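/- Let $X$ be a complex Banach space, $\tau>0$, $k\in L^1_{loc}([0,\infty))$ (complex valued) with $0\in\mathrm{supp}(k)$, and let $A$ be a closed linear operator in $X$. Let $(S_k(t))_{t\in[0,\tau]}\subset\mathcal B(X)$ be a non-degenerate local $k$-convoluted semigroup generated by $A$, i.e. $t\mapsto S_k(t)$ is strongly continuous, $S_k(t)A\subset AS_k(t)$, $\int_0^tS_k(s)x\,ds\in D(A)$ and $A\int_0^tS_k(s)x\,ds=S_k(t)x-\int_0^tk(s)\,ds\,x$ for $t\in[0,\tau]$, $x\in X$, and $S_k(t)x=0$ for all $t\in[0,\tau]$ implies $x=0$. Write $(f*g)(t)=\int_0^tf(t-s)g(s)\,ds$, $k^{*1}=k$, $k^{*(n+1)}=k*k^{*n}$, and $(k\circ g)(t)=\int_t^\infty k(s-t)g(s)\,ds$ for $t\ge0$. Let $S_{k^{*1}}=S_k$ and, for $n\ge1$ and $x\in X$, define $$S_{k^{*(n+1)}}(t)x=\int_0^tk(t-s)S_{k^{*n}}(s)x\,ds,\qquad t\in[0,n\tau],$$ $$S_{k^{*(n+1)}}(t)x=S_{k^{*n}}(n\tau)S_k(t-n\tau)x+\int_0^{n\tau}k(t-s)S_{k^{*n}}(s)x\,ds+\int_0^{t-n\tau}k^{*n}(t-s)S_k(s)x\,ds,\qquad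 t\in(n\tau,(n+1)\tau].$$ Let $\mathcal D_+$ be the space of restrictions to $[0,\infty)$ of functions in $C_c^\infty(\mathbb R)$, $\mathcal D_{k^{*n}}=\{k^{*n}\circ g: g\in\mathcal D_+\}$, $W_{k^{*n}}:\mathcal D_{k^{*n}}\to\mathcal D_+$ the inverse of the (injective) map $g\mapsto k^{*n}\circ g$ on $\mathcal D_+$, and $\mathcal D_{k^{*\infty}}=\bigcap_{n\ge1}\mathcal D_{k^{*n}}$. For $a\in\mathbb R$, the space $\{f\in\mathcal D_{k^{*\infty}}:\mathrm{supp}(f)\subset[0,a]\}$ carries the topology of the seminorms $\sup_{t\ge0}|(W_{k^{*n}}f)^{(i)}(t)|$, $n\ge1$, $i\ge0$ (the projective limit topology over $n$, where $\mathcal D_{k^{*n}}$ carries the topology of $\mathcal D_+$ transported by $W_{k^{*n}}$), and $\mathcal D_{k^{*\infty}}$ carries the locally convex inductive limit topology over $a$. Define $$\mathcal G_k(f)x=\int_0^{n\tau}W_{k^{*n}}f(t)\,S_{k^{*n}}(t)x\,dt,\qquad x\in X,\ f\in\mathcal D_{k^{*\infty}},$$ where $n\ge1$ is such that $\mathrm{supp}(f)\subset[0,n\tau]$.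 Then: (i) $\mathcal G_k:\mathcal D_{k^{*\infty}}\to\mathcal B(X)$ is well defined (such an $n$ exists, the integrals exist and do not depend on the choice of $n$, and $\mathcal G_k(f)\in\mathcal B(X)$), linear, and continuous for the operator norm of $\mathcal B(X)$. (ii) For $f,g\in\mathcal D_{k^{*\infty}}$ one has $f*g\in\mathcal D_{k^{*\infty}}$ and $\mathcal G_k(f*g)=\mathcal G_k(f)\mathcal G_k(g)$. (iii) For $f\in\mathcal D_{k^{*\infty}}$ and $x\in X$ one has $f'\in\mathcal D_{k^{*\infty}}$, $\mathcal G_k(f)x\in D(A)$ and $A\mathcal G_k(f)x=-\mathcal G_k(f')x-f(0)x$. -/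

import Mathlib

open MeasureTheory Set Topology

noncomputable section

/-! Functions on `ℝ⁺ = [0, ∞)` are modelled as functions on `ℝ`: of a kernel `k` only the values on
`[0, ∞)` are used, and a test function on `[0, ∞)` is extended by `0` to `(-∞, 0)`. -/

namespace ConvSemigroup

/-- `k ∈ L¹_loc(ℝ⁺)`, with `ℝ⁺ = [0, ∞)`. -/
def LOneLoc (k : ℝ → ℂ) : Prop := LocallyIntegrableOn k (Ici 0)

/-- `0 ∈ supp k` for (the class of) a locally integrable function on `ℝ⁺`. -/
def ZeroMemSupp (k : ℝ → ℂ) : Prop :=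
  ∀ ε : ℝ, 0 < ε → ¬ ∀ᵐ t : ℝ, t ∈ Ioo 0 ε → k t = 0

/-- The convolution product `(f * g)(t) = ∫₀ᵗ f(t - s) g(s) ds` on `ℝ⁺`. -/
def conv (f g : ℝ → ℂ) (t : ℝ) : ℂ := ∫ s in (0 : ℝ)..t, f (t - s) * g s

/-- The convolution power `k^{*n}`, for `n ≥ 1` (the value at `n = 0` is never used). -/
def convPow (k : ℝ → ℂ) : ℕ → ℝ → ℂ
  | 0 => 0
  | 1 => k
  | n + 2 => conv k (convPow k (n + 1))

/-- The dual convolution product `(k ∘ g)(t) = ∫ₜ^∞ k(s - t) g(s) ds`, `t ≥ 0`. -/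
def dualConv (k g : ℝ → ℂ) : ℝ → ℂ :=
  (Ici (0 : ℝ)).indicator fun t => ∫ s in Ioi t, k (s - t) * g s

/-- The space `𝒟₊` of restrictions to `[0, ∞)` of smooth compactly supported functions on `ℝ`. -/
def DPlus : Submodule ℂ (ℝ → ℂ) where
  carrier := {f | ∃ φ : ℝ → ℂ, ContDiff ℝ (⊤ : ℕ∞) φ ∧ HasCompactSupport φ ∧
    f = (Ici (0 : ℝ)).indicator φ}
  add_mem' := by
    rintro _ _ ⟨φ, hφ, hφc, rfl⟩ ⟨ψ, hψ, hψc, rfl⟩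
    exact ⟨φ + ψ, hφ.add hψ, hφc.add hψc, (indicator_add' _ _ _).symm⟩
  zero_mem' := ⟨0, contDiff_const, HasCompactSupport.zero, by simp⟩
  smul_mem' := by
    rintro c _ ⟨φ, hφ, hφc, rfl⟩
    refine ⟨c • φ, hφ.const_smul c, hφc.smul_left (f := fun _ => c), ?_⟩
    ext t
    by_cases ht : t ∈ Ici (0 : ℝ) <;> simp [ht]

/-- The derivative on `[0, ∞)` (one-sided at `0`) of a function on `[0, ∞)`. -/
def derivPlus (f : ℝ → ℂ) : ℝ → ℂ := (Ici (0 : ℝ)).indicator (derivWithin f (Ici 0))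

lemma LOneLoc.integrableOn_Ioc {k : ℝ → ℂ} (hk : LOneLoc k) (T : ℝ) :
    IntegrableOn k (Ioc 0 T) :=
  (hk.integrableOn_compact_subset (t := Icc 0 T) (fun _ h => h.1) isCompact_Icc).mono_set
    Ioc_subset_Icc_self

lemma LOneLoc.conv {f g : ℝ → ℂ} (hf : LOneLoc f) (hg : LOneLoc g) : LOneLoc (conv f g) := by
  have key : ∀ T : ℝ, IntegrableOn (ConvSemigroup.conv f g) (Icc 0 T) := by
    intro T
    rw [integrableOn_Icc_iff_integrableOn_Ioc]
    have hf1 := (hf.integrableOn_Ioc T).integrable_indicator measurableSet_Ioc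
    have hg1 := (hg.integrableOn_Ioc T).integrable_indicator measurableSet_Ioc
    have hc := (hg1.integrable_convolution (ContinuousLinearMap.mul ℂ ℂ) hf1).integrableOn
      (s := Ioc 0 T)
    refine hc.congr_fun ?_ measurableSet_Ioc
    intro t ht
    have h1 : ∀ s, (ContinuousLinearMap.mul ℂ ℂ) ((Ioc 0 T).indicator g s)
        ((Ioc 0 T).indicator f (t - s)) =
        (Ioo 0 t).indicator (fun s => f (t - s) * g s) s := by
      intro s
      by_cases hs : s ∈ Ioo 0 t
      · have h2 : s ∈ Ioc 0 T := ⟨hs.1, hs.2.le.trans ht.2⟩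
        have h3 : t - s ∈ Ioc 0 T := ⟨by linarith [hs.2], by linarith [hs.1, ht.2]⟩
        simp only [indicator_of_mem hs, indicator_of_mem h2, indicator_of_mem h3,
          ContinuousLinearMap.mul_apply']
        ring
      · rw [indicator_of_notMem hs]
        by_cases h2 : s ∈ Ioc 0 T
        · have h3 : t - s ∉ Ioc 0 T := fun h3 => hs ⟨h2.1, by linarith [h3.1]⟩
          rw [indicator_of_notMem h3, map_zero]
        · rw [indicator_of_notMem h2, map_zero, zero_apply]
    simp only [MeasureTheory.convolution, h1, ConvSemigroup.conv]
    rw [integral_indicator measurableSet_Ioo, intervalIntegral.integral_of_le ht.1.le,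
      integral_Ioc_eq_integral_Ioo]
  refine (locallyIntegrableOn_iff isClosed_Ici.isLocallyClosed).2 fun K hK hKc => ?_
  obtain ⟨T, hT⟩ := hKc.bddAbove
  exact (key T).mono_set fun x hx => ⟨hK hx, hT hx⟩

lemma LOneLoc.convPow {k : ℝ → ℂ} (hk : LOneLoc k) (n : ℕ) :
    LOneLoc (convPow k (n + 1)) := by
  induction n with
  | zero => exact hk
  | succ n ih => exact hk.conv ih

lemma integrableOn_dualConv {k g : ℝ → ℂ} (hk : LOneLoc k) (hg : g ∈ DPlus) {t : ℝ}
    (ht : 0 ≤ t) : IntegrableOn (fun s => k (s - t) * g s) (Ioi t) := by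
  obtain ⟨φ, hφ, hφc, rfl⟩ := hg
  obtain ⟨T, hT⟩ := hφc.isCompact.bddAbove
  obtain ⟨C, hC⟩ := hφc.exists_bound_of_continuous hφ.continuous
  have h1 := ((hk.integrableOn_Ioc (T - t)).integrable_indicator measurableSet_Ioc).comp_sub_right t
  have h2 := h1.mul_bdd (c := C) hφ.continuous.aestronglyMeasurable (ae_of_all _ hC)
  refine (h2.integrableOn (s := Ioi t)).congr_fun ?_ measurableSet_Ioi
  intro s hs
  have hs' : t < s := hs
  have h0 : s ∈ Ici (0 : ℝ) := ht.trans hs'.le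
  simp only [indicator_of_mem h0]
  by_cases h : s ≤ T
  · rw [indicator_of_mem (show s - t ∈ Ioc 0 (T - t) from ⟨by linarith, by linarith⟩)]
  · have : φ s = 0 := image_eq_zero_of_notMem_tsupport fun hm => h (hT hm)
    simp [this]

lemma dualConv_add {k g h : ℝ → ℂ} (hk : LOneLoc k) (hg : g ∈ DPlus) (hh : h ∈ DPlus) :
    dualConv k (g + h) = dualConv k g + dualConv k h := by
  ext t
  by_cases ht : t ∈ Ici (0 : ℝ)
  · simp only [dualConv, indicator_of_mem ht, Pi.add_apply, mul_add]
    exact integral_add (integrableOn_dualConv hk hg ht) (integrableOn_dualConv hk hh ht)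
  · simp [dualConv, indicator_of_notMem ht]

lemma dualConv_smul {k g : ℝ → ℂ} (c : ℂ) : dualConv k (c • g) = c • dualConv k g := by
  ext t
  by_cases ht : t ∈ Ici (0 : ℝ)
  · simp only [dualConv, indicator_of_mem ht, Pi.smul_apply, smul_eq_mul, mul_left_comm _ c]
    exact integral_const_mul _ _
  · simp [dualConv, indicator_of_notMem ht]

/-- The space `𝒟_k`, the image of `𝒟₊` under `g ↦ k ∘ g`. -/
def DK (k : ℝ → ℂ) (hk : LOneLoc k) : Submodule ℂ (ℝ → ℂ) where
  carrier := {f | ∃ g ∈ DPlus, dualConv k g = f}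
  add_mem' := by
    rintro _ _ ⟨g, hg, rfl⟩ ⟨h, hh, rfl⟩
    exact ⟨g + h, DPlus.add_mem hg hh, dualConv_add hk hg hh⟩
  zero_mem' := ⟨0, DPlus.zero_mem, by ext t; simp [dualConv, indicator]⟩
  smul_mem' := by
    rintro c _ ⟨g, hg, rfl⟩
    exact ⟨c • g, DPlus.smul_mem c hg, dualConv_smul c⟩

/-- The map `W_k : 𝒟_k → 𝒟₊`, the inverse of `g ↦ k ∘ g` on `𝒟₊` (injective if `0 ∈ supp k`). -/
def W (k f : ℝ → ℂ) : ℝ → ℂ := Function.invFunOn (dualConv k) (DPlus : Set (ℝ → ℂ)) f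

/-- The space `𝒟_{k^{*∞}} = ⋂_{n ≥ 1} 𝒟_{k^{*n}}`. -/
def DKInf (k : ℝ → ℂ) (hk : LOneLoc k) : Submodule ℂ (ℝ → ℂ) :=
  ⨅ n : ℕ, DK (convPow k (n + 1)) (hk.convPow n)

/-- `supp f ⊆ [0, a]` for a function `f` on `[0, ∞)`. -/
def SuppIn (f : ℝ → ℂ) (a : ℝ) : Prop := ∀ t, 0 ≤ t → a < t → f t = 0

/-- The (Fréchet) topology on `{f ∈ 𝒟_{k^{*∞}} | supp f ⊆ [0, a]}`: it is given by the seminorms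
`sup_{t ≥ 0} |(W_{k^{*n}} f)^{(i)}(t)|`, `n ≥ 1`, `i ≥ 0`; that is, it is the projective limit
topology when every `𝒟_{k^{*n}}` carries the topology of `𝒟₊`, transported by `W_{k^{*n}}`. -/
@[reducible] def stepTopology (k : ℝ → ℂ) (hk : LOneLoc k) (a : ℝ) :
    TopologicalSpace {f : DKInf k hk // SuppIn (f : ℝ → ℂ) a} :=
  ⨅ (n : ℕ) (i : ℕ), TopologicalSpace.induced
    (fun f => UniformFun.ofFun fun t : Ici (0 : ℝ) =>
      iteratedDerivWithin i (W (convPow k (n + 1)) (f : DKInf k hk)) (Ici 0) (t : ℝ))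
    (inferInstance : TopologicalSpace (UniformFun (Ici (0 : ℝ)) ℂ))

/-- The topology of `𝒟_{k^{*∞}}`: the locally convex inductive limit, over the supports `[0, a]`,
of the spaces above, i.e. the finest locally convex vector topology for which the inclusions of
all these spaces are continuous. -/
@[reducible] def topologyDKInf (k : ℝ → ℂ) (hk : LOneLoc k) : TopologicalSpace (DKInf k hk) :=
  sInf {t | @IsTopologicalAddGroup (DKInf k hk) t _ ∧ @ContinuousSMul ℂ (DKInf k hk) _ _ t ∧
    @LocallyConvexSpace ℝ (DKInf k hk) _ _ _ _ t ∧
    ∀ a : ℝ, Continuous[stepTopology k hk a, t] (fun f => (f : DKInf k hk))}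

variable {X : Type*} [NormedAddCommGroup X] [NormedSpace ℂ X]

/-- `(S(t))_{t ∈ [0, τ]}` is a local `k`-convoluted semigroup generated by `A`. -/
structure IsLocalConvSemigroup (k : ℝ → ℂ) (τ : ℝ) (S : ℝ → X →L[ℂ] X) (A : X →ₗ.[ℂ] X) :
    Prop where
  /-- `A` is a closed operator. -/
  closed : A.IsClosed
  /-- Strong continuity. -/
  continuousOn : ∀ x, ContinuousOn (fun t => S t x) (Icc 0 τ)
  /-- `S(t) A ⊆ A S(t)`. -/
  commute : ∀ t ∈ Icc 0 τ, ∀ x : A.domain,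
    ∃ h : S t x ∈ A.domain, A ⟨S t x, h⟩ = S t (A x)
  /-- `A ∫₀ᵗ S(s)x ds = S(t)x - ∫₀ᵗ k(s) ds x`. -/
  integral_eq : ∀ t ∈ Icc 0 τ, ∀ x : X,
    ∃ h : (∫ s in (0 : ℝ)..t, S s x) ∈ A.domain,
      A ⟨∫ s in (0 : ℝ)..t, S s x, h⟩ = S t x - (∫ s in (0 : ℝ)..t, k s) • x

/-- Non-degeneracy of `(S(t))_{t ∈ [0, τ]}`. -/
def NonDegenerate (τ : ℝ) (S : ℝ → X →L[ℂ] X) : Prop :=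
  ∀ x : X, (∀ t ∈ Icc 0 τ, S t x = 0) → x = 0

/-- The extended family `(S_{k^{*n}}(t))_{t ∈ [0, nτ]}`, `n ≥ 1`, built from `(S(t))_{t ∈ [0, τ]}`
(the value at `n = 0` is never used). -/
def extFamily (k : ℝ → ℂ) (τ : ℝ) (S : ℝ → X →L[ℂ] X) : ℕ → ℝ → X → X
  | 0 => fun _ _ => 0
  | 1 => fun t x => S t x
  | n + 2 => fun t x =>
    if t ≤ (n + 1) * τ then
      ∫ s in (0 : ℝ)..t, k (t - s) • extFamily k τ S (n + 1) s x
    else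
      extFamily k τ S (n + 1) ((n + 1) * τ) (S (t - (n + 1) * τ) x)
        + (∫ s in (0 : ℝ)..((n + 1) * τ), k (t - s) • extFamily k τ S (n + 1) s x)
        + ∫ s in (0 : ℝ)..(t - (n + 1) * τ), convPow k (n + 1) (t - s) • S s x

end ConvSemigroup

end

/-!
Write `k_n = k^{*n}` and `S_n = S_{k^{*n}}`. Three facts carry the argument.

*Injectivity of convolution.* If `0 ∈ supp k`, then convolution with `k` is injective on continuous
functions on `[0, T]` (`eq_zero_of_conv`), by the Titchmarsh convolution theorem
(`titchmarsh_of_continuous`). The latter is proved with real variable methods: a continuous function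
whose exponential moments `∫ e^{nx} h` stay bounded is zero; this gives the case `f * f = 0`, and
the general case follows from the statement that `f * g = 0` on `[0, T]` implies `f * (x g) = 0` on
`[0, cT]`, whose constant can be improved from `c` to `(1 + c²) / 2` and hence to `1`. Reflection
`u ↦ L - u` turns the dual convolution `k ∘ g` into an ordinary convolution, so `g ↦ k ∘ g` is
injective on `𝒟₊` and does not shrink supports (`dualConv_injOn`, `suppIn_of_dualConv`); the `k_n`
inherit `0 ∈ supp k_n`.

*Extension.* `S_n` is a local `k_n`-convoluted semigroup on `[0, nτ]` generated by `A`
(`exists_extension`, `exists_extFamily_clm`). All computations with the closed operator `A` take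
place in its graph, which is a closed subspace and so contains the integrals and convolutions of
functions with values in it.

*Uniqueness.* The only mild solution of `v' = A v`, `v(0) = 0`, on `[0, nτ]` is `0`
(`mild_solution_eq_zero`); this combines the existence of `S_n` with the injectivity of convolution.

For `f` supported in `[0, nτ]` put `F = W_{k_n} f`, so that `f = k_n ∘ F`. In reflected form
`𝒢_k(f) x` is the value at `L = nτ` of the convolution of `t ↦ F(L - t)` with `S_n(·) x`. Passing
from `n` to `n + 1` moves one factor `k` from the test function to the semigroup, so independence of
`n` is associativity of convolution (`testAverage_succ`). The formula for `A 𝒢_k(f)` follows from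
`A ∫ S_n = S_n - ∫ k_n` by integration by parts (`average_derivPlus_mem_graph`). For
multiplicativity, `v_F(t) = ∫₀ᵗ F(L - t + s) S_n(s)x ds` is a mild solution of the inhomogeneous
problem `v' = A v + f(L - t) x`; for test functions whose supports add up to at most `L`, both
`𝒢_k(f * g) x` and `𝒢_k(f) 𝒢_k(g) x` are end values of mild solutions of one such problem, and
uniqueness applies (`average_mul`). That `𝒟_{k^{*∞}}` is closed under convolution comes from the
identity `k ∘ (F * g) = (k ∘ F) * g + q ∘ g` with a suitable kernel `q` (`exists_dualConv_conv_eq`).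

Continuity: the topology that `𝒢_k` induces on `𝒟_{k^{*∞}}` is a locally convex vector topology,
so by the definition of the inductive limit it is enough to bound `𝒢_k` on functions supported in a
fixed `[0, a]`, where the single seminorm `sup |W_{k_n} f|` with `a ≤ nτ` suffices.
-/

namespace ConvSemigroup

variable {E : Type*} [NormedAddCommGroup E]

/-! ### Convolution on the half-line with a vector-valued factor -/

/-- `F` is bounded and measurable on `(0, T]`: the class of right factors for which convolutions
with locally integrable kernels exist at every point of `[0, T]`. -/
structure BddMeasOn (F : ℝ → E) (T : ℝ) : Prop where
  aesm : AEStronglyMeasurable F (volume.restrict (Ioc 0 T))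
  bdd : ∃ C, ∀ s ∈ Ioc 0 T, ‖F s‖ ≤ C

lemma _root_.ContinuousOn.bddMeasOn {F : ℝ → E} {T : ℝ} (hF : ContinuousOn F (Icc 0 T)) :
    BddMeasOn F T where
  aesm := (hF.mono Ioc_subset_Icc_self).aestronglyMeasurable measurableSet_Ioc
  bdd := by
    obtain ⟨C, hC⟩ := isCompact_Icc.exists_bound_of_continuousOn hF
    exact ⟨C, fun s hs => hC s (Ioc_subset_Icc_self hs)⟩

lemma BddMeasOn.mono {F : ℝ → E} {T T' : ℝ} (hF : BddMeasOn F T) (h : T' ≤ T) :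
    BddMeasOn F T' where
  aesm := hF.aesm.mono_set (Ioc_subset_Ioc_right h)
  bdd := let ⟨C, hC⟩ := hF.bdd; ⟨C, fun s hs => hC s (Ioc_subset_Ioc_right h hs)⟩

lemma bddMeasOn_const (c : E) (T : ℝ) : BddMeasOn (fun _ => c) T :=
  continuousOn_const.bddMeasOn

lemma BddMeasOn.intervalIntegrable {F : ℝ → E} {T : ℝ} (hF : BddMeasOn F T) {b c : ℝ}
    (hb : b ∈ Icc 0 T) (hc : c ∈ Icc 0 T) : IntervalIntegrable F volume b c := by
  obtain ⟨C, hC⟩ := hF.bdd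
  have h : IntegrableOn F (Ioc 0 T) :=
    ⟨hF.aesm, .restrict_of_bounded C measure_Ioc_lt_top
      ((ae_restrict_iff' measurableSet_Ioc).2 (ae_of_all _ hC))⟩
  have h2 : IntervalIntegrable F volume 0 T :=
    (intervalIntegrable_iff_integrableOn_Ioc_of_le (hb.1.trans hb.2)).2 h
  refine h2.mono_set ?_
  rw [uIcc_of_le (hb.1.trans hb.2)]
  exact uIcc_subset_Icc hb hc

lemma LOneLoc.intervalIntegrable {a : ℝ → ℂ} (ha : LOneLoc a) {b c : ℝ} (hb : 0 ≤ b)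
    (hc : 0 ≤ c) : IntervalIntegrable a volume b c :=
  intervalIntegrable_iff.2 ((ha.integrableOn_Ioc (max b c)).mono_set
    (Ioc_subset_Ioc_left (le_min hb hc)))

lemma LOneLoc.shift {a : ℝ → ℂ} (ha : LOneLoc a) {c : ℝ} (hc : 0 ≤ c) :
    LOneLoc (fun u => a (u + c)) := by
  refine (locallyIntegrableOn_iff isClosed_Ici.isLocallyClosed).2 fun K hK hKc => ?_
  obtain ⟨T, hT⟩ := hKc.bddAbove
  rcases K.eq_empty_or_nonempty with rfl | ⟨x, hx⟩
  · simp
  have hT0 : 0 ≤ T := (hK hx).trans (hT hx)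
  have h := (ha.intervalIntegrable hc (show 0 ≤ T + c by linarith)).comp_add_right c
  rw [sub_self, add_sub_cancel_right] at h
  have h2 := (intervalIntegrable_iff_integrableOn_Ioc_of_le hT0).1 h
  rw [← integrableOn_Icc_iff_integrableOn_Ioc] at h2
  exact h2.mono_set fun y hy => ⟨hK hy, hT hy⟩

lemma LOneLoc.of_continuousOn {a : ℝ → ℂ} (ha : ContinuousOn a (Ici 0)) : LOneLoc a :=
  ha.locallyIntegrableOn measurableSet_Ici

lemma lOneLoc_const (c : ℂ) : LOneLoc fun _ => c := .of_continuousOn continuousOn_const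

variable [NormedSpace ℂ E]

/-- The convolution `(a * F)(t) = ∫₀ᵗ a(t - s) F(s) ds` of a scalar function with a vector-valued
one; for `E = ℂ` it is definitionally `conv`. -/
noncomputable def vconv (a : ℝ → ℂ) (F : ℝ → E) (t : ℝ) : E := ∫ s in (0 : ℝ)..t, a (t - s) • F s

lemma conv_eq_vconv (f g : ℝ → ℂ) : conv f g = vconv f g := rfl

/-- Integrability of the integrand in the definition of `vconv`. -/
lemma vconv_integrable {a : ℝ → ℂ} {F : ℝ → E} {T t : ℝ} (ha : LOneLoc a) (hF : BddMeasOn F T)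
    (ht : t ∈ Icc 0 T) : IntervalIntegrable (fun s => a (t - s) • F s) volume 0 t := by
  have h1 : IntervalIntegrable (fun s => a (t - s)) volume 0 t := by
    simpa using ((ha.intervalIntegrable le_rfl ht.1).comp_sub_left t).symm
  rw [intervalIntegrable_iff_integrableOn_Ioc_of_le ht.1] at h1 ⊢
  obtain ⟨C, hC⟩ := hF.bdd
  exact Integrable.smul_bdd h1 C (hF.mono ht.2).aesm
    ((ae_restrict_iff' measurableSet_Ioc).2
      (ae_of_all _ fun s hs => hC s ⟨hs.1, hs.2.trans ht.2⟩))

lemma vconv_eq_integral_comp_sub (a : ℝ → ℂ) (F : ℝ → E) (t : ℝ) :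
    vconv a F t = ∫ s in (0 : ℝ)..t, a s • F (t - s) := by
  have := intervalIntegral.integral_comp_sub_left (fun s => a s • F (t - s)) (a := 0) (b := t) t
  simpa [vconv] using this

lemma conv_comm (f g : ℝ → ℂ) : conv f g = conv g f := by
  ext t
  rw [conv_eq_vconv, vconv_eq_integral_comp_sub, conv]
  simp only [smul_eq_mul, mul_comm]

@[simp] lemma vconv_zero_right_time (a : ℝ → ℂ) (F : ℝ → E) : vconv a F 0 = 0 := by
  simp [vconv]

lemma vconv_congr {a b : ℝ → ℂ} {F G : ℝ → E} {t : ℝ} (ht : 0 ≤ t)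
    (hab : ∀ s ∈ Icc 0 t, a s = b s) (hFG : ∀ s ∈ Icc 0 t, F s = G s) :
    vconv a F t = vconv b G t := by
  refine intervalIntegral.integral_congr fun s hs => ?_
  rw [uIcc_of_le ht] at hs
  rw [hab (t - s) ⟨by linarith [hs.2], by linarith [hs.1]⟩, hFG s hs]

lemma vconv_sub_right {a : ℝ → ℂ} {F G : ℝ → E} {T t : ℝ} (ha : LOneLoc a) (hF : BddMeasOn F T)
    (hG : BddMeasOn G T) (ht : t ∈ Icc 0 T) :
    vconv a (fun s => F s - G s) t = vconv a F t - vconv a G t := by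
  simp only [vconv, smul_sub]
  exact intervalIntegral.integral_sub (vconv_integrable ha hF ht) (vconv_integrable ha hG ht)

lemma vconv_smul_const [CompleteSpace E] (a f : ℝ → ℂ) (x : E) (t : ℝ) :
    vconv a (fun s => f s • x) t = conv a f t • x := by
  simp only [vconv, conv, smul_smul]
  exact intervalIntegral.integral_smul_const _ _

lemma vconv_one_left (F : ℝ → E) (t : ℝ) :
    vconv (fun _ => 1) F t = ∫ s in (0 : ℝ)..t, F s := by simp [vconv]

/-- Interchange of the order of integration over the triangle `0 < u < s ≤ t`. -/
lemma integral_triangle_swap {φ : ℝ → ℝ → E} {t : ℝ} (ht : 0 ≤ t)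
    (h : Integrable ({p : ℝ × ℝ | 0 < p.2 ∧ p.2 < p.1 ∧ p.1 ≤ t}.indicator
      (Function.uncurry φ)) (volume.prod volume)) :
    ∫ s in (0 : ℝ)..t, ∫ u in (0 : ℝ)..s, φ s u = ∫ u in (0 : ℝ)..t, ∫ s in u..t, φ s u := by
  set D : Set (ℝ × ℝ) := {p : ℝ × ℝ | 0 < p.2 ∧ p.2 < p.1 ∧ p.1 ≤ t}
  have hsw := integral_integral_swap (f := fun s u => D.indicator (Function.uncurry φ) (s, u)) h
  have h1 : ∀ s, ∫ u, D.indicator (Function.uncurry φ) (s, u) =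
      (Ioc 0 t).indicator (fun s => ∫ u in (0 : ℝ)..s, φ s u) s := by
    intro s
    by_cases hs : s ∈ Ioc 0 t
    · rw [indicator_of_mem hs, intervalIntegral.integral_of_le hs.1.le,
        integral_Ioc_eq_integral_Ioo, ← integral_indicator measurableSet_Ioo]
      congr 1 with u
      by_cases hu : u ∈ Ioo 0 s
      · rw [indicator_of_mem hu, indicator_of_mem (show (s, u) ∈ D from ⟨hu.1, hu.2, hs.2⟩)]
        rfl
      · rw [indicator_of_notMem hu,
          indicator_of_notMem (fun h : (s, u) ∈ D => hu ⟨h.1, h.2.1⟩)]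
    · rw [indicator_of_notMem hs, ← integral_zero ℝ E (μ := volume)]
      congr 1 with u
      exact indicator_of_notMem
        (fun h : (s, u) ∈ D => hs ⟨lt_trans h.1 h.2.1, h.2.2⟩) _
  have h2 : ∀ u, ∫ s, D.indicator (Function.uncurry φ) (s, u) =
      (Ioc 0 t).indicator (fun u => ∫ s in u..t, φ s u) u := by
    intro u
    by_cases hu : u ∈ Ioc 0 t
    · rw [indicator_of_mem hu, intervalIntegral.integral_of_le hu.2,
        ← integral_indicator measurableSet_Ioc]
      congr 1 with s
      by_cases hs : s ∈ Ioc u t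
      · rw [indicator_of_mem hs, indicator_of_mem (show (s, u) ∈ D from ⟨hu.1, hs.1, hs.2⟩)]
        rfl
      · rw [indicator_of_notMem hs,
          indicator_of_notMem (fun h : (s, u) ∈ D => hs ⟨h.2.1, h.2.2⟩)]
    · rw [indicator_of_notMem hu, ← integral_zero ℝ E (μ := volume)]
      congr 1 with s
      exact indicator_of_notMem
        (fun h : (s, u) ∈ D => hu ⟨h.1, (h.2.1.trans_le h.2.2).le⟩) _
  simp only [h1, h2] at hsw
  rw [integral_indicator measurableSet_Ioc, integral_indicator measurableSet_Ioc] at hsw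
  rw [intervalIntegral.integral_of_le ht, intervalIntegral.integral_of_le ht, hsw]

/-- Associativity of convolution, valid at every point since the last factor is bounded. -/
lemma vconv_assoc [CompleteSpace E] {a b : ℝ → ℂ} {F : ℝ → E} {T t : ℝ} (ha : LOneLoc a)
    (hb : LOneLoc b) (hF : BddMeasOn F T) (ht : t ∈ Icc 0 T) :
    vconv a (vconv b F) t = vconv (conv a b) F t := by
  have hF' := hF.mono ht.2
  obtain ⟨C, hC⟩ := hF'.bdd
  set a' := (Ioc 0 t).indicator a
  set b' := (Ioc 0 t).indicator b
  set F' := (Ioc 0 t).indicator F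
  have ha' : Integrable a' := (ha.integrableOn_Ioc t).integrable_indicator measurableSet_Ioc
  have hb' : Integrable b' := (hb.integrableOn_Ioc t).integrable_indicator measurableSet_Ioc
  have hFm : AEStronglyMeasurable F' volume :=
    (aestronglyMeasurable_indicator_iff measurableSet_Ioc).2 hF'.aesm
  have hFC : ∀ s, ‖F' s‖ ≤ max C 0 := by
    intro s
    by_cases hs : s ∈ Ioc 0 t
    · simpa [F', indicator_of_mem hs] using Or.inl (hC s hs)
    · simp [F', indicator_of_notMem hs]
  have hint : Integrable (fun p : ℝ × ℝ => (a' (t - p.1) * b' (p.1 - p.2)) • F' p.2)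
      (volume.prod volume) := by
    have h1 := ((ha'.comp_sub_left t).convolution_integrand (ContinuousLinearMap.mul ℂ ℂ)
      hb'.comp_neg).swap
    have h2 : AEStronglyMeasurable (fun p : ℝ × ℝ => F' p.2) (volume.prod volume) :=
      hFm.comp_snd
    refine (h1.smul_bdd (max C 0) h2 (ae_of_all _ fun p => hFC _)).congr (ae_of_all _ fun p => ?_)
    simp [Function.comp]
  have hD : MeasurableSet {p : ℝ × ℝ | 0 < p.2 ∧ p.2 < p.1 ∧ p.1 ≤ t} :=
    (measurableSet_lt measurable_const measurable_snd).inter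
      ((measurableSet_lt measurable_snd measurable_fst).inter
        (measurableSet_le measurable_fst measurable_const))
  have hsw := integral_triangle_swap (φ := fun s u => (a (t - s) * b (s - u)) • F u) ht.1 (by
    refine (hint.indicator hD).congr ?_
    -- the truncated and the original integrand differ only on the null set `p.1 = t`
    have hne : ∀ᵐ p : ℝ × ℝ ∂(volume.prod volume), p.1 ≠ t :=
      Measure.quasiMeasurePreserving_fst.ae (p := fun x => x ≠ t) (Measure.ae_ne volume t)
    filter_upwards [hne] with p hp
    by_cases hpD : p ∈ {p : ℝ × ℝ | 0 < p.2 ∧ p.2 < p.1 ∧ p.1 ≤ t}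
    · rw [indicator_of_mem hpD, indicator_of_mem hpD]
      obtain ⟨h1, h2, h3⟩ := hpD
      have h3' := lt_of_le_of_ne h3 hp
      simp only [a', b', F', Function.uncurry]
      rw [indicator_of_mem (by constructor <;> linarith),
        indicator_of_mem (by constructor <;> linarith),
        indicator_of_mem (by constructor <;> linarith)]
    · rw [indicator_of_notMem hpD, indicator_of_notMem hpD])
  have hl : vconv a (vconv b F) t =
      ∫ s in (0 : ℝ)..t, ∫ u in (0 : ℝ)..s, (a (t - s) * b (s - u)) • F u := by
    simp only [vconv, mul_smul, intervalIntegral.integral_smul]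
  rw [hl, hsw]
  refine intervalIntegral.integral_congr fun u _ => ?_
  rw [intervalIntegral.integral_smul_const, conv]
  congr 1
  have := intervalIntegral.integral_comp_sub_right
    (fun s => a (t - u - s) * b s) (a := u) (b := t) u
  rw [sub_self] at this
  rw [← this]
  exact intervalIntegral.integral_congr fun s _ => by
    congr 2; ring

/-! ### The Titchmarsh convolution theorem -/

/-- Expansion of `∫ exp(φ) h` into the moments `∫ φ ^ j h`. -/
lemma hasSum_integral_exp_mul {φ h : ℝ → ℂ} (hφ : Continuous φ) (hh : Continuous h) {T : ℝ}
    (hT : 0 ≤ T) :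
    HasSum (fun j : ℕ => ∫ x in (0 : ℝ)..T, φ x ^ j / (j.factorial : ℂ) * h x)
      (∫ x in (0 : ℝ)..T, Complex.exp (φ x) * h x) := by
  obtain ⟨M, hM⟩ := isCompact_Icc.exists_bound_of_continuousOn (s := Icc 0 T) hφ.continuousOn
  obtain ⟨C, hC⟩ := isCompact_Icc.exists_bound_of_continuousOn (s := Icc 0 T) hh.continuousOn
  have hM0 : 0 ≤ M := (norm_nonneg _).trans (hM 0 ⟨le_rfl, hT⟩)
  refine intervalIntegral.hasSum_integral_of_dominated_convergence
    (fun j _ => M ^ j / (j.factorial : ℝ) * C) (fun j => ?_) (fun j => ?_) ?_ ?_ ?_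
  · exact (by fun_prop : Continuous fun x => φ x ^ j / (j.factorial : ℂ) * h x).aestronglyMeasurable
  · refine ae_of_all _ fun x hx => ?_
    rw [uIoc_of_le hT] at hx
    have hx' := Ioc_subset_Icc_self hx
    rw [norm_mul, norm_div, norm_pow, RCLike.norm_natCast]
    gcongr
    · exact hM x hx'
    · exact hC x hx'
  · exact ae_of_all _ fun x _ => (Real.summable_pow_div_factorial M).mul_right C
  · simp
  · refine ae_of_all _ fun x _ => ?_
    rw [Complex.exp_eq_exp_ℂ]
    exact (NormedSpace.expSeries_div_hasSum_exp (φ x)).mul_right _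

/-- A continuous function all of whose exponential moments `∫₀ᵀ e^{nx} h(x) dx`, `n ∈ ℕ`, are
bounded by the same constant vanishes on `[0, T]`. -/
lemma eqOn_zero_of_exp_moments_bounded {h : ℝ → ℂ} (hh : Continuous h) {T M : ℝ}
    (hT : 0 < T)
    (hM : ∀ n : ℕ, ‖∫ x in (0 : ℝ)..T, Complex.exp (n * x) * h x‖ ≤ M) :
    EqOn h 0 (Icc 0 T) := by
  have key : ∀ t ∈ Ioc 0 T, ∫ x in (0 : ℝ)..t, h x = ∫ x in (0 : ℝ)..T, h x := by
    intro t ht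
    -- `exp(-e^{n(x - t)})` tends to the indicator function of `x < t`
    have hlim1 : Filter.Tendsto
        (fun n : ℕ => ∫ x in (0 : ℝ)..T, Complex.exp (-Complex.exp (n * (x - t))) * h x)
        Filter.atTop (𝓝 (∫ x in (0 : ℝ)..T, (Iic t).indicator h x)) := by
      refine intervalIntegral.tendsto_integral_filter_of_dominated_convergence (fun x => ‖h x‖)
        (Filter.Eventually.of_forall fun n => ?_) (Filter.Eventually.of_forall fun n => ?_) ?_ ?_
      · exact (by fun_prop : Continuous fun x : ℝ =>
          Complex.exp (-Complex.exp (n * (x - t))) * h x).aestronglyMeasurable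
      · refine ae_of_all _ fun x _ => ?_
        rw [norm_mul]
        refine mul_le_of_le_one_left (norm_nonneg _) ?_
        rw [Complex.norm_exp, Real.exp_le_one_iff]
        have : Complex.exp (n * (x - t)) = ((Real.exp (n * (x - t)) : ℝ) : ℂ) := by
          push_cast; rfl
        rw [this, Complex.neg_re, Complex.ofReal_re]
        exact neg_nonpos.2 (Real.exp_pos _).le
      · exact hh.norm.intervalIntegrable _ _
      · filter_upwards [Measure.ae_ne volume t] with x hx _
        have hcast : ∀ n : ℕ, Complex.exp (-Complex.exp (n * (x - t))) =
            ((Real.exp (-Real.exp (n * (x - t))) : ℝ) : ℂ) := fun n => by push_cast; rfl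
        simp only [hcast]
        rcases lt_or_gt_of_ne hx with hlt | hgt
        · rw [indicator_of_mem (show x ∈ Iic t from hlt.le)]
          have h1 : Filter.Tendsto (fun n : ℕ => (n : ℝ) * (x - t)) Filter.atTop Filter.atBot :=
            tendsto_natCast_atTop_atTop.atTop_mul_const_of_neg (by linarith)
          have h2 := ((Real.continuous_exp.tendsto _).comp
            (Real.tendsto_exp_atBot.comp h1).neg)
          rw [neg_zero, Real.exp_zero] at h2
          simpa using ((Complex.continuous_ofReal.tendsto _).comp h2).mul_const (h x)
        · rw [indicator_of_notMem (show x ∉ Iic t from not_le.2 hgt)]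
          have h1 : Filter.Tendsto (fun n : ℕ => (n : ℝ) * (x - t)) Filter.atTop Filter.atTop :=
            tendsto_natCast_atTop_atTop.atTop_mul_const (by linarith)
          have h2 := Real.tendsto_exp_neg_atTop_nhds_zero.comp (Real.tendsto_exp_atTop.comp h1)
          simpa using ((Complex.continuous_ofReal.tendsto _).comp h2).mul_const (h x)
    have hlim2 : Filter.Tendsto
        (fun n : ℕ => ∫ x in (0 : ℝ)..T, Complex.exp (-Complex.exp (n * (x - t))) * h x)
        Filter.atTop (𝓝 (∫ x in (0 : ℝ)..T, h x)) := by
      rw [tendsto_iff_norm_sub_tendsto_zero]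
      have hbd : ∀ n : ℕ, ‖(∫ x in (0 : ℝ)..T, Complex.exp (-Complex.exp (n * (x - t))) * h x) -
          ∫ x in (0 : ℝ)..T, h x‖ ≤ (Real.exp (Real.exp (-(n * t))) - 1) * M := by
        intro n
        have hs := hasSum_integral_exp_mul
          (φ := fun x : ℝ => -Complex.exp (n * (x - t))) (by fun_prop) hh hT.le
        have hs1 := (hasSum_nat_add_iff' 1).2 hs
        have hr : HasSum (fun j : ℕ => Real.exp (-(n * t)) ^ j / (j.factorial : ℝ))
            (Real.exp (Real.exp (-(n * t)))) := by
          rw [Real.exp_eq_exp_ℝ]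
          exact NormedSpace.expSeries_div_hasSum_exp _
        have hr1 := ((hasSum_nat_add_iff' 1).2 hr).mul_right M
        simp only [Finset.range_one, Finset.sum_singleton, pow_zero, Nat.factorial_zero,
          Nat.cast_one, div_one, one_mul] at hs1 hr1
        refine hs1.norm_le_of_bounded hr1 fun j => ?_
        have hterm : ∀ x : ℝ, (-Complex.exp (n * (x - t))) ^ (j + 1) /
            ((j + 1).factorial : ℂ) * h x =
            ((-1) ^ (j + 1) * (Real.exp (-(n * t)) ^ (j + 1) / ((j + 1).factorial : ℝ) : ℝ)) *
              (Complex.exp (((j + 1) * n : ℕ) * x) * h x) := by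
          intro x
          have : Complex.exp (n * (x - t)) ^ (j + 1) =
              (Real.exp (-(n * t)) ^ (j + 1) : ℝ) * Complex.exp (((j + 1) * n : ℕ) * x) := by
            push_cast
            rw [← Complex.exp_nat_mul, ← Complex.exp_nat_mul, ← Complex.exp_add]
            congr 1
            push_cast
            ring
          rw [neg_pow, this]
          push_cast
          ring
        simp only [hterm]
        rw [intervalIntegral.integral_const_mul, norm_mul, norm_mul, norm_pow, norm_neg, norm_one,
          one_pow, one_mul, Complex.norm_real, Real.norm_of_nonneg (by positivity)]
        exact mul_le_mul_of_nonneg_left (hM _) (by positivity)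
      refine squeeze_zero (fun _ => norm_nonneg _) hbd ?_
      have h1 : Filter.Tendsto (fun n : ℕ => (n : ℝ) * t) Filter.atTop Filter.atTop :=
        tendsto_natCast_atTop_atTop.atTop_mul_const ht.1
      have h2 := (Real.continuous_exp.tendsto _).comp
        (Real.tendsto_exp_neg_atTop_nhds_zero.comp h1)
      rw [Real.exp_zero] at h2
      simpa using (h2.sub_const 1).mul_const M
    rw [← tendsto_nhds_unique hlim1 hlim2, intervalIntegral.integral_of_le hT.le,
      intervalIntegral.integral_of_le ht.1.le, setIntegral_indicator measurableSet_Iic]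
    congr 2
    ext x
    simp only [mem_Ioc, mem_inter_iff, mem_Iic]
    exact ⟨fun h => ⟨⟨h.1, h.2.trans ht.2⟩, h.2⟩, fun h => ⟨h.1.1, h.2⟩⟩
  have hIoo : EqOn h 0 (Ioo 0 T) := by
    intro t ht
    have hd : HasDerivAt (fun t => ∫ x in (0 : ℝ)..t, h x) (h t) t :=
      intervalIntegral.integral_hasDerivAt_right (hh.intervalIntegrable _ _)
        (hh.stronglyMeasurableAtFilter _ _) hh.continuousAt
    have heq : (fun t => ∫ x in (0 : ℝ)..t, h x) =ᶠ[𝓝 t] fun _ => ∫ x in (0 : ℝ)..T, h x := by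
      filter_upwards [Ioo_mem_nhds ht.1 ht.2] with s hs using key s (Ioo_subset_Ioc_self hs)
    exact (hd.congr_of_eventuallyEq heq.symm).unique (hasDerivAt_const _ _)
  have := hIoo.closure hh continuous_zero
  rwa [closure_Ioo hT.ne] at this

lemma continuous_conv {f g : ℝ → ℂ} (hf : Continuous f) (hg : Continuous g) :
    Continuous (conv f g) :=
  intervalIntegral.continuous_parametric_intervalIntegral_of_continuous
    (f := fun t s => f (t - s) * g s) (by fun_prop) continuous_id

/-- The case of equal factors in the Titchmarsh theorem. Let `a` be the restriction of
`f` to `[0, 2T]`. The square of `∫₀²ᵀ e^{-nx} f(x) dx` is the integral of `e^{-nx} (a * a)(x)`,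
where `a * a` lives on `[2T, 4T]`, hence it is `O(e^{-2nT})`. -/
lemma eqOn_zero_of_conv_self {f : ℝ → ℂ} (hf : Continuous f) {T : ℝ} (hT : 0 < T)
    (h : EqOn (conv f f) 0 (Icc 0 (2 * T))) : EqOn f 0 (Icc 0 T) := by
  obtain ⟨C, hC⟩ := isCompact_Icc.exists_bound_of_continuousOn (s := Icc 0 (2 * T))
    hf.continuousOn
  have hC0 : 0 ≤ C := (norm_nonneg _).trans (hC 0 ⟨le_rfl, by positivity⟩)
  have hbig : ∀ n : ℕ, ‖Complex.exp (n * T) * ∫ x in (0 : ℝ)..2 * T,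
      Complex.exp (-(n * x)) * f x‖ ≤ 2 * T * C := by
    intro n
    set e : ℝ → ℂ := fun x => Complex.exp (-(n * x)) * f x
    have he : Continuous e := by fun_prop
    set a : ℝ → ℂ := (Ioc 0 (2 * T)).indicator e
    have ha : Integrable a :=
      ((he.integrableOn_Icc (a := 0) (b := 2 * T)).mono_set
        Ioc_subset_Icc_self).integrable_indicator measurableSet_Ioc
    have hia : ∫ x, a x = ∫ x in (0 : ℝ)..2 * T, e x := by
      rw [integral_indicator measurableSet_Ioc, intervalIntegral.integral_of_le (by positivity)]
    have hsq := integral_convolution (ContinuousLinearMap.mul ℂ ℂ) ha ha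
      (μ := volume) (ν := volume)
    rw [ContinuousLinearMap.mul_apply', hia] at hsq
    have hpt : ∀ s, ‖convolution a a (ContinuousLinearMap.mul ℂ ℂ) volume s‖ ≤
        (Ioc (2 * T) (4 * T)).indicator
          (fun _ => Real.exp (-(2 * n * T)) * C ^ 2 * (2 * T)) s := by
      intro s
      have hcv : convolution a a (ContinuousLinearMap.mul ℂ ℂ) volume s =
          ∫ u, a u * a (s - u) := rfl
      have hprod : ∀ u, a u * a (s - u) = Complex.exp (-(n * s)) *
          ((Ioc 0 (2 * T)).indicator f u * (Ioc 0 (2 * T)).indicator f (s - u)) := by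
        intro u
        by_cases h1 : u ∈ Ioc 0 (2 * T)
        · by_cases h2 : s - u ∈ Ioc 0 (2 * T)
          · simp only [a, e, indicator_of_mem h1, indicator_of_mem h2]
            have : Complex.exp (-(n * s)) =
                Complex.exp (-(n * u)) * Complex.exp (-(n * ((s - u : ℝ) : ℂ))) := by
              rw [← Complex.exp_add]; congr 1; push_cast; ring
            rw [this]; ring
          · simp [a, indicator_of_notMem h2]
        · simp [a, indicator_of_notMem h1]
      rw [hcv]
      simp only [hprod]
      rw [integral_const_mul]
      by_cases hs1 : s ≤ 2 * T
      · rw [indicator_of_notMem (fun hm : s ∈ Ioc _ _ => absurd hm.1 (not_lt.2 hs1))]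
        have hz : ∫ u, (Ioc 0 (2 * T)).indicator f u * (Ioc 0 (2 * T)).indicator f (s - u) = 0 := by
          by_cases hs0 : 0 ≤ s
          · have : ∀ u, (Ioc 0 (2 * T)).indicator f u * (Ioc 0 (2 * T)).indicator f (s - u) =
                (Ioo 0 s).indicator (fun u => f (s - u) * f u) u := by
              intro u
              by_cases hu : u ∈ Ioo 0 s
              · rw [indicator_of_mem hu,
                  indicator_of_mem (show u ∈ Ioc 0 (2 * T) from ⟨hu.1, hu.2.le.trans hs1⟩),
                  indicator_of_mem (show s - u ∈ Ioc 0 (2 * T) from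
                    ⟨by linarith [hu.2], by linarith [hu.1]⟩), mul_comm]
              · rw [indicator_of_notMem hu]
                by_cases h1 : u ∈ Ioc 0 (2 * T)
                · rw [indicator_of_notMem (fun h2 : s - u ∈ Ioc 0 (2 * T) =>
                    hu ⟨h1.1, by linarith [h2.1]⟩), mul_zero]
                · rw [indicator_of_notMem h1, zero_mul]
            simp only [this]
            rw [integral_indicator measurableSet_Ioo, ← integral_Ioc_eq_integral_Ioo,
              ← intervalIntegral.integral_of_le hs0]
            exact h ⟨hs0, hs1⟩
          · rw [← integral_zero ℝ ℂ (μ := volume)]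
            congr 1 with u
            by_cases h1 : u ∈ Ioc 0 (2 * T)
            · rw [indicator_of_notMem (fun h2 : s - u ∈ Ioc 0 (2 * T) => hs0
                (by linarith [h1.1, h2.1])), mul_zero]
            · rw [indicator_of_notMem h1, zero_mul]
        rw [hz, mul_zero, norm_zero]
      · by_cases hs2 : s ≤ 4 * T
        · rw [indicator_of_mem (show s ∈ Ioc _ _ from ⟨not_le.1 hs1, hs2⟩), norm_mul, mul_assoc]
          refine mul_le_mul ?_ ?_ (norm_nonneg _) (Real.exp_pos _).le
          · rw [Complex.norm_exp, Real.exp_le_exp]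
            have : (-((n : ℂ) * s)).re = -(n * s) := by simp
            rw [this]
            have := mul_le_mul_of_nonneg_left (not_le.1 hs1).le (Nat.cast_nonneg (α := ℝ) n)
            linarith
          · have hle : ∀ u, ‖(Ioc 0 (2 * T)).indicator f u *
                (Ioc 0 (2 * T)).indicator f (s - u)‖ ≤
                (Ioc 0 (2 * T)).indicator (fun _ => C ^ 2) u := by
              intro u
              by_cases h1 : u ∈ Ioc 0 (2 * T)
              · rw [indicator_of_mem h1, indicator_of_mem h1, norm_mul, sq]
                refine mul_le_mul (hC u (Ioc_subset_Icc_self h1)) ?_ (norm_nonneg _) hC0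
                by_cases h2 : s - u ∈ Ioc 0 (2 * T)
                · rw [indicator_of_mem h2]; exact hC _ (Ioc_subset_Icc_self h2)
                · rw [indicator_of_notMem h2, norm_zero]; exact hC0
              · simp [indicator_of_notMem h1]
            refine (norm_integral_le_of_norm_le ?_ (ae_of_all _ hle)).trans ?_
            · exact (integrable_indicator_iff measurableSet_Ioc).2
                (integrableOn_const measure_Ioc_lt_top.ne)
            · rw [integral_indicator measurableSet_Ioc, setIntegral_const]
              simp [hT.le, mul_comm]
        · rw [indicator_of_notMem (fun hm : s ∈ Ioc _ _ => hs2 hm.2)]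
          have hz : ∫ u, (Ioc 0 (2 * T)).indicator f u *
              (Ioc 0 (2 * T)).indicator f (s - u) = 0 := by
            rw [← integral_zero ℝ ℂ (μ := volume)]
            congr 1 with u
            by_cases h1 : u ∈ Ioc 0 (2 * T)
            · rw [indicator_of_notMem (fun h2 : s - u ∈ Ioc 0 (2 * T) => hs2
                (by linarith [h1.2, h2.2])), mul_zero]
            · rw [indicator_of_notMem h1, zero_mul]
          rw [hz, mul_zero, norm_zero]
    have hnorm : ‖∫ x in (0 : ℝ)..2 * T, e x‖ ^ 2 ≤
        Real.exp (-(2 * n * T)) * (2 * T * C) ^ 2 := by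
      rw [sq, ← norm_mul, ← hsq]
      refine (norm_integral_le_of_norm_le ?_ (ae_of_all _ hpt)).trans ?_
      · exact (integrable_indicator_iff measurableSet_Ioc).2
          (integrableOn_const measure_Ioc_lt_top.ne)
      · rw [integral_indicator measurableSet_Ioc, setIntegral_const]
        have : volume.real (Ioc (2 * T) (4 * T)) = 2 * T := by
          rw [Real.volume_real_Ioc_of_le (by linarith)]; ring
        rw [this, smul_eq_mul]
        exact le_of_eq (by ring)
    refine abs_le_of_sq_le_sq' ?_ (by positivity) |>.2
    rw [norm_mul, mul_pow, Complex.norm_exp]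
    have h1 : ((n : ℂ) * T).re = n * T := by simp
    rw [h1, ← Real.exp_nat_mul]
    calc _ ≤ Real.exp ((2 : ℕ) * (n * T)) * (Real.exp (-(2 * n * T)) * (2 * T * C) ^ 2) :=
          mul_le_mul_of_nonneg_left hnorm (Real.exp_pos _).le
      _ = (2 * T * C) ^ 2 := by
          rw [← mul_assoc, ← Real.exp_add]
          have : ((2 : ℕ) : ℝ) * (n * T) + -(2 * n * T) = 0 := by push_cast; ring
          rw [this, Real.exp_zero, one_mul]
  -- the reflection of `f` at `T` has bounded exponential moments
  have hfin := eqOn_zero_of_exp_moments_bounded (h := fun u => f (T - u)) (by fun_prop) hT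
    (M := 2 * T * C + C * T) (fun n => by
      have hsub := intervalIntegral.integral_comp_sub_left
        (fun x : ℝ => Complex.exp (n * ((T - x : ℝ) : ℂ)) * f x) (a := 0) (b := T) T
      rw [sub_self, sub_zero] at hsub
      have h1 : ∫ x in (0 : ℝ)..T, Complex.exp (n * x) * f (T - x) =
          ∫ x in (0 : ℝ)..T, Complex.exp (n * ((T - x : ℝ) : ℂ)) * f x := by
        rw [← hsub]
        simp only [sub_sub_cancel]
      have hcont : Continuous fun x : ℝ => Complex.exp (n * ((T - x : ℝ) : ℂ)) * f x := by
        fun_prop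
      have h2 := intervalIntegral.integral_add_adjacent_intervals (μ := volume)
        (hcont.intervalIntegrable 0 T) (hcont.intervalIntegrable T (2 * T))
      have h3 : ∫ x in (0 : ℝ)..2 * T, Complex.exp (n * ((T - x : ℝ) : ℂ)) * f x =
          Complex.exp (n * T) * ∫ x in (0 : ℝ)..2 * T, Complex.exp (-(n * x)) * f x := by
        rw [← intervalIntegral.integral_const_mul]
        congr 1 with x
        rw [← mul_assoc, ← Complex.exp_add]
        congr 2
        push_cast
        ring
      have h4 : ‖∫ x in T..2 * T, Complex.exp (n * ((T - x : ℝ) : ℂ)) * f x‖ ≤ C * T := by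
        have := intervalIntegral.norm_integral_le_of_norm_le_const (a := T) (b := 2 * T) (C := C)
          (f := fun x : ℝ => Complex.exp (n * ((T - x : ℝ) : ℂ)) * f x) (fun x hx => by
            rw [uIoc_of_le (by linarith)] at hx
            rw [norm_mul]
            have hfx := hC x ⟨by linarith [hx.1], hx.2⟩
            refine (mul_le_of_le_one_left (norm_nonneg _) ?_).trans hfx
            rw [Complex.norm_exp, Real.exp_le_one_iff]
            have : ((n : ℂ) * ((T - x : ℝ) : ℂ)).re = n * (T - x) := by simp
            rw [this]
            exact mul_nonpos_of_nonneg_of_nonpos (Nat.cast_nonneg _) (by linarith [hx.1]))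
        rwa [show 2 * T - T = T by ring, abs_of_pos hT] at this
      rw [h1, eq_sub_of_add_eq h2, h3]
      exact (norm_sub_le _ _).trans (add_le_add (hbig n) h4))
  intro t ht
  have := hfin (show T - t ∈ Icc 0 T from ⟨by linarith [ht.2], by linarith [ht.1]⟩)
  simpa using this

lemma conv_eqOn_zero_add {f g : ℝ → ℂ} {S T : ℝ} (hf : EqOn f 0 (Icc 0 S))
    (hg : EqOn g 0 (Icc 0 T)) : EqOn (conv f g) 0 (Icc 0 (S + T)) := by
  intro t ht
  simp only [conv, Pi.zero_apply]
  refine intervalIntegral.integral_zero_ae (ae_of_all _ fun s hs => ?_)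
  rw [uIoc_of_le ht.1] at hs
  rcases le_total s T with h | h
  · rw [hg ⟨hs.1.le, h⟩, Pi.zero_apply, mul_zero]
  · rw [hf ⟨by linarith [hs.2], by linarith [ht.2]⟩, Pi.zero_apply, zero_mul]

lemma conv_assoc_of_continuous {f g h : ℝ → ℂ} (hf : Continuous f) (hg : Continuous g)
    (hh : Continuous h) {t : ℝ} (ht : 0 ≤ t) :
    conv f (conv g h) t = conv (conv f g) h t :=
  vconv_assoc (.of_continuousOn hf.continuousOn) (.of_continuousOn hg.continuousOn)
    hh.continuousOn.bddMeasOn (T := t) ⟨ht, le_rfl⟩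

lemma conv_congr {f f' g g' : ℝ → ℂ} {t : ℝ} (ht : 0 ≤ t)
    (hf : ∀ s ∈ Icc 0 t, f s = f' s) (hg : ∀ s ∈ Icc 0 t, g s = g' s) :
    conv f g t = conv f' g' t :=
  vconv_congr ht hf hg

/-- The improvement step for the property "if `f * g = 0` on `[0, T]`, then
`f * (x g) = 0` on `[0, cT]`". With `u = f * (x g)`, `v = (x f) * g` and `w = x (f * g) = u + v` one
has `u * u = u * w - (f * g) * ((x g) * (x f))`, which vanishes on `[0, (1 + c²) T]`. -/
lemma conv_mul_id_improve {c : ℝ} (hc0 : 0 ≤ c) (hc1 : c ≤ 1)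
    (H : ∀ f g : ℝ → ℂ, Continuous f → Continuous g → ∀ T, 0 ≤ T →
      EqOn (conv f g) 0 (Icc 0 T) → EqOn (conv f fun s => s * g s) 0 (Icc 0 (c * T)))
    {f g : ℝ → ℂ} (hf : Continuous f) (hg : Continuous g) {T : ℝ} (hT : 0 ≤ T)
    (hfg : EqOn (conv f g) 0 (Icc 0 T)) :
    EqOn (conv f fun s => s * g s) 0 (Icc 0 ((1 + c ^ 2) / 2 * T)) := by
  rcases hT.eq_or_lt with rfl | hT'
  · intro t ht
    have : t = 0 := by simpa using ht
    simp [this, conv]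
  set f1 : ℝ → ℂ := fun s => s * f s with hf1
  set g1 : ℝ → ℂ := fun s => s * g s with hg1
  have hf1c : Continuous f1 := by fun_prop
  have hg1c : Continuous g1 := by fun_prop
  have hu := H f g hf hg T hT hfg
  have hw : EqOn (fun s : ℝ => (s : ℂ) * conv f g s) 0 (Icc 0 T) := fun s hs => by
    simp [hfg hs]
  have huv : ∀ t : ℝ, (t : ℂ) * conv f g t - conv f1 g t = conv f g1 t := by
    intro t
    simp only [conv, hf1, hg1]
    rw [← intervalIntegral.integral_const_mul, ← intervalIntegral.integral_sub]
    · congr 1 with s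
      push_cast
      ring
    · exact (by fun_prop : Continuous fun s : ℝ => (t : ℂ) * (f (t - s) * g s)).intervalIntegrable
        _ _
    · exact (by fun_prop : Continuous
        fun s : ℝ => (((t - s : ℝ) : ℂ) * f (t - s)) * g s).intervalIntegrable _ _
  have hprod : EqOn (conv (conv f g1) (conv f1 g)) 0 (Icc 0 (T + c * (c * T))) := by
    have h1 : EqOn (conv g f1) 0 (Icc 0 (c * T)) := H g f hg hf T hT (by rwa [conv_comm])
    have h2 := H f1 g hf1c hg (c * T) (by positivity) (by rwa [conv_comm])
    have h3 := conv_eqOn_zero_add hfg h2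
    intro t ht
    rw [← h3 ht, ← conv_assoc_of_continuous hf hg1c (continuous_conv hf1c hg) ht.1,
      ← conv_assoc_of_continuous hf hg (continuous_conv hf1c hg1c) ht.1]
    refine conv_congr ht.1 (fun _ _ => rfl) fun s hs => ?_
    rw [conv_assoc_of_continuous hg1c hf1c hg hs.1, conv_comm, conv_comm g1 f1]
  have huu : EqOn (conv (conv f g1) (conv f g1)) 0 (Icc 0 (2 * ((1 + c ^ 2) / 2 * T))) := by
    intro t ht
    have h1 := conv_eqOn_zero_add hu hw
    have hcw : Continuous fun s : ℝ => (s : ℂ) * conv f g s := by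
      have := continuous_conv hf hg
      fun_prop
    have h2 : conv (conv f g1) (conv f g1) t =
        conv (conv f g1) (fun s : ℝ => (s : ℂ) * conv f g s) t -
          conv (conv f g1) (conv f1 g) t := by
      have := vconv_sub_right (t := t) (T := t)
        (LOneLoc.of_continuousOn (continuous_conv hf hg1c).continuousOn)
        hcw.continuousOn.bddMeasOn (continuous_conv hf1c hg).continuousOn.bddMeasOn ⟨ht.1, le_rfl⟩
      exact (conv_congr ht.1 (fun _ _ => rfl) fun s _ => (huv s).symm).trans this
    have hcT : c ^ 2 * T ≤ c * T := mul_le_mul_of_nonneg_right (by nlinarith) hT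
    rw [h2, h1 ⟨ht.1, ht.2.trans (by nlinarith)⟩, hprod ⟨ht.1, ht.2.trans (by nlinarith)⟩]
    simp
  exact eqOn_zero_of_conv_self (continuous_conv hf hg1c) (by positivity) huu

/-- If `f * g` vanishes on `[0, T]`, then so does `f * (x g)`: the constants obtained from
`conv_mul_id_improve`, starting from `c = 0`, increase to `1`. -/
lemma conv_mul_id_eqOn_zero {f g : ℝ → ℂ} (hf : Continuous f) (hg : Continuous g) {T : ℝ}
    (hT : 0 ≤ T) (hfg : EqOn (conv f g) 0 (Icc 0 T)) :
    EqOn (conv f fun s => s * g s) 0 (Icc 0 T) := by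
  have hex : ∀ n : ℕ, ∃ c : ℝ, 0 ≤ c ∧ c ≤ 1 ∧ (1 - c) * (n + 2) ≤ 2 ∧
      ∀ f g : ℝ → ℂ, Continuous f → Continuous g → ∀ T, 0 ≤ T →
      EqOn (conv f g) 0 (Icc 0 T) → EqOn (conv f fun s => s * g s) 0 (Icc 0 (c * T)) := by
    intro n
    induction n with
    | zero =>
      refine ⟨0, le_rfl, zero_le_one, by norm_num, fun f g _ _ T _ _ t ht => ?_⟩
      have : t = 0 := by simpa using ht
      simp [this, conv]
    | succ n ih =>
      obtain ⟨c, h0, h1, h2, H⟩ := ih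
      refine ⟨(1 + c ^ 2) / 2, by positivity, by nlinarith, ?_, fun f g hf hg T hT h =>
        conv_mul_id_improve h0 h1 H hf hg hT h⟩
      -- in terms of `d = 1 - c` the claim is that `d ↦ d - d² / 2` maps `[0, 2 / m]` to
      -- `[0, 2 / (m + 1)]`, where `m = n + 2`
      push_cast
      set m : ℝ := (n : ℝ) + 2 with hm
      have hm2 : 2 ≤ m := by rw [hm]; linarith [Nat.cast_nonneg (α := ℝ) n]
      set d := 1 - c with hd
      have hc : (1 - (1 + c ^ 2) / 2) * ((n : ℝ) + 1 + 2) = (d - d ^ 2 / 2) * (m + 1) := by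
        rw [hd, hm]; ring
      rw [hc]
      have hd0 : 0 ≤ d := by linarith
      have hd1 : d ≤ 1 := by linarith
      nlinarith [mul_nonneg hd0 (sub_nonneg.2 h2), sq_nonneg (d - 1), mul_nonneg hd0 hd0,
        mul_nonneg (mul_nonneg hd0 (sub_nonneg.2 hd1)) (by linarith : (0:ℝ) ≤ m - 2)]
  rcases hT.eq_or_lt with rfl | hT'
  · intro t ht
    have : t = 0 := by simpa using ht
    simp [this, conv]
  have hIco : EqOn (conv f fun s => s * g s) 0 (Ico 0 T) := by
    intro t ht
    obtain ⟨n, hn⟩ := exists_nat_gt (2 * T / (T - t))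
    obtain ⟨c, h0, h1, h2, H⟩ := hex n
    refine H f g hf hg T hT hfg ⟨ht.1, ?_⟩
    have hpos : 0 < T - t := sub_pos.2 ht.2
    rw [div_lt_iff₀ hpos] at hn
    have hn2 : (0 : ℝ) < n + 2 := by positivity
    by_contra hcon
    have : (T - t) * (n + 2) < 2 * T := by
      calc (T - t) * (n + 2) < ((1 - c) * T) * (n + 2) :=
            mul_lt_mul_of_pos_right (by linarith [not_le.1 hcon]) hn2
        _ = ((1 - c) * (n + 2)) * T := by ring
        _ ≤ 2 * T := mul_le_mul_of_nonneg_right h2 hT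
    linarith
  have := hIco.closure (continuous_conv hf (by fun_prop)) continuous_zero
  rwa [closure_Ico hT'.ne] at this

/-- The Titchmarsh convolution theorem for continuous functions: if `f * g = 0` on `[0, T]`, then
iterating `conv_mul_id_eqOn_zero` shows that all moments `∫₀ᵗ sʲ f(t - s) g(s) ds` with `t ≤ T`
vanish, so the integrand itself vanishes. -/
theorem titchmarsh_of_continuous {f g : ℝ → ℂ} (hf : Continuous f) (hg : Continuous g) {T : ℝ}
    (hfg : EqOn (conv f g) 0 (Icc 0 T)) {t u : ℝ} (hu : u ∈ Icc 0 t) (ht0' : 0 < t)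
    (ht : t ≤ T) :
    f (t - u) * g u = 0 := by
  have ht0 : 0 ≤ t := ht0'.le
  have hT : 0 ≤ T := ht0.trans ht
  have hmom : ∀ j : ℕ, EqOn (conv f fun s => (s : ℂ) ^ j * g s) 0 (Icc 0 T) := by
    intro j
    induction j with
    | zero => simpa using hfg
    | succ j ih =>
      have := conv_mul_id_eqOn_zero hf (g := fun s => (s : ℂ) ^ j * g s) (by fun_prop) hT ih
      simpa only [pow_succ', mul_assoc] using this
  have hcont : Continuous fun s => f (t - s) * g s := by fun_prop
  refine eqOn_zero_of_exp_moments_bounded (M := 0) hcont ht0' (fun n => ?_) hu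
  have hs := hasSum_integral_exp_mul (φ := fun x : ℝ => (n : ℂ) * x) (by fun_prop) hcont ht0
  have hz : ∀ j : ℕ, ∫ x in (0 : ℝ)..t, ((n : ℂ) * x) ^ j / (j.factorial : ℂ) *
      (f (t - x) * g x) = 0 := by
    intro j
    have h1 : ∀ x : ℝ, ((n : ℂ) * x) ^ j / (j.factorial : ℂ) * (f (t - x) * g x) =
        ((n : ℂ) ^ j / (j.factorial : ℂ)) * (f (t - x) * ((x : ℂ) ^ j * g x)) := fun x => by
      rw [mul_pow]; ring
    simp only [h1]
    rw [intervalIntegral.integral_const_mul]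
    have := hmom j ⟨ht0, ht⟩
    simp only [conv, Pi.zero_apply] at this
    rw [this, mul_zero]
  simp only [hz] at hs
  rw [hs.unique hasSum_zero, norm_zero]

lemma continuousOn_primitive {k : ℝ → ℂ} (hk : LOneLoc k) (T : ℝ) :
    ContinuousOn (fun t => ∫ s in (0 : ℝ)..t, k s) (Icc 0 T) := by
  rcases le_or_gt 0 T with hT | hT
  · have h := intervalIntegral.continuousOn_primitive_interval (a := 0) (b := T) (f := k)
      (μ := volume) (by
        rw [uIcc_of_le hT, integrableOn_Icc_iff_integrableOn_Ioc]
        exact hk.integrableOn_Ioc T)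
    rwa [uIcc_of_le hT] at h
  · simp [Icc_eq_empty (not_le.2 hT)]

lemma lOneLoc_primitive {k : ℝ → ℂ} (hk : LOneLoc k) :
    LOneLoc fun t => ∫ s in (0 : ℝ)..t, k s :=
  .of_continuousOn fun t ht =>
    (continuousOn_primitive hk (t + 1) t ⟨ht, by linarith⟩).mono_of_mem_nhdsWithin (by
      rw [← Ici_inter_Iic]; exact inter_mem_nhdsWithin _ (Iic_mem_nhds (by linarith)))

lemma ae_eq_zero_of_primitive_eq_zero {k : ℝ → ℂ} (hk : LOneLoc k) {ε : ℝ} (hε : 0 < ε)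
    (h : ∀ t ∈ Ioo 0 ε, ∫ s in (0 : ℝ)..t, k s = 0) :
    ∀ᵐ t : ℝ, t ∈ Ioo 0 ε → k t = 0 := by
  have hd := (hk.intervalIntegrable le_rfl hε.le).ae_hasDerivAt_integral
  filter_upwards [hd] with t ht hmem
  have hmem' : t ∈ uIcc 0 ε := by rw [uIcc_of_le hε.le]; exact Ioo_subset_Icc_self hmem
  have h1 := ht hmem' 0 (by simp)
  have heq : (fun t => ∫ s in (0 : ℝ)..t, k s) =ᶠ[𝓝 t] fun _ => 0 := by
    filter_upwards [Ioo_mem_nhds hmem.1 hmem.2] with s hs using h s hs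
  exact (h1.congr_of_eventuallyEq heq.symm).unique (hasDerivAt_const _ _)

/-- If `0 ∈ supp k`, then convolution with the primitive of `k` is injective on continuous
functions. -/
theorem eq_zero_of_conv_primitive {k g : ℝ → ℂ} (hk : LOneLoc k) (hk0 : ZeroMemSupp k) {T : ℝ}
    (hg : ContinuousOn g (Icc 0 T))
    (h : ∀ t ∈ Icc 0 T, conv (fun t => ∫ s in (0 : ℝ)..t, k s) g t = 0) :
    ∀ u ∈ Ico 0 T, g u = 0 := by
  intro u hu
  have hT : 0 ≤ T := hu.1.trans hu.2.le
  set K : ℝ → ℂ := fun t => ∫ s in (0 : ℝ)..t, k s with hK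
  set K' : ℝ → ℂ := IccExtend hT ((Icc 0 T).domRestrict K) with hK'
  set g' : ℝ → ℂ := IccExtend hT ((Icc 0 T).domRestrict g) with hg'
  have hKc : Continuous K' := (continuousOn_primitive hk T).domRestrict.Icc_extend'
  have hgc : Continuous g' := hg.domRestrict.Icc_extend'
  have hKe : ∀ s ∈ Icc 0 T, K' s = K s := fun s hs => by
    rw [hK', IccExtend_of_mem _ _ hs, domRestrict_apply]
  have hge : ∀ s ∈ Icc 0 T, g' s = g s := fun s hs => by
    rw [hg', IccExtend_of_mem _ _ hs, domRestrict_apply]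
  have hz : EqOn (conv K' g') 0 (Icc 0 T) := fun t ht => by
    rw [conv_congr ht.1 (fun s hs => hKe s ⟨hs.1, hs.2.trans ht.2⟩)
      (fun s hs => hge s ⟨hs.1, hs.2.trans ht.2⟩), h t ht, Pi.zero_apply]
  by_contra hne
  refine hk0 (T - u) (by linarith [hu.2]) (ae_eq_zero_of_primitive_eq_zero hk
    (by linarith [hu.2]) fun s hs => ?_)
  have := titchmarsh_of_continuous hKc hgc hz (t := u + s) (u := u)
    ⟨hu.1, by linarith [hs.1]⟩ (by linarith [hu.1, hs.1]) (by linarith [hs.2])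
  rw [add_sub_cancel_left, hKe s ⟨hs.1.le, by linarith [hu.1, hs.2]⟩,
    hge u ⟨hu.1, hu.2.le⟩] at this
  exact (mul_eq_zero.1 this).resolve_right hne

lemma conv_one_left (f : ℝ → ℂ) : conv (fun _ => 1) f = fun t => ∫ s in (0 : ℝ)..t, f s := by
  ext t; simp [conv]

theorem eq_zero_of_conv {k g : ℝ → ℂ} (hk : LOneLoc k) (hk0 : ZeroMemSupp k) {T : ℝ}
    (hg : ContinuousOn g (Icc 0 T)) (h : ∀ t ∈ Icc 0 T, conv k g t = 0) :
    ∀ u ∈ Ico 0 T, g u = 0 := by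
  refine eq_zero_of_conv_primitive hk hk0 hg fun t ht => ?_
  rw [← conv_one_left, conv_eq_vconv, ← vconv_assoc (lOneLoc_const 1) hk hg.bddMeasOn ht,
    vconv_one_left]
  refine intervalIntegral.integral_zero_ae (ae_of_all _ fun s hs => ?_)
  rw [uIoc_of_le ht.1] at hs
  exact h s ⟨hs.1.le, hs.2.trans ht.2⟩

/-- Vector-valued form of `eq_zero_of_conv_primitive`, obtained by applying functionals. -/
theorem eq_zero_of_vconv_primitive {E : Type*} [NormedAddCommGroup E] [NormedSpace ℂ E]
    [CompleteSpace E] {k : ℝ → ℂ} (hk : LOneLoc k) (hk0 : ZeroMemSupp k) {T : ℝ} {v : ℝ → E}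
    (hv : ContinuousOn v (Icc 0 T))
    (h : ∀ t ∈ Icc 0 T, vconv (fun t => ∫ s in (0 : ℝ)..t, k s) v t = 0) :
    ∀ u ∈ Ico 0 T, v u = 0 := by
  intro u hu
  refine SeparatingDual.eq_zero_of_forall_dual_eq_zero (R := ℂ) fun ℓ => ?_
  refine eq_zero_of_conv_primitive hk hk0 (g := fun s => ℓ (v s))
    (ℓ.continuous.comp_continuousOn hv) (fun t ht => ?_) u hu
  have := ℓ.intervalIntegral_comp_comm
    (vconv_integrable (lOneLoc_primitive hk) hv.bddMeasOn ht)
  have h2 := h t ht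
  rw [vconv] at h2
  rw [h2, map_zero] at this
  simpa [conv] using this

/-- The convolution powers of `k` inherit `0 ∈ supp k`. -/
theorem ZeroMemSupp.convPow {k : ℝ → ℂ} (hk : LOneLoc k) (hk0 : ZeroMemSupp k) (n : ℕ) :
    ZeroMemSupp (convPow k (n + 1)) := by
  induction n with
  | zero => exact hk0
  | succ n ih =>
    intro ε hε hz
    refine ih ε hε (ae_eq_zero_of_primitive_eq_zero (hk.convPow n) hε fun t ht => ?_)
    refine eq_zero_of_conv hk hk0 (T := ε) (continuousOn_primitive (hk.convPow n) ε)
      (fun t ht => ?_) t ⟨ht.1.le, ht.2⟩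
    rw [← conv_one_left, conv_comm (fun _ => 1), conv_eq_vconv, conv_eq_vconv,
      vconv_assoc hk (hk.convPow n) (bddMeasOn_const (1 : ℂ) ε) ht]
    change conv (conv k (ConvSemigroup.convPow k (n + 1))) (fun _ => 1) t = 0
    rw [conv_comm, conv_one_left]
    refine intervalIntegral.integral_zero_ae ?_
    filter_upwards [hz, Measure.ae_ne volume ε] with s hs hne hmem
    rw [uIoc_of_le ht.1] at hmem
    exact hs ⟨hmem.1, lt_of_le_of_ne (hmem.2.trans ht.2) hne⟩

/-! ### Closed operators and local convoluted semigroups -/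

section Graph

variable {X : Type*} [NormedAddCommGroup X] [NormedSpace ℂ X] [CompleteSpace X]

/-- A closed subspace contains the integrals of functions with values in it: pass to the
quotient. -/
lemma intervalIntegral_mem_of_isClosed {S : Submodule ℂ X} (hS : IsClosed (S : Set X)) {f : ℝ → X}
    {a b : ℝ} (hf : IntervalIntegrable f volume a b) (h : ∀ s ∈ uIoc a b, f s ∈ S) :
    ∫ s in a..b, f s ∈ S := by
  have : IsClosed (S : Set X) := hS
  have hL := S.mkQL.intervalIntegral_comp_comm hf
  rw [← Submodule.Quotient.mk_eq_zero]
  change S.mkQL _ = 0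
  rw [← hL]
  refine intervalIntegral.integral_zero_ae (ae_of_all _ fun s hs => ?_)
  exact (Submodule.Quotient.mk_eq_zero S).2 (h s hs)

/-- A closed operator commutes with integration. -/
lemma integral_mem_graph {A : X →ₗ.[ℂ] X} (hA : A.IsClosed) {u w : ℝ → X} {a b : ℝ}
    (hu : IntervalIntegrable u volume a b) (hw : IntervalIntegrable w volume a b)
    (h : ∀ s ∈ uIoc a b, (u s, w s) ∈ A.graph) :
    (∫ s in a..b, u s, ∫ s in a..b, w s) ∈ A.graph := by
  have hint : IntervalIntegrable (fun s => (u s, w s)) volume a b :=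
    ⟨hu.1.prodMk hw.1, hu.2.prodMk hw.2⟩
  have h1 := intervalIntegral_mem_of_isClosed (S := A.graph) hA hint h
  have h2 := (ContinuousLinearMap.fst ℂ X X).intervalIntegral_comp_comm hint
  have h3 := (ContinuousLinearMap.snd ℂ X X).intervalIntegral_comp_comm hint
  simp only [ContinuousLinearMap.coe_fst', ContinuousLinearMap.coe_snd'] at h2 h3
  rw [h2, h3]
  exact h1

lemma vconv_mem_graph {A : X →ₗ.[ℂ] X} (hA : A.IsClosed) {a : ℝ → ℂ} (ha : LOneLoc a)
    {F G : ℝ → X} {T t : ℝ} (hF : BddMeasOn F T) (hG : BddMeasOn G T) (ht : t ∈ Icc 0 T)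
    (h : ∀ s ∈ Icc 0 t, (F s, G s) ∈ A.graph) :
    (vconv a F t, vconv a G t) ∈ A.graph := by
  refine integral_mem_graph hA (vconv_integrable ha hF ht) (vconv_integrable ha hG ht)
    fun s hs => ?_
  rw [uIoc_of_le ht.1] at hs
  exact A.graph.smul_mem (a (t - s)) (h s (Ioc_subset_Icc_self hs))

end Graph

section Semigroup

variable {X : Type*} [NormedAddCommGroup X] [NormedSpace ℂ X]
  {k : ℝ → ℂ} {τ : ℝ} {S : ℝ → X →L[ℂ] X} {A : X →ₗ.[ℂ] X}

lemma IsLocalConvSemigroup.commute_graph (hS : IsLocalConvSemigroup k τ S A) {t : ℝ}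
    (ht : t ∈ Icc 0 τ) {x y : X} (h : (x, y) ∈ A.graph) : (S t x, S t y) ∈ A.graph := by
  obtain ⟨z, hz1, hz2⟩ := (A.mem_graph_iff).1 h
  obtain ⟨hm, he⟩ := hS.commute t ht z
  simp only at hz1 hz2
  subst hz1
  refine (A.mem_graph_iff).2 ⟨⟨_, hm⟩, rfl, ?_⟩
  rw [← hz2]
  exact he

lemma IsLocalConvSemigroup.integral_graph (hS : IsLocalConvSemigroup k τ S A) {t : ℝ}
    (ht : t ∈ Icc 0 τ) (x : X) :
    (∫ s in (0 : ℝ)..t, S s x, S t x - (∫ s in (0 : ℝ)..t, k s) • x) ∈ A.graph := by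
  obtain ⟨hm, he⟩ := hS.integral_eq t ht x
  exact (A.mem_graph_iff).2 ⟨_, rfl, he⟩

lemma IsLocalConvSemigroup.of_graph (hA : A.IsClosed)
    (hc : ∀ x, ContinuousOn (fun t => S t x) (Icc 0 τ))
    (hcomm : ∀ t ∈ Icc 0 τ, ∀ x y, (x, y) ∈ A.graph → (S t x, S t y) ∈ A.graph)
    (hint : ∀ t ∈ Icc 0 τ, ∀ x,
      (∫ s in (0 : ℝ)..t, S s x, S t x - (∫ s in (0 : ℝ)..t, k s) • x) ∈ A.graph) :
    IsLocalConvSemigroup k τ S A where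
  closed := hA
  continuousOn := hc
  commute t ht x := by
    obtain ⟨z, hz1, hz2⟩ := (A.mem_graph_iff).1 (hcomm t ht x (A x) (A.mem_graph x))
    simp only at hz1 hz2
    refine ⟨hz1 ▸ z.2, ?_⟩
    rw [← hz2]
    congr 1
    exact Subtype.ext hz1.symm
  integral_eq t ht x := by
    obtain ⟨z, hz1, hz2⟩ := (A.mem_graph_iff).1 (hint t ht x)
    simp only at hz1 hz2
    refine ⟨hz1 ▸ z.2, ?_⟩
    rw [← hz2]
    congr 1
    exact Subtype.ext hz1.symm

lemma IsLocalConvSemigroup.zero_apply (hS : IsLocalConvSemigroup k τ S A) (hτ : 0 ≤ τ) (x : X) :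
    S 0 x = 0 := by
  have h := hS.integral_graph ⟨le_rfl, hτ⟩ x
  rw [intervalIntegral.integral_same, intervalIntegral.integral_same, zero_smul, sub_zero] at h
  exact A.graph_fst_eq_zero_snd h rfl

lemma exists_norm_le_of_continuousOn [CompleteSpace X]
    (hS : ∀ x, ContinuousOn (fun t => S t x) (Icc 0 τ)) :
    ∃ C, 0 ≤ C ∧ ∀ t ∈ Icc 0 τ, ‖S t‖ ≤ C := by
  obtain ⟨C, hC⟩ := banach_steinhaus (g := fun t : Icc 0 τ => S t) fun x => by
    obtain ⟨M, hM⟩ := isCompact_Icc.exists_bound_of_continuousOn (hS x)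
    exact ⟨M, fun t => hM t t.2⟩
  exact ⟨max C 0, le_max_right _ _, fun t ht => (hC ⟨t, ht⟩).trans (le_max_left _ _)⟩

/-- Strong integrals `x ↦ ∫₀ᵇ a(s) S(s)x ds` are bounded operators. -/
lemma exists_clm_integral [CompleteSpace X] (hS : ∀ x, ContinuousOn (fun t => S t x) (Icc 0 τ))
    {a : ℝ → ℂ} {b : ℝ} (hb : b ∈ Icc 0 τ) (ha : IntervalIntegrable a volume 0 b) :
    ∃ Q : X →L[ℂ] X, ∀ x, Q x = ∫ s in (0 : ℝ)..b, a s • S s x := by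
  obtain ⟨C, hC0, hC⟩ := exists_norm_le_of_continuousOn hS
  have hint : ∀ x, IntervalIntegrable (fun s => a s • S s x) volume 0 b := by
    intro x
    refine ha.smul_continuousOn ((hS x).mono ?_)
    rw [uIcc_of_le hb.1]
    exact Icc_subset_Icc_right hb.2
  let Q : X →ₗ[ℂ] X :=
    { toFun := fun x => ∫ s in (0 : ℝ)..b, a s • S s x
      map_add' := fun x y => by
        simp only [map_add, smul_add]
        exact intervalIntegral.integral_add (hint x) (hint y)
      map_smul' := fun c x => by
        simp only [map_smul, RingHom.id_apply]
        rw [← intervalIntegral.integral_smul]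
        simp only [smul_comm c] }
  refine ⟨Q.mkContinuous ((∫ s in (0 : ℝ)..b, ‖a s‖) * C) fun x => ?_, fun x => rfl⟩
  refine (intervalIntegral.norm_integral_le_of_norm_le (g := fun s => ‖a s‖ * (C * ‖x‖)) hb.1
    (ae_of_all _ fun s hs => ?_) (ha.norm.mul_const _)).trans (le_of_eq ?_)
  · rw [norm_smul]
    gcongr
    exact ((S s).le_opNorm x).trans
      (mul_le_mul_of_nonneg_right (hC s ⟨hs.1.le, hs.2.trans hb.2⟩) (norm_nonneg _))
  · rw [intervalIntegral.integral_mul_const, mul_assoc]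

end Semigroup

/-! ### Continuity, truncation and translation of convolutions -/

section Vconv

variable {E : Type*} [NormedAddCommGroup E] [NormedSpace ℂ E]

lemma continuousOn_vconv [CompleteSpace E] {a : ℝ → ℂ} (ha : LOneLoc a) {F : ℝ → E} {T : ℝ}
    (hF : ContinuousOn F (Icc 0 T)) : ContinuousOn (vconv a F) (Icc 0 T) := by
  rcases lt_or_ge T 0 with hT | hT
  · simp [Icc_eq_empty (not_le.2 hT)]
  -- extend `F` continuously by constants; the extra contribution of `(-∞, 0)` is a multiple of
  -- `F 0` with a continuous coefficient
  set G : ℝ → E := IccExtend hT ((Icc 0 T).domRestrict F) with hG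
  have hGc : Continuous G := hF.domRestrict.Icc_extend'
  have hGe : ∀ s ∈ Icc 0 T, G s = F s := fun s hs => by
    rw [hG, IccExtend_of_mem _ _ hs, domRestrict_apply]
  have hG0 : ∀ s ≤ 0, G s = F 0 := fun s hs => by
    rw [hG, IccExtend_of_le_left _ _ hs, domRestrict_apply]
  have ha' : Integrable ((Ioc 0 T).indicator a) :=
    (ha.integrableOn_Ioc T).integrable_indicator measurableSet_Ioc
  have hGb : BddAbove (range fun s => ‖G s‖) := by
    obtain ⟨C, hC⟩ := isCompact_Icc.exists_bound_of_continuousOn hF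
    refine ⟨C, ?_⟩
    rintro _ ⟨s, rfl⟩
    simp only [hG, IccExtend, Function.comp, domRestrict_apply]
    exact hC _ (projIcc 0 T hT s).2
  have hc := hGb.continuous_convolution_right_of_integrable (ContinuousLinearMap.lsmul ℂ ℂ)
    ha' hGc
  have hprim : ContinuousOn (fun t => ((∫ s in (0 : ℝ)..T, a s) - ∫ s in (0 : ℝ)..t, a s) • F 0)
      (Icc 0 T) := (continuousOn_const.sub (continuousOn_primitive ha T)).smul continuousOn_const
  refine (hc.continuousOn.sub hprim).congr fun t ht => ?_
  have h1 : convolution ((Ioc 0 T).indicator a) G (ContinuousLinearMap.lsmul ℂ ℂ) volume t =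
      ∫ s in (0 : ℝ)..T, a s • G (t - s) := by
    rw [convolution_lsmul, intervalIntegral.integral_of_le hT,
      ← integral_indicator measurableSet_Ioc]
    congr 1 with s
    by_cases hs : s ∈ Ioc 0 T <;> simp [hs]
  have hint : ∀ b c : ℝ, 0 ≤ b → 0 ≤ c →
      IntervalIntegrable (fun s => a s • G (t - s)) volume b c := fun b c hb hc' =>
    (ha.intervalIntegrable hb hc').smul_continuousOn
      (hGc.comp (continuous_const.sub continuous_id)).continuousOn
  change vconv a F t =
    convolution ((Ioc 0 T).indicator a) G (ContinuousLinearMap.lsmul ℂ ℂ) volume t -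
      ((∫ s in (0 : ℝ)..T, a s) - ∫ s in (0 : ℝ)..t, a s) • F 0
  rw [h1, vconv_eq_integral_comp_sub, ← intervalIntegral.integral_add_adjacent_intervals
    (hint 0 t le_rfl ht.1) (hint t T ht.1 hT),
    intervalIntegral.integral_interval_sub_left (ha.intervalIntegrable le_rfl hT)
      (ha.intervalIntegrable le_rfl ht.1)]
  have h2 : ∫ s in t..T, a s • G (t - s) = (∫ s in t..T, a s) • F 0 := by
    rw [← intervalIntegral.integral_smul_const]
    refine intervalIntegral.integral_congr fun s hs => ?_
    rw [uIcc_of_le ht.2] at hs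
    simp only [hG0 (t - s) (by linarith [hs.1])]
  have h3 : ∫ s in (0 : ℝ)..t, a s • G (t - s) = ∫ s in (0 : ℝ)..t, a s • F (t - s) := by
    refine intervalIntegral.integral_congr fun s hs => ?_
    rw [uIcc_of_le ht.1] at hs
    simp only [hGe (t - s) ⟨by linarith [hs.2], by linarith [hs.1, ht.2]⟩]
  rw [h2, h3, add_sub_cancel_right]

lemma BddMeasOn.indicator {E' : Type*} [NormedAddCommGroup E'] {F : ℝ → E'} {T : ℝ}
    (hF : BddMeasOn F T) (σ T' : ℝ) (h : T' ≤ T ∨ σ ≤ T) :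
    BddMeasOn ((Iic σ).indicator F) T' where
  aesm := by
    rw [aestronglyMeasurable_indicator_iff measurableSet_Iic,
      Measure.restrict_restrict measurableSet_Iic]
    have hsub : Iic σ ∩ Ioc 0 T' ⊆ Ioc 0 T := fun s hs =>
      ⟨hs.2.1, h.elim hs.2.2.trans (le_trans hs.1)⟩
    exact hF.aesm.mono_set hsub
  bdd := by
    obtain ⟨C, hC⟩ := hF.bdd
    refine ⟨max C 0, fun s hs => ?_⟩
    by_cases hsσ : s ∈ Iic σ
    · rw [indicator_of_mem hsσ]
      refine (hC s ⟨hs.1, ?_⟩).trans (le_max_left _ _)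
      rcases h with h | h
      · exact hs.2.trans h
      · exact le_trans hsσ h
    · rw [indicator_of_notMem hsσ, norm_zero]
      exact le_max_right _ _

lemma vconv_indicator_Iic (a : ℝ → ℂ) (F : ℝ → E) {σ t : ℝ} (ht : 0 ≤ t) (hσ : 0 ≤ σ) :
    vconv a ((Iic σ).indicator F) t = ∫ s in (0 : ℝ)..min t σ, a (t - s) • F s := by
  rw [vconv, intervalIntegral.integral_of_le ht, intervalIntegral.integral_of_le (le_min ht hσ)]
  have : ∀ s, a (t - s) • (Iic σ).indicator F s =
      (Iic σ).indicator (fun s => a (t - s) • F s) s := fun s => by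
    by_cases hs : s ∈ Iic σ <;> simp [hs]
  simp only [this]
  rw [setIntegral_indicator measurableSet_Iic, Ioc_inter_Iic]

/-- The convolution with a function vanishing on `[0, σ]` is a translated convolution. -/
lemma vconv_eq_vconv_shift {a : ℝ → ℂ} {H : ℝ → E} {σ t : ℝ} (hσ : 0 ≤ σ)
    (ht : 0 ≤ t) (hH0 : ∀ s ∈ Icc 0 σ, H s = 0) :
    vconv a H t = vconv a (fun s => H (s + σ)) (max (t - σ) 0) := by
  rcases le_total t σ with h | h
  · rw [max_eq_right (by linarith), vconv_zero_right_time]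
    refine intervalIntegral.integral_zero_ae (ae_of_all _ fun s hs => ?_)
    rw [uIoc_of_le ht] at hs
    rw [hH0 s ⟨hs.1.le, hs.2.trans h⟩, smul_zero]
  · rw [max_eq_left (by linarith)]
    have h3 : ∫ s in σ..t, a (t - s) • H s = vconv a (fun s => H (s + σ)) (t - σ) := by
      have := intervalIntegral.integral_comp_add_right (fun s => a (t - s) • H s)
        (a := 0) (b := t - σ) σ
      rw [zero_add, sub_add_cancel] at this
      rw [← this, vconv]
      refine intervalIntegral.integral_congr fun s _ => ?_
      congr 2
      ring
    rw [← h3, vconv, intervalIntegral.integral_of_le ht, intervalIntegral.integral_of_le h]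
    refine setIntegral_eq_of_subset_of_forall_sdiff_eq_zero (μ := volume)
      (f := fun s => a (t - s) • H s) measurableSet_Ioc (Ioc_subset_Ioc_left hσ)
      fun s hs => ?_
    have hsσ : s ≤ σ := not_lt.1 fun hlt => hs.2 ⟨hlt, hs.1.2⟩
    rw [hH0 s ⟨hs.1.1.le, hsσ⟩, smul_zero]

end Vconv

/-! ### Extension of a local convoluted semigroup -/

section Extension

variable {X : Type*} [NormedAddCommGroup X] [NormedSpace ℂ X]

/-- A local `k`-convoluted semigroup `S` on `[0, τ]` and a local `l`-convoluted semigroup `T` on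
`[0, σ]` with the same generator give a local `k * l`-convoluted semigroup on `[0, σ + τ]`. This is
its value at `t` and `x`; the two summands are the contribution of `T`, cut off at `σ`, and a
function of `r = max (t - σ) 0` vanishing at `r = 0`. -/
noncomputable def extFun (k l : ℝ → ℂ) (σ : ℝ) (S T : ℝ → X →L[ℂ] X) (t : ℝ) (x : X) : X :=
  vconv k ((Iic σ).indicator fun s => T s x) t +
    (T σ (S (max (t - σ) 0) x) +
      vconv (fun u => l (u + σ)) (fun s => S s x) (max (t - σ) 0))

variable {k l : ℝ → ℂ} {σ τ : ℝ} {S T : ℝ → X →L[ℂ] X} {A : X →ₗ.[ℂ] X}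

lemma extFun_of_le (hτ : 0 ≤ τ) (hS : IsLocalConvSemigroup k τ S A) {t : ℝ}
    (ht : t ∈ Icc 0 σ) (x : X) : extFun k l σ S T t x = vconv k (fun s => T s x) t := by
  rw [extFun, max_eq_right (by linarith [ht.2]), hS.zero_apply hτ, map_zero,
    vconv_zero_right_time, add_zero, add_zero, vconv_indicator_Iic _ _ ht.1 (ht.1.trans ht.2),
    min_eq_left ht.2]
  rfl

lemma extFun_of_gt (hσ : 0 ≤ σ) {t : ℝ} (ht : σ < t) (x : X) :
    extFun k l σ S T t x = T σ (S (t - σ) x) + (∫ s in (0 : ℝ)..σ, k (t - s) • T s x) +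
      ∫ s in (0 : ℝ)..(t - σ), l (t - s) • S s x := by
  rw [extFun, max_eq_left (by linarith), vconv_indicator_Iic _ _ (hσ.trans ht.le) hσ,
    min_eq_right ht.le, ← add_assoc, add_comm (∫ s in (0 : ℝ)..σ, _)]
  congr 1
  rw [vconv]
  congr 1 with s
  congr 2
  ring

lemma max_sub_mem {t : ℝ} (hτ : 0 ≤ τ) (ht : t ∈ Icc 0 (σ + τ)) : max (t - σ) 0 ∈ Icc 0 τ :=
  ⟨le_max_right _ _, max_le (by linarith [ht.2]) hτ⟩

lemma exists_clm_extFun [CompleteSpace X] (hk : LOneLoc k) (hl : LOneLoc l) (hσ : 0 ≤ σ)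
    (hτ : 0 ≤ τ) (hS : IsLocalConvSemigroup k τ S A) (hT : IsLocalConvSemigroup l σ T A) {t : ℝ}
    (ht : t ∈ Icc 0 (σ + τ)) : ∃ Q : X →L[ℂ] X, ∀ x, Q x = extFun k l σ S T t x := by
  set r := max (t - σ) 0 with hr
  have hrm : r ∈ Icc 0 τ := max_sub_mem hτ ht
  have hm : min t σ ∈ Icc 0 σ := ⟨le_min ht.1 hσ, min_le_right _ _⟩
  have h1 : IntervalIntegrable (fun s => k (t - s)) volume 0 (min t σ) := by
    have := (hk.intervalIntegrable ht.1 (sub_nonneg.2 (min_le_left t σ))).comp_sub_left t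
    simpa using this
  have h2 : IntervalIntegrable (fun s => l (r - s + σ)) volume 0 r := by
    have := ((hl.shift hσ).intervalIntegrable hrm.1 le_rfl).comp_sub_left r
    simpa using this
  obtain ⟨Q1, hQ1⟩ := exists_clm_integral hT.continuousOn hm h1
  obtain ⟨Q2, hQ2⟩ := exists_clm_integral hS.continuousOn hrm h2
  refine ⟨Q1 + ((T σ).comp (S r) + Q2), fun x => ?_⟩
  rw [extFun, vconv_indicator_Iic _ _ ht.1 hσ, ← hr]
  simp only [add_apply, ContinuousLinearMap.comp_apply, hQ1, hQ2, vconv]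

/-- Cutting off the second factor at `σ` and freezing it after `σ` differ by a multiple of the
primitive of `k`. -/
lemma vconv_freeze_eq (hk : LOneLoc k) (hσ : 0 ≤ σ) {F : ℝ → X} (hF : ContinuousOn F (Icc 0 σ))
    {t : ℝ} (ht : 0 ≤ t) :
    vconv k (fun s => F (min s σ)) t = vconv k ((Iic σ).indicator F) t +
      vconv k (fun _ => F σ) (max (t - σ) 0) := by
  have hfr : ContinuousOn (fun s => F (min s σ)) (Icc 0 t) :=
    hF.comp (by fun_prop) fun s hs => ⟨le_min hs.1 hσ, min_le_right _ _⟩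
  have hind : BddMeasOn ((Iic σ).indicator F) t := hF.bddMeasOn.indicator σ t (Or.inr le_rfl)
  have h1 := vconv_eq_vconv_shift (a := k) (t := t)
    (H := fun s => F (min s σ) - (Iic σ).indicator F s) hσ ht fun s hs => by
      rw [indicator_of_mem (show s ∈ Iic σ from hs.2), min_eq_left hs.2, sub_self]
  rw [vconv_sub_right hk hfr.bddMeasOn hind ⟨ht, le_rfl⟩] at h1
  rw [← sub_eq_iff_eq_add', h1]
  refine intervalIntegral.integral_congr_ae (ae_of_all _ fun s hs => ?_)
  rw [uIoc_of_le (le_max_right _ _)] at hs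
  beta_reduce
  rw [min_eq_right (by linarith [hs.1]),
    indicator_of_notMem (show s + σ ∉ Iic σ by simp [hs.1]), sub_zero]

lemma vconv_const [CompleteSpace X] (a : ℝ → ℂ) (x : X) (t : ℝ) :
    vconv a (fun _ => x) t = (∫ s in (0 : ℝ)..t, a s) • x := by
  rw [vconv_eq_integral_comp_sub, intervalIntegral.integral_smul_const]

lemma continuousOn_extFun [CompleteSpace X] (hk : LOneLoc k) (hl : LOneLoc l) (hσ : 0 ≤ σ)
    (hτ : 0 ≤ τ) (hS : IsLocalConvSemigroup k τ S A) (hT : IsLocalConvSemigroup l σ T A) (x : X) :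
    ContinuousOn (fun t => extFun k l σ S T t x) (Icc 0 (σ + τ)) := by
  have hmax : ContinuousOn (fun t : ℝ => max (t - σ) 0) (Icc 0 (σ + τ)) := by fun_prop
  have hmaps : MapsTo (fun t : ℝ => max (t - σ) 0) (Icc 0 (σ + τ)) (Icc 0 τ) :=
    fun t ht => max_sub_mem hτ ht
  have h1 : ContinuousOn (vconv k fun s => T (min s σ) x) (Icc 0 (σ + τ)) :=
    continuousOn_vconv hk ((hT.continuousOn x).comp (by fun_prop)
      fun s hs => ⟨le_min hs.1 hσ, min_le_right _ _⟩)
  have h2 : ContinuousOn (fun r => T σ (S r x) +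
      vconv (fun u => l (u + σ)) (fun s => S s x) r - vconv k (fun _ => T σ x) r) (Icc 0 τ) :=
    (((T σ).continuous.comp_continuousOn (hS.continuousOn x)).add
      (continuousOn_vconv (hl.shift hσ) (hS.continuousOn x))).sub
      (continuousOn_vconv hk continuousOn_const)
  refine (h1.add (h2.comp hmax hmaps)).congr fun t ht => ?_
  rw [Pi.add_apply, Function.comp_apply, extFun,
    vconv_freeze_eq hk hσ (F := fun s => T s x) (hT.continuousOn x) ht.1]
  abel

/-- `k * L` splits at `σ`, where `L` is the primitive of `l`. -/
lemma conv_primitive_split (hk : LOneLoc k) (hl : LOneLoc l) (hσ : 0 ≤ σ) {t : ℝ} (ht : 0 ≤ t) :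
    conv k (fun s => ∫ u in (0 : ℝ)..min s σ, l u) t +
      conv (fun u => l (u + σ)) (fun s => ∫ u in (0 : ℝ)..s, k u) (max (t - σ) 0) =
    ∫ s in (0 : ℝ)..t, conv k l s := by
  set r := max (t - σ) 0
  have hr : 0 ≤ r := le_max_right _ _
  set L : ℝ → ℂ := fun s => ∫ u in (0 : ℝ)..s, l u with hL
  have hone : ∀ (f : ℝ → ℂ), vconv f (fun _ => (1 : ℂ)) = fun t => ∫ s in (0 : ℝ)..t, f s := by
    intro f; ext t; rw [vconv_const, smul_eq_mul, mul_one]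
  have h1 : ∫ s in (0 : ℝ)..t, conv k l s = vconv k L t := by
    have := vconv_assoc hk hl (bddMeasOn_const (1 : ℂ) t) ⟨ht, le_rfl⟩
    rw [hone, hone] at this
    exact this.symm
  have h2 : conv (fun u => l (u + σ)) (fun s => ∫ u in (0 : ℝ)..s, k u) r =
      vconv k (fun s => ∫ u in (0 : ℝ)..s, l (u + σ)) r := by
    have e1 := vconv_assoc hk (hl.shift hσ) (bddMeasOn_const (1 : ℂ) r) ⟨hr, le_rfl⟩
    have e2 := vconv_assoc (hl.shift hσ) hk (bddMeasOn_const (1 : ℂ) r) ⟨hr, le_rfl⟩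
    rw [hone] at e1 e2
    rw [e1, conv_comm k, ← e2]
    rfl
  have hLc : ContinuousOn L (Icc 0 t) := continuousOn_primitive hl t
  have hLm : ContinuousOn (fun s => L (min s σ)) (Icc 0 t) :=
    hLc.comp (by fun_prop) fun s hs => ⟨le_min hs.1 hσ, (min_le_left _ _).trans hs.2⟩
  have h3 := vconv_eq_vconv_shift (a := k) (t := t) (H := fun s => L s - L (min s σ)) hσ ht
    fun s hs => by rw [min_eq_left hs.2, sub_self]
  rw [vconv_sub_right hk hLc.bddMeasOn hLm.bddMeasOn ⟨ht, le_rfl⟩] at h3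
  rw [h1, h2, eq_comm, conv_eq_vconv, ← sub_eq_iff_eq_add', h3]
  refine vconv_congr hr (fun _ _ => rfl) fun s hs => ?_
  rw [min_eq_right (by linarith [hs.1]), hL]
  simp only
  rw [intervalIntegral.integral_interval_sub_left
    (hl.intervalIntegrable le_rfl (add_nonneg hs.1 hσ)) (hl.intervalIntegrable le_rfl hσ),
    intervalIntegral.integral_comp_add_right (fun u => l u), zero_add]

lemma integral_max_sub {P : ℝ → X} (hσ : 0 ≤ σ) (hP0 : P 0 = 0) {t : ℝ} (ht : 0 ≤ t) :
    ∫ s in (0 : ℝ)..t, P (max (s - σ) 0) = ∫ s in (0 : ℝ)..max (t - σ) 0, P s := by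
  have h := vconv_eq_vconv_shift (a := fun _ => 1) (H := fun s => P (max (s - σ) 0)) hσ ht
    fun s hs => by rw [max_eq_right (by linarith [hs.2]), hP0]
  rw [vconv_one_left, vconv_one_left] at h
  rw [h]
  refine intervalIntegral.integral_congr fun s hs => ?_
  rw [uIcc_of_le (le_max_right _ _)] at hs
  simp only [add_sub_cancel_right, max_eq_left hs.1]

/-- The extension theorem for local convoluted semigroups. That `A ∫₀ᵗ R(s)x ds` has the right value
is checked on the three summands of `extFun`; the terms with `T(σ)x` that arise from the cut-off at
`σ` cancel by `vconv_freeze_eq`, and the scalar terms add up by `conv_primitive_split`. -/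
theorem exists_extension [CompleteSpace X] (hk : LOneLoc k) (hl : LOneLoc l) (hσ : 0 ≤ σ)
    (hτ : 0 ≤ τ) (hS : IsLocalConvSemigroup k τ S A) (hT : IsLocalConvSemigroup l σ T A) :
    ∃ R : ℝ → X →L[ℂ] X, IsLocalConvSemigroup (conv k l) (σ + τ) R A ∧
      ∀ t ∈ Icc 0 (σ + τ), ∀ x, R t x = extFun k l σ S T t x := by
  have hex : ∀ t, ∃ Q : X →L[ℂ] X, t ∈ Icc 0 (σ + τ) → ∀ x, Q x = extFun k l σ S T t x := by
    intro t
    by_cases ht : t ∈ Icc 0 (σ + τ)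
    · obtain ⟨Q, hQ⟩ := exists_clm_extFun hk hl hσ hτ hS hT ht
      exact ⟨Q, fun _ => hQ⟩
    · exact ⟨0, fun h => absurd h ht⟩
  choose R hR using hex
  have hA := hS.closed
  refine ⟨R, IsLocalConvSemigroup.of_graph hA (fun x => ?_) (fun t ht x y hxy => ?_)
    (fun t ht x => ?_), hR⟩
  · exact (continuousOn_extFun hk hl hσ hτ hS hT x).congr fun t ht => hR t ht x
  · rw [hR t ht, hR t ht]
    have hrm := max_sub_mem hτ ht
    have g1 : (vconv k ((Iic σ).indicator fun s => T s x) t,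
        vconv k ((Iic σ).indicator fun s => T s y) t) ∈ A.graph := by
      refine vconv_mem_graph (T := t) hA hk
        ((hT.continuousOn x).bddMeasOn.indicator σ t (Or.inr le_rfl))
        ((hT.continuousOn y).bddMeasOn.indicator σ t (Or.inr le_rfl)) ⟨ht.1, le_rfl⟩
        fun s hs => ?_
      by_cases hsσ : s ∈ Iic σ
      · rw [indicator_of_mem hsσ, indicator_of_mem hsσ]
        exact hT.commute_graph ⟨hs.1, hsσ⟩ hxy
      · rw [indicator_of_notMem hsσ, indicator_of_notMem hsσ]
        exact A.graph.zero_mem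
    have g2 := hT.commute_graph ⟨hσ, le_rfl⟩ (hS.commute_graph hrm hxy)
    have g3 := vconv_mem_graph hA (hl.shift hσ) (hS.continuousOn x).bddMeasOn
      (hS.continuousOn y).bddMeasOn hrm fun s hs =>
        hS.commute_graph ⟨hs.1, hs.2.trans hrm.2⟩ hxy
    exact A.graph.add_mem g1 (A.graph.add_mem g2 g3)
  · set r := max (t - σ) 0 with hr
    have hrm : r ∈ Icc 0 τ := max_sub_mem hτ ht
    set F : ℝ → X := fun s => T s x with hF
    have hFc : ContinuousOn F (Icc 0 σ) := hT.continuousOn x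
    have hFi : BddMeasOn ((Iic σ).indicator F) t := hFc.bddMeasOn.indicator σ t (Or.inr le_rfl)
    have hSc := hS.continuousOn x
    set P : ℝ → X := fun ρ => T σ (S ρ x) + vconv (fun u => l (u + σ)) (fun s => S s x) ρ with hP
    have hPc1 : ContinuousOn (fun ρ => T σ (S ρ x)) (Icc 0 τ) :=
      (T σ).continuous.comp_continuousOn hSc
    have hPc2 := continuousOn_vconv (hl.shift hσ) hSc
    have hPc : ContinuousOn P (Icc 0 τ) := hPc1.add hPc2
    have hP0 : P 0 = 0 := by simp [hP, hS.zero_apply hτ]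
    have hmaxc : ContinuousOn (fun s : ℝ => P (max (s - σ) 0)) (Icc 0 t) :=
      hPc.comp (by fun_prop) fun s hs => max_sub_mem hτ ⟨hs.1, hs.2.trans ht.2⟩
    have h0t : t ∈ Icc 0 t := ⟨ht.1, le_rfl⟩
    have h00 : (0 : ℝ) ∈ Icc 0 t := ⟨le_rfl, ht.1⟩
    have hFr : ContinuousOn (fun s => F (min s σ)) (Icc 0 t) :=
      hFc.comp (by fun_prop) fun s hs => ⟨le_min hs.1 hσ, min_le_right _ _⟩
    set L : ℝ → ℂ := fun s => ∫ u in (0 : ℝ)..s, l u with hL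
    have hLr : ContinuousOn (fun s => L (min s σ)) (Icc 0 t) :=
      (continuousOn_primitive hl t).comp (by fun_prop)
        fun s hs => ⟨le_min hs.1 hσ, (min_le_left _ _).trans hs.2⟩
    have hLx : ContinuousOn (fun s => L (min s σ) • x) (Icc 0 t) := hLr.smul continuousOn_const
    have hKx : ContinuousOn (fun s => (∫ u in (0 : ℝ)..s, k u) • x) (Icc 0 τ) :=
      (continuousOn_primitive hk τ).smul continuousOn_const
    have hcvF : BddMeasOn (vconv k ((Iic σ).indicator F)) t := by
      refine ContinuousOn.bddMeasOn ((continuousOn_vconv hk hFr).sub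
        (((continuousOn_vconv hk (F := fun _ => F σ) (T := τ) continuousOn_const).comp
          (f := fun s => max (s - σ) 0) (by fun_prop : ContinuousOn _ (Icc 0 t))
          fun s hs => max_sub_mem hτ ⟨hs.1, hs.2.trans ht.2⟩))|>.congr fun s hs => ?_)
      rw [eq_comm]
      exact sub_eq_of_eq_add (vconv_freeze_eq hk hσ hFc hs.1)
    -- the integral of the extension
    have hint : ∫ s in (0 : ℝ)..t, R s x = vconv k (vconv (fun _ => 1) ((Iic σ).indicator F)) t +
        (T σ (∫ s in (0 : ℝ)..r, S s x) +
          vconv (fun u => l (u + σ)) (fun ρ => ∫ s in (0 : ℝ)..ρ, S s x) r) := by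
      have e1 : ∫ s in (0 : ℝ)..t, R s x =
          ∫ s in (0 : ℝ)..t, (vconv k ((Iic σ).indicator F) s + P (max (s - σ) 0)) := by
        refine intervalIntegral.integral_congr fun s hs => ?_
        rw [uIcc_of_le ht.1] at hs
        exact hR s ⟨hs.1, hs.2.trans ht.2⟩ x
      have e2 : ∫ s in (0 : ℝ)..t, vconv k ((Iic σ).indicator F) s =
          vconv k (vconv (fun _ => 1) ((Iic σ).indicator F)) t := by
        rw [vconv_assoc hk (lOneLoc_const 1) hFi h0t, conv_comm,
          ← vconv_assoc (lOneLoc_const 1) hk hFi h0t, vconv_one_left]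
      have e3 : ∫ s in (0 : ℝ)..r, vconv (fun u => l (u + σ)) (fun s => S s x) s =
          vconv (fun u => l (u + σ)) (fun ρ => ∫ s in (0 : ℝ)..ρ, S s x) r := by
        have := vconv_assoc (hl.shift hσ) (lOneLoc_const 1) hSc.bddMeasOn hrm
        rw [conv_comm, ← vconv_assoc (lOneLoc_const 1) (hl.shift hσ) hSc.bddMeasOn hrm,
          vconv_one_left] at this
        rw [← this]
        exact vconv_congr hrm.1 (fun _ _ => rfl) fun s _ => vconv_one_left _ _
      have hr0 : (0 : ℝ) ∈ Icc 0 τ := ⟨le_rfl, hτ⟩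
      rw [e1, intervalIntegral.integral_add (hcvF.intervalIntegrable h00 h0t)
        (hmaxc.bddMeasOn.intervalIntegrable h00 h0t), e2, integral_max_sub hσ hP0 ht.1, hP,
        intervalIntegral.integral_add (hPc1.bddMeasOn.intervalIntegrable hr0 hrm)
          (hPc2.bddMeasOn.intervalIntegrable hr0 hrm), e3,
        (T σ).intervalIntegral_comp_comm (hSc.bddMeasOn.intervalIntegrable hr0 hrm)]
    -- the generator applied to each of the three summands
    have g1 : (vconv k (vconv (fun _ => 1) ((Iic σ).indicator F)) t,
        vconv k (fun s => F (min s σ) - L (min s σ) • x) t) ∈ A.graph := by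
      have hprim : ∀ s, 0 ≤ s → vconv (fun _ => 1) ((Iic σ).indicator F) s =
          vconv (fun _ => 1) F (min s σ) := fun s hs => by
        rw [vconv_indicator_Iic _ _ hs hσ, vconv_one_left]
        simp
      have hprimc : ContinuousOn (vconv (fun _ => 1) ((Iic σ).indicator F)) (Icc 0 t) :=
        ((continuousOn_vconv (lOneLoc_const 1) hFc).comp (f := fun s => min s σ) (by fun_prop)
          fun s hs => ⟨le_min hs.1 hσ, min_le_right _ _⟩).congr fun s hs => hprim s hs.1
      refine vconv_mem_graph hA hk hprimc.bddMeasOn (hFr.sub hLx).bddMeasOn h0t fun s hs => ?_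
      rw [hprim s hs.1, vconv_one_left]
      exact hT.integral_graph ⟨le_min hs.1 hσ, min_le_right _ _⟩ x
    have g2 := hT.commute_graph ⟨hσ, le_rfl⟩ (hS.integral_graph hrm x)
    have g3 : (vconv (fun u => l (u + σ)) (fun ρ => ∫ s in (0 : ℝ)..ρ, S s x) r,
        vconv (fun u => l (u + σ)) (fun ρ => S ρ x - (∫ s in (0 : ℝ)..ρ, k s) • x) r) ∈
          A.graph := by
      refine vconv_mem_graph hA (hl.shift hσ) ?_ (hSc.sub hKx).bddMeasOn
        hrm fun s hs => hS.integral_graph ⟨hs.1, hs.2.trans hrm.2⟩ x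
      refine ContinuousOn.bddMeasOn (T := τ) ((continuousOn_vconv (lOneLoc_const 1) hSc).congr
        fun s _ => (vconv_one_left _ _).symm)
    rw [hint]
    convert A.graph.add_mem g1 (A.graph.add_mem g2 g3) using 1
    refine Prod.ext rfl ?_
    simp only [Prod.snd_add]
    rw [vconv_sub_right hk hFr.bddMeasOn hLx.bddMeasOn h0t,
      vconv_sub_right (hl.shift hσ) hSc.bddMeasOn hKx.bddMeasOn hrm,
      vconv_smul_const, vconv_smul_const, vconv_freeze_eq hk hσ hFc ht.1, vconv_const, hR t ht,
      ← conv_primitive_split hk hl hσ ht.1, extFun, map_sub, map_smul, add_smul]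
    simp only [← hr, hF, hL]
    abel

end Extension

section Family

variable {X : Type*} [NormedAddCommGroup X] [NormedSpace ℂ X]
  {k : ℝ → ℂ} {τ : ℝ} {S : ℝ → X →L[ℂ] X} {A : X →ₗ.[ℂ] X}

/-- Joint continuity of `(t, v) ↦ S(t) v` for a bounded strongly continuous family. -/
lemma continuousOn_clm_apply {C : ℝ} (hS : ∀ x, ContinuousOn (fun t => S t x) (Icc 0 τ))
    (hC : ∀ t ∈ Icc 0 τ, ‖S t‖ ≤ C) {Y : Type*} [TopologicalSpace Y] {s : Set Y} {p : Y → ℝ}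
    {v : Y → X} (hp : ContinuousOn p s) (hv : ContinuousOn v s) (hps : MapsTo p s (Icc 0 τ)) :
    ContinuousOn (fun y => S (p y) (v y)) s := by
  intro y hy
  rw [ContinuousWithinAt, tendsto_iff_norm_sub_tendsto_zero]
  have h1 : Filter.Tendsto (fun z => C * ‖v z - v y‖ + ‖S (p z) (v y) - S (p y) (v y)‖)
      (𝓝[s] y) (𝓝 0) := by
    have e1 := (tendsto_iff_norm_sub_tendsto_zero.1 (hv y hy)).const_mul C
    have e2 := tendsto_iff_norm_sub_tendsto_zero.1 (((hS (v y)).comp hp hps) y hy)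
    simpa using e1.add e2
  refine squeeze_zero' (Filter.Eventually.of_forall fun _ => norm_nonneg _) ?_ h1
  filter_upwards [self_mem_nhdsWithin] with z hz
  have : S (p z) (v z) - S (p y) (v y) =
      S (p z) (v z - v y) + (S (p z) (v y) - S (p y) (v y)) := by
    rw [map_sub]; abel
  rw [this]
  refine (norm_add_le _ _).trans (add_le_add_left ?_ _)
  exact ((S (p z)).le_opNorm _).trans (mul_le_mul_of_nonneg_right (hC _ (hps hz)) (norm_nonneg _))

variable [CompleteSpace X]

/-- The extended family is a local `k^{*n}`-convoluted semigroup on `[0, nτ]`. -/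
theorem exists_extFamily_clm (hk : LOneLoc k) (hτ : 0 ≤ τ) (hS : IsLocalConvSemigroup k τ S A)
    (n : ℕ) :
    ∃ T : ℝ → X →L[ℂ] X, IsLocalConvSemigroup (convPow k (n + 1)) ((n + 1 : ℕ) * τ) T A ∧
      ∀ t ∈ Icc 0 ((n + 1 : ℕ) * τ), ∀ x, extFamily k τ S (n + 1) t x = T t x := by
  induction n with
  | zero =>
    refine ⟨S, ?_, fun t _ x => rfl⟩
    simpa [convPow] using hS
  | succ n ih =>
    obtain ⟨T, hT, hTe⟩ := ih
    set σ : ℝ := (n + 1 : ℕ) * τ with hσ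
    have hσ0 : 0 ≤ σ := by positivity
    have hσ' : ((n : ℝ) + 1) * τ = σ := by rw [hσ]; push_cast; ring
    obtain ⟨R, hR, hRe⟩ := exists_extension hk (hk.convPow n) hσ0 hτ hS hT
    have hend : ((n + 1 + 1 : ℕ) : ℝ) * τ = σ + τ := by rw [hσ]; push_cast; ring
    refine ⟨R, by rw [hend]; exact hR, fun t ht x => ?_⟩
    rw [hend] at ht
    rw [hRe t ht, extFamily, hσ']
    have hint : ∀ b, 0 ≤ b → b ≤ σ →
        ∫ s in (0 : ℝ)..b, k (t - s) • extFamily k τ S (n + 1) s x =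
        ∫ s in (0 : ℝ)..b, k (t - s) • T s x := fun b hb hbσ => by
      refine intervalIntegral.integral_congr fun s hs => ?_
      rw [uIcc_of_le hb] at hs
      simp only [hTe s ⟨hs.1, hs.2.trans hbσ⟩]
    beta_reduce
    split_ifs with htσ
    · rw [extFun_of_le hτ hS ⟨ht.1, htσ⟩, hint t ht.1 htσ]
      rfl
    · rw [extFun_of_gt hσ0 (not_le.1 htσ), hint σ hσ0 le_rfl, hTe σ ⟨hσ0, le_rfl⟩]

/-! ### Uniqueness of mild solutions -/

/-- The only mild solution of `v' = A v`, `v(0) = 0`, is zero, if `A` generates a local convoluted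
semigroup. Applying `A` to both sides of `∫₀ᵗ S(t - s) V(s) ds = ∫₀ᵗ Σ(t - s) v(s) ds`, where
`V = ∫ v` and `Σ = ∫ S`, shows that the primitive `K` of `k` satisfies `K * v = 0`. -/
theorem mild_solution_eq_zero (hk : LOneLoc k) (hk0 : ZeroMemSupp k)
    (hS : IsLocalConvSemigroup k τ S A) {v : ℝ → X} (hv : ContinuousOn v (Icc 0 τ))
    (hvA : ∀ t ∈ Icc 0 τ, (∫ s in (0 : ℝ)..t, v s, v t) ∈ A.graph) :
    ∀ t ∈ Ico 0 τ, v t = 0 := by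
  refine eq_zero_of_vconv_primitive hk hk0 hv fun t ht => ?_
  have hA := hS.closed
  have hsub : Icc 0 t ⊆ Icc 0 τ := Icc_subset_Icc_right ht.2
  have hvt := hv.mono hsub
  obtain ⟨C, -, hC⟩ := exists_norm_le_of_continuousOn hS.continuousOn
  have hrev : MapsTo (fun s => t - s) (Icc 0 t) (Icc 0 τ) := fun s hs =>
    ⟨by linarith [hs.2], by linarith [hs.1, ht.2]⟩
  have hex : ∀ r, ∃ Q : X →L[ℂ] X, r ∈ Icc 0 τ → ∀ x, Q x = ∫ s in (0 : ℝ)..r, S s x := by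
    intro r
    by_cases hr : r ∈ Icc 0 τ
    · obtain ⟨Q, hQ⟩ := exists_clm_integral (a := fun _ => 1) hS.continuousOn hr (by simp)
      exact ⟨Q, fun _ x => by simpa using hQ x⟩
    · exact ⟨0, fun h => absurd h hr⟩
  choose Q hQ using hex
  have hQc : ∀ x, ContinuousOn (fun r => Q r x) (Icc 0 τ) := fun x =>
    (continuousOn_vconv (lOneLoc_const 1) (hS.continuousOn x)).congr fun r hr => by
      rw [vconv_one_left]; exact hQ r hr x
  obtain ⟨D, -, hD⟩ := exists_norm_le_of_continuousOn hQc
  set V : ℝ → X := fun s => ∫ r in (0 : ℝ)..s, v r with hV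
  have hVc : ContinuousOn V (Icc 0 t) :=
    (continuousOn_vconv (lOneLoc_const 1) hvt).congr fun r _ => (vconv_one_left _ _).symm
  have hrevc : ContinuousOn (fun s => t - s) (Icc 0 t) := by fun_prop
  have hII : ∀ {f : ℝ → X}, ContinuousOn f (Icc 0 t) → IntervalIntegrable f volume 0 t :=
    fun hf => ContinuousOn.intervalIntegrable (by rwa [uIcc_of_le ht.1])
  have c1 := continuousOn_clm_apply hS.continuousOn hC hrevc hVc hrev
  have c2 := continuousOn_clm_apply hS.continuousOn hC hrevc hvt hrev
  have c3 := continuousOn_clm_apply hQc hD hrevc hvt hrev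
  have c4 : ContinuousOn (fun s => (∫ u in (0 : ℝ)..(t - s), k u) • v s) (Icc 0 t) :=
    ((continuousOn_primitive hk τ).comp hrevc hrev).smul hvt
  have hswap : ∫ s in (0 : ℝ)..t, S (t - s) (V s) = ∫ r in (0 : ℝ)..t, Q (t - r) (v r) := by
    have hφ : ContinuousOn (fun p : ℝ × ℝ => S (t - p.1) (v p.2)) (Icc 0 t ×ˢ Icc 0 t) :=
      continuousOn_clm_apply hS.continuousOn hC (by fun_prop)
        (hvt.comp continuousOn_snd fun p hp => hp.2) fun p hp => hrev hp.1
    have hD : MeasurableSet {p : ℝ × ℝ | 0 < p.2 ∧ p.2 < p.1 ∧ p.1 ≤ t} :=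
      (measurableSet_lt measurable_const measurable_snd).inter
        ((measurableSet_lt measurable_snd measurable_fst).inter
          (measurableSet_le measurable_fst measurable_const))
    have h := integral_triangle_swap (φ := fun s r => S (t - s) (v r)) ht.1 (by
      refine (integrable_indicator_iff hD).2 (IntegrableOn.mono_set (t := Icc 0 t ×ˢ Icc 0 t)
        (hφ.integrableOn_compact (isCompact_Icc.prod isCompact_Icc)) ?_)
      rintro p ⟨h1, h2, h3⟩
      exact ⟨⟨(h1.trans h2).le, h3⟩, ⟨h1.le, h2.le.trans h3⟩⟩)
    have e1 : ∫ s in (0 : ℝ)..t, S (t - s) (V s) =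
        ∫ s in (0 : ℝ)..t, ∫ r in (0 : ℝ)..s, S (t - s) (v r) := by
      refine intervalIntegral.integral_congr fun s hs => ?_
      rw [uIcc_of_le ht.1] at hs
      exact ((S (t - s)).intervalIntegral_comp_comm
        (hvt.bddMeasOn.intervalIntegrable ⟨le_rfl, ht.1⟩ hs)).symm
    rw [e1, h]
    refine intervalIntegral.integral_congr fun r hr => ?_
    rw [uIcc_of_le ht.1] at hr
    rw [hQ (t - r) (hrev hr),
      intervalIntegral.integral_comp_sub_left (fun s => S s (v r)), sub_self]
  have g1 : (∫ s in (0 : ℝ)..t, S (t - s) (V s), ∫ s in (0 : ℝ)..t, S (t - s) (v s)) ∈ A.graph :=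
    integral_mem_graph hA (hII c1) (hII c2) fun s hs => by
      rw [uIoc_of_le ht.1] at hs
      have hs' := Ioc_subset_Icc_self hs
      exact hS.commute_graph (hrev hs') (hvA s (hsub hs'))
  have g2 : (∫ r in (0 : ℝ)..t, Q (t - r) (v r), ∫ s in (0 : ℝ)..t,
      (S (t - s) (v s) - (∫ u in (0 : ℝ)..(t - s), k u) • v s)) ∈ A.graph :=
    integral_mem_graph hA (hII c3) ((hII c2).sub (hII c4)) fun s hs => by
      rw [uIoc_of_le ht.1] at hs
      have hs' := Ioc_subset_Icc_self hs
      rw [hQ _ (hrev hs')]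
      exact hS.integral_graph (hrev hs') (v s)
  rw [hswap] at g1
  have heq := A.mem_graph_snd_inj g1 g2 rfl
  rw [intervalIntegral.integral_sub (hII c2) (hII c4)] at heq
  exact sub_eq_self.1 heq.symm

end Family

/-! ### The dual convolution on test functions -/

lemma DPlus.apply_of_neg {g : ℝ → ℂ} (hg : g ∈ DPlus) {t : ℝ} (ht : t < 0) : g t = 0 := by
  obtain ⟨φ, -, -, rfl⟩ := hg
  exact indicator_of_notMem (not_le.2 ht) _

lemma DPlus.continuousOn {g : ℝ → ℂ} (hg : g ∈ DPlus) : ContinuousOn g (Ici 0) := by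
  obtain ⟨φ, hφ, -, rfl⟩ := hg
  exact hφ.continuous.continuousOn.congr fun t ht => indicator_of_mem ht _

lemma DPlus.exists_bound {g : ℝ → ℂ} (hg : g ∈ DPlus) : ∃ R, 0 < R ∧ ∀ t, R < t → g t = 0 := by
  obtain ⟨φ, -, hφc, rfl⟩ := hg
  obtain ⟨T, hT⟩ := hφc.isCompact.bddAbove
  refine ⟨max T 1, by positivity, fun t ht => ?_⟩
  have : φ t = 0 := image_eq_zero_of_notMem_tsupport fun hm =>
    absurd (hT hm) (not_le.2 ((le_max_left _ _).trans_lt ht))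
  by_cases h : t ∈ Ici (0 : ℝ) <;> simp [h, this]

lemma DPlus.integrable {g : ℝ → ℂ} (hg : g ∈ DPlus) : Integrable g := by
  obtain ⟨φ, hφ, hφc, rfl⟩ := hg
  exact (hφ.continuous.integrable_of_hasCompactSupport hφc).indicator measurableSet_Ici

lemma DPlus.exists_norm_le {g : ℝ → ℂ} (hg : g ∈ DPlus) : ∃ C, ∀ t, ‖g t‖ ≤ C := by
  obtain ⟨φ, hφ, hφc, rfl⟩ := hg
  obtain ⟨C, hC⟩ := hφc.exists_bound_of_continuous hφ.continuous
  exact ⟨C, fun t => (norm_indicator_le_norm_self _ _).trans (hC t)⟩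

/-- The dual convolution becomes a convolution after the reflection `u ↦ L - u`. -/
lemma dualConv_eq_conv_reflect {k g : ℝ → ℂ} {L : ℝ} (hL : ∀ t, L < t → g t = 0) {t : ℝ}
    (ht : t ∈ Icc 0 L) : dualConv k g t = conv k (fun u => g (L - u)) (L - t) := by
  rw [dualConv, indicator_of_mem (show t ∈ Ici (0 : ℝ) from ht.1)]
  have h1 : ∫ s in Ioi t, k (s - t) * g s = ∫ s in Ioc t L, k (s - t) * g s := by
    refine setIntegral_eq_of_subset_of_forall_sdiff_eq_zero measurableSet_Ioi
      Ioc_subset_Ioi_self fun s hs => ?_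
    rw [hL s (not_le.1 fun h => hs.2 ⟨hs.1, h⟩), mul_zero]
  have h2 := intervalIntegral.integral_comp_sub_left (fun s => k (s - t) * g s) (a := 0)
    (b := L - t) L
  rw [sub_sub_cancel, sub_zero, intervalIntegral.integral_of_le ht.2] at h2
  rw [h1, ← h2, conv]
  refine intervalIntegral.integral_congr fun s _ => ?_
  congr 2
  ring

lemma dualConv_of_neg (k g : ℝ → ℂ) {t : ℝ} (ht : t < 0) : dualConv k g t = 0 :=
  indicator_of_notMem (not_le.2 ht) _

lemma dualConv_of_ge {k g : ℝ → ℂ} {L : ℝ} (hL : ∀ t, L < t → g t = 0) {t : ℝ} (ht : L ≤ t) :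
    dualConv k g t = 0 := by
  by_cases h0 : t ∈ Ici (0 : ℝ)
  · rw [dualConv, indicator_of_mem h0]
    refine setIntegral_eq_zero_of_forall_eq_zero fun s hs => ?_
    rw [hL s (lt_of_le_of_lt ht hs), mul_zero]
  · exact indicator_of_notMem h0 _

lemma DPlus.continuousOn_reflect {g : ℝ → ℂ} (hg : g ∈ DPlus) (L : ℝ) :
    ContinuousOn (fun u => g (L - u)) (Icc 0 L) :=
  (DPlus.continuousOn hg).comp (by fun_prop) fun u hu => sub_nonneg.2 hu.2

/-- The support of `g` is contained in `[0, a]` if that of `k ∘ g` is. -/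
lemma suppIn_of_dualConv {k g : ℝ → ℂ} (hk : LOneLoc k) (hk0 : ZeroMemSupp k) (hg : g ∈ DPlus)
    {a : ℝ} (h : SuppIn (dualConv k g) a) (ha : 0 ≤ a) : SuppIn g a := by
  intro t ht0 hat
  obtain ⟨R, -, hR⟩ := DPlus.exists_bound hg
  set L := max R t + 1 with hLdef
  have htL : t < L := (le_max_right R t).trans_lt (lt_add_one _)
  have hL : ∀ s, L < s → g s = 0 := fun s hs =>
    hR s (((le_max_left R t).trans (lt_add_one _).le).trans_lt hs)
  have hz := eq_zero_of_conv hk hk0 (T := L - (a + t) / 2)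
    ((DPlus.continuousOn_reflect hg L).mono (Icc_subset_Icc_right (by linarith)))
    (fun s hs => by
      have := dualConv_eq_conv_reflect (k := k) hL (t := L - s)
        ⟨by linarith [hs.2], by linarith [hs.1]⟩
      rw [sub_sub_cancel] at this
      rw [← this]
      exact h _ (by linarith [hs.2]) (by linarith [hs.2]))
    (L - t) ⟨by linarith, by linarith⟩
  simpa using hz

lemma DPlus.eq_zero_of_Ioi {g : ℝ → ℂ} (hg : g ∈ DPlus) (h : ∀ t, 0 < t → g t = 0) : g = 0 := by
  have h0 : EqOn g 0 (Ici 0) := by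
    have h1 : EqOn g 0 (Ioi 0) := fun t ht => h t ht
    exact h1.of_subset_closure (DPlus.continuousOn hg) continuousOn_const Ioi_subset_Ici_self
      (by rw [closure_Ioi])
  ext t
  rcases lt_or_ge t 0 with ht | ht
  · exact DPlus.apply_of_neg hg ht
  · exact h0 ht

lemma dualConv_sub {k g h : ℝ → ℂ} (hk : LOneLoc k) (hg : g ∈ DPlus) (hh : h ∈ DPlus) :
    dualConv k (g - h) = dualConv k g - dualConv k h := by
  have h1 := dualConv_add hk hg (DPlus.smul_mem (-1) hh)
  rw [dualConv_smul, neg_one_smul, neg_one_smul, ← sub_eq_add_neg, ← sub_eq_add_neg] at h1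
  exact h1

/-- The map `g ↦ k ∘ g` is injective on `𝒟₊`. -/
lemma dualConv_injOn {k : ℝ → ℂ} (hk : LOneLoc k) (hk0 : ZeroMemSupp k) :
    InjOn (dualConv k) (DPlus : Set (ℝ → ℂ)) := by
  intro g hg h hh hgh
  have hsub : g - h ∈ DPlus := DPlus.sub_mem hg hh
  refine sub_eq_zero.1 (DPlus.eq_zero_of_Ioi hsub fun t ht => ?_)
  refine suppIn_of_dualConv hk hk0 hsub (a := 0) (fun s _ _ => ?_) le_rfl t ht.le ht
  rw [dualConv_sub hk hg hh, hgh, sub_self, Pi.zero_apply]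

lemma W_mem {k f : ℝ → ℂ} {hk : LOneLoc k} (hf : f ∈ DK k hk) : W k f ∈ DPlus := by
  obtain ⟨g, hg, hgf⟩ := hf
  exact Function.invFunOn_mem (f := dualConv k) (s := (DPlus : Set (ℝ → ℂ))) ⟨g, hg, hgf⟩

lemma dualConv_W {k f : ℝ → ℂ} {hk : LOneLoc k} (hf : f ∈ DK k hk) : dualConv k (W k f) = f := by
  obtain ⟨g, hg, hgf⟩ := hf
  exact Function.invFunOn_eq (f := dualConv k) (s := (DPlus : Set (ℝ → ℂ))) ⟨g, hg, hgf⟩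

lemma W_dualConv {k g : ℝ → ℂ} (hk : LOneLoc k) (hk0 : ZeroMemSupp k) (hg : g ∈ DPlus) :
    W k (dualConv k g) = g :=
  (dualConv_injOn hk hk0).leftInvOn_invFunOn hg

/-- The kernel `v ↦ k(-v)`, cut off outside `[-R, 0)`, whose convolution with functions supported
in `(-∞, R]` agrees on `[0, ∞)` with the dual convolution. -/
noncomputable def reflKernel (k : ℝ → ℂ) (R : ℝ) (v : ℝ) : ℂ := (Ioc 0 R).indicator k (-v)

lemma integrable_reflKernel {k : ℝ → ℂ} (hk : LOneLoc k) (R : ℝ) : Integrable (reflKernel k R) :=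
  ((hk.integrableOn_Ioc R).integrable_indicator measurableSet_Ioc).comp_neg

lemma hasCompactSupport_reflKernel (k : ℝ → ℂ) (R : ℝ) : HasCompactSupport (reflKernel k R) := by
  refine HasCompactSupport.intro (K := Icc (-R) 0) isCompact_Icc fun v hv => ?_
  exact indicator_of_notMem (fun h => hv ⟨by linarith [h.2], by linarith [h.1]⟩) _

lemma dualConv_eq_convolution {k h : ℝ → ℂ} {R : ℝ} (hR : ∀ s, R < s → h s = 0) {t : ℝ}
    (ht : 0 ≤ t) :
    dualConv k h t = convolution (reflKernel k R) h (ContinuousLinearMap.mul ℝ ℂ) volume t := by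
  have h1 : convolution (reflKernel k R) h (ContinuousLinearMap.mul ℝ ℂ) volume t =
      ∫ v, reflKernel k R v * h (t - v) := rfl
  have h2 := integral_sub_left_eq_self (fun v => reflKernel k R v * h (t - v)) volume t
  rw [h1, ← h2, dualConv, indicator_of_mem (show t ∈ Ici (0 : ℝ) from ht),
    ← integral_indicator measurableSet_Ioi]
  congr 1 with s
  rw [sub_sub_cancel, reflKernel, neg_sub]
  by_cases hs : s ∈ Ioi t
  · rw [indicator_of_mem hs]
    by_cases hsR : s - t ∈ Ioc 0 R
    · rw [indicator_of_mem hsR]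
    · have : R < s := by
        by_contra hle
        exact hsR ⟨sub_pos.2 hs, by linarith [not_lt.1 hle]⟩
      rw [hR s this, mul_zero, mul_zero]
  · rw [indicator_of_notMem hs,
      indicator_of_notMem (fun h => hs (sub_pos.1 h.1)), zero_mul]

lemma dualConv_mem_DPlus {k g : ℝ → ℂ} (hk : LOneLoc k) (hg : g ∈ DPlus) :
    dualConv k g ∈ DPlus := by
  obtain ⟨φ, hφ, hφc, rfl⟩ := hg
  obtain ⟨R, hR⟩ := hφc.isCompact.bddAbove
  have hR' : ∀ s, R < s → φ s = 0 := fun s hs =>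
    image_eq_zero_of_notMem_tsupport fun hm => absurd (hR hm) (not_le.2 hs)
  have h1 : ContDiff ℝ (⊤ : ℕ∞)
      (convolution (reflKernel k R) φ (ContinuousLinearMap.mul ℝ ℂ) volume) :=
    hφc.contDiff_convolution_right _ (integrable_reflKernel hk R).locallyIntegrable hφ
  have h2 : HasCompactSupport
      (convolution (reflKernel k R) φ (ContinuousLinearMap.mul ℝ ℂ) volume) :=
    (hasCompactSupport_reflKernel k R).convolution _ hφc
  refine ⟨_, h1, h2, ?_⟩
  ext t
  by_cases ht : t ∈ Ici (0 : ℝ)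
  · rw [indicator_of_mem ht, ← dualConv_eq_convolution hR' ht, dualConv, dualConv,
      indicator_of_mem ht, indicator_of_mem ht]
    refine setIntegral_congr_fun measurableSet_Ioi fun s hs => ?_
    simp only [indicator_of_mem (show s ∈ Ici (0 : ℝ) from
      (show (0 : ℝ) ≤ t from ht).trans (le_of_lt (show t < s from hs)))]
  · rw [indicator_of_notMem ht, dualConv, indicator_of_notMem ht]

lemma derivPlus_indicator {φ : ℝ → ℂ} (hφ : Differentiable ℝ φ) :
    derivPlus ((Ici (0 : ℝ)).indicator φ) = (Ici (0 : ℝ)).indicator (deriv φ) := by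
  refine indicator_congr fun t ht => ?_
  rw [derivWithin_congr (f := φ) (fun s hs => indicator_of_mem hs _) (indicator_of_mem ht _)]
  exact (hφ t).derivWithin (uniqueDiffOn_Ici 0 t ht)

lemma derivPlus_mem_DPlus {g : ℝ → ℂ} (hg : g ∈ DPlus) : derivPlus g ∈ DPlus := by
  obtain ⟨φ, hφ, hφc, rfl⟩ := hg
  exact ⟨deriv φ, (contDiff_infty_iff_deriv.1 hφ).2, hφc.deriv,
    derivPlus_indicator (hφ.differentiable (by simp))⟩

/-- Dual convolution commutes with differentiation. -/
lemma dualConv_derivPlus {k g : ℝ → ℂ} (hk : LOneLoc k) (hg : g ∈ DPlus) :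
    dualConv k (derivPlus g) = derivPlus (dualConv k g) := by
  obtain ⟨φ, hφ, hφc, rfl⟩ := hg
  obtain ⟨R, hR⟩ := hφc.isCompact.bddAbove
  have hR' : ∀ s, R < s → φ s = 0 := fun s hs =>
    image_eq_zero_of_notMem_tsupport fun hm => absurd (hR hm) (not_le.2 hs)
  have hR'' : ∀ s, R < s → deriv φ s = 0 := fun s hs =>
    image_eq_zero_of_notMem_tsupport fun hm =>
      absurd (hR (tsupport_deriv_subset hm)) (not_le.2 hs)
  have hrep : ∀ {ψ : ℝ → ℂ}, (∀ s, R < s → ψ s = 0) →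
      dualConv k ((Ici (0 : ℝ)).indicator ψ) = (Ici (0 : ℝ)).indicator
        (convolution (reflKernel k R) ψ (ContinuousLinearMap.mul ℝ ℂ) volume) := by
    intro ψ hψ
    refine indicator_congr fun t ht => ?_
    have := dualConv_eq_convolution (k := k) hψ ht
    rw [dualConv, indicator_of_mem (show t ∈ Ici (0 : ℝ) from ht)] at this
    rw [← this]
    refine setIntegral_congr_fun measurableSet_Ioi fun s hs => ?_
    simp only [indicator_of_mem (show s ∈ Ici (0 : ℝ) from
      (show (0 : ℝ) ≤ t from ht).trans (le_of_lt (show t < s from hs)))]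
  have hd : ∀ t, HasDerivAt (convolution (reflKernel k R) φ (ContinuousLinearMap.mul ℝ ℂ) volume)
      (convolution (reflKernel k R) (deriv φ) (ContinuousLinearMap.mul ℝ ℂ) volume t) t :=
    hφc.hasDerivAt_convolution_right _ (integrable_reflKernel hk R).locallyIntegrable
      (hφ.of_le (by exact_mod_cast le_top))
  rw [derivPlus_indicator (hφ.differentiable (by simp)), hrep hR', hrep hR'',
    derivPlus_indicator fun t => (hd t).differentiableAt]
  exact indicator_congr fun t _ => (hd t).deriv.symm

lemma dualConv_dualConv {k l g : ℝ → ℂ} (hk : LOneLoc k) (hl : LOneLoc l) (hg : g ∈ DPlus) :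
    dualConv k (dualConv l g) = dualConv (conv k l) g := by
  obtain ⟨L, hL0, hL⟩ := DPlus.exists_bound hg
  have hL' : ∀ t, L < t → dualConv l g t = 0 := fun t ht => dualConv_of_ge hL ht.le
  ext t
  rcases lt_or_ge t 0 with ht | ht
  · rw [dualConv_of_neg _ _ ht, dualConv_of_neg _ _ ht]
  rcases lt_or_ge L t with htL | htL
  · rw [dualConv_of_ge hL' htL.le, dualConv_of_ge hL htL.le]
  rw [dualConv_eq_conv_reflect hL' ⟨ht, htL⟩, dualConv_eq_conv_reflect hL ⟨ht, htL⟩]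
  have h1 := vconv_assoc hk hl (DPlus.continuousOn_reflect hg L).bddMeasOn (t := L - t)
    ⟨by linarith, by linarith⟩
  refine Eq.trans (conv_congr (by linarith) (fun _ _ => rfl) fun u hu => ?_) h1
  rw [dualConv_eq_conv_reflect hL ⟨by linarith [hu.2], by linarith [hu.1]⟩, sub_sub_cancel]
  rfl

lemma hasCompactSupport_DPlus {g : ℝ → ℂ} (hg : g ∈ DPlus) : HasCompactSupport g := by
  obtain ⟨φ, -, hφc, rfl⟩ := hg
  exact hφc.mono (by rw [support_indicator]; exact inter_subset_right)

lemma conv_of_neg (f : ℝ → ℂ) {g : ℝ → ℂ} (hg : ∀ t < 0, g t = 0) {t : ℝ} (ht : t < 0) :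
    conv f g t = 0 := by
  rw [conv, intervalIntegral.integral_symm, intervalIntegral.integral_of_le ht.le,
    integral_Ioc_eq_integral_Ioo,
    setIntegral_eq_zero_of_forall_eq_zero fun s hs => by rw [hg s hs.2, mul_zero], neg_zero]

lemma convolution_eq_conv {f g : ℝ → ℂ} (hf : ∀ t < 0, f t = 0) (hg : ∀ t < 0, g t = 0) :
    convolution g f (ContinuousLinearMap.mul ℝ ℂ) volume = conv f g := by
  ext t
  have h1 : convolution g f (ContinuousLinearMap.mul ℝ ℂ) volume t = ∫ s, g s * f (t - s) := rfl
  rw [h1]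
  rcases lt_or_ge t 0 with ht | ht
  · rw [conv_of_neg f hg ht, ← integral_zero ℝ ℂ (μ := volume)]
    congr 1 with s
    rcases lt_or_ge s 0 with hs | hs
    · rw [hg s hs, zero_mul]
    · rw [hf (t - s) (by linarith), mul_zero]
  · rw [conv, intervalIntegral.integral_of_le ht, ← integral_Icc_eq_integral_Ioc,
      ← integral_indicator measurableSet_Icc]
    congr 1 with s
    by_cases hs : s ∈ Icc 0 t
    · rw [indicator_of_mem hs, mul_comm]
    · rw [indicator_of_notMem hs]
      rcases lt_or_ge s 0 with h | h
      · rw [hg s h, zero_mul]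
      · rw [hf (t - s) (by
          have : ¬ s ≤ t := fun h' => hs ⟨h, h'⟩
          linarith [not_le.1 this]), mul_zero]

/-- `𝒟₊` is closed under convolution: the convolution over `[0, t]` is the difference of a
convolution over `[0, ∞)` and a dual convolution. -/
lemma conv_mem_DPlus {f g : ℝ → ℂ} (hf : f ∈ DPlus) (hg : g ∈ DPlus) : conv f g ∈ DPlus := by
  obtain ⟨φ, hφ, hφc, rfl⟩ := id hf
  set F := convolution g φ (ContinuousLinearMap.mul ℝ ℂ) volume with hF
  have hF1 : ContDiff ℝ (⊤ : ℕ∞) F :=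
    hφc.contDiff_convolution_right _ (DPlus.integrable hg).locallyIntegrable hφ
  have hF2 : HasCompactSupport F := (hasCompactSupport_DPlus hg).convolution _ hφc
  have hFm : (Ici (0 : ℝ)).indicator F ∈ DPlus := ⟨F, hF1, hF2, rfl⟩
  have hl : LOneLoc fun u => φ (-u) :=
    .of_continuousOn (hφ.continuous.comp continuous_neg).continuousOn
  convert DPlus.sub_mem hFm (dualConv_mem_DPlus hl hg) using 1
  ext t
  rcases lt_or_ge t 0 with ht | ht
  · rw [conv_of_neg _ (fun _ h => DPlus.apply_of_neg hg h) ht, Pi.sub_apply,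
      dualConv_of_neg _ _ ht, indicator_of_notMem (show t ∉ Ici (0 : ℝ) from not_le.2 ht), sub_zero]
  · have ht' : t ∈ Ici (0 : ℝ) := ht
    rw [Pi.sub_apply, indicator_of_mem ht', dualConv, indicator_of_mem ht', hF]
    have h1 : convolution g φ (ContinuousLinearMap.mul ℝ ℂ) volume t =
      ∫ s, g s * φ (t - s) := rfl
    obtain ⟨C, hC⟩ := hφc.exists_bound_of_continuous hφ.continuous
    have hint : Integrable fun s => g s * φ (t - s) :=
      (DPlus.integrable hg).mul_bdd (c := C)
        (hφ.continuous.comp (by fun_prop)).aestronglyMeasurable (ae_of_all _ fun s => hC _)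
    have h2 : ∫ s, g s * φ (t - s) = ∫ s in Ioi 0, g s * φ (t - s) := by
      rw [← integral_Ici_eq_integral_Ioi]
      refine (setIntegral_eq_integral_of_forall_compl_eq_zero fun s hs => ?_).symm
      rw [DPlus.apply_of_neg hg (not_le.1 hs), zero_mul]
    rw [h1, h2, ← Ioc_union_Ioi_eq_Ioi ht, setIntegral_union (Ioc_disjoint_Ioi le_rfl)
      measurableSet_Ioi hint.integrableOn hint.integrableOn, conv,
      intervalIntegral.integral_of_le ht]
    have h3 : ∫ s in Ioi t, φ (-(s - t)) * g s = ∫ s in Ioi t, g s * φ (t - s) := by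
      congr 1 with s
      rw [neg_sub, mul_comm]
    rw [h3, add_sub_cancel_right]
    refine setIntegral_congr_fun measurableSet_Ioc fun s hs => ?_
    simp only [indicator_of_mem (show t - s ∈ Ici (0 : ℝ) from sub_nonneg.2 hs.2), mul_comm]

lemma LOneLoc.of_integrable {q : ℝ → ℂ} (hq : Integrable q) : LOneLoc q :=
  hq.locallyIntegrable.locallyIntegrableOn _

/-- `k ∘ (F * g) = (k ∘ F) * g + q ∘ g` for a suitable kernel `q`: on the whole line this is
associativity of convolution, and `q` is the reflection of the part of the convolution of
`v ↦ k(-v)` and `F` that lives on the negative half-line. -/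
lemma exists_dualConv_conv_eq {k F g : ℝ → ℂ} (hk : LOneLoc k) (hF : F ∈ DPlus) (hg : g ∈ DPlus) :
    ∃ q, LOneLoc q ∧ dualConv k (conv F g) = conv (dualConv k F) g + dualConv q g := by
  obtain ⟨R1, -, hR1⟩ := DPlus.exists_bound hF
  obtain ⟨R2, -, hR2⟩ := DPlus.exists_bound (conv_mem_DPlus hF hg)
  set R := max R1 R2
  have hRF : ∀ s, R < s → F s = 0 := fun s hs => hR1 s ((le_max_left _ _).trans_lt hs)
  have hRc : ∀ s, R < s → conv F g s = 0 := fun s hs => hR2 s ((le_max_right _ _).trans_lt hs)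
  have hki := integrable_reflKernel hk R
  have hFi := DPlus.integrable hF
  have hgi := DPlus.integrable hg
  set B := ContinuousLinearMap.mul ℝ ℂ
  set p := convolution (reflKernel k R) F B volume with hp
  have hpi : Integrable p := hki.integrable_convolution B hFi
  refine ⟨fun v => p (-v), .of_integrable hpi.comp_neg, ?_⟩
  have hcommF : convolution F g B volume = conv F g := by
    rw [convolution_eq_conv (fun _ h => DPlus.apply_of_neg hg h)
      (fun _ h => DPlus.apply_of_neg hF h), conv_comm]
  obtain ⟨C, hC⟩ := DPlus.exists_norm_le hF
  have hassoc : ∀ t, convolution p g B volume t =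
      convolution (reflKernel k R) (conv F g) B volume t := by
    intro t
    rw [← hcommF]
    refine convolution_assoc B B B B (fun x y z => mul_assoc x y z) hki.aestronglyMeasurable
      hFi.aestronglyMeasurable hgi.aestronglyMeasurable
      (hki.ae_convolution_exists B hFi)
      (hFi.norm.ae_convolution_exists (ContinuousLinearMap.mul ℝ ℝ) hgi.norm) ?_
    have hci := hFi.norm.integrable_convolution (ContinuousLinearMap.mul ℝ ℝ) hgi.norm
      (μ := volume)
    have hbd : ∀ y, ‖convolution (fun x => ‖F x‖) (fun x => ‖g x‖)
        (ContinuousLinearMap.mul ℝ ℝ) volume y‖ ≤ C * ∫ s, ‖g s‖ := by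
      intro y
      rw [convolution_eq_swap, ← integral_const_mul]
      refine norm_integral_le_of_norm_le (hgi.norm.const_mul C) (ae_of_all _ fun s => ?_)
      rw [ContinuousLinearMap.mul_apply', norm_mul, norm_norm, norm_norm]
      exact mul_le_mul_of_nonneg_right (hC _) (norm_nonneg _)
    exact hki.norm.mul_bdd (c := C * ∫ s, ‖g s‖) (hci.comp_sub_left t).aestronglyMeasurable
      (ae_of_all _ fun s => hbd _)
  ext t
  rcases lt_or_ge t 0 with ht | ht
  · rw [dualConv_of_neg _ _ ht, Pi.add_apply, dualConv_of_neg _ _ ht,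
      DPlus.apply_of_neg (conv_mem_DPlus (dualConv_mem_DPlus hk hF) hg) ht, add_zero]
  have ht' : t ∈ Ici (0 : ℝ) := ht
  obtain ⟨D, hD⟩ := DPlus.exists_norm_le hg
  have hq : dualConv (fun v => p (-v)) g t = ∫ s in Ioi t, p (-(s - t)) * g s :=
    indicator_of_mem ht' _
  rw [dualConv_eq_convolution hRc ht, ← hassoc, convolution_eq_swap, Pi.add_apply, hq]
  have hint : Integrable fun s => B (p (t - s)) (g s) :=
    (hpi.comp_sub_left t).mul_bdd (c := D) hgi.aestronglyMeasurable (ae_of_all _ hD)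
  have h2 : ∫ s, B (p (t - s)) (g s) = ∫ s in Ioi 0, B (p (t - s)) (g s) := by
    rw [← integral_Ici_eq_integral_Ioi]
    refine (setIntegral_eq_integral_of_forall_compl_eq_zero fun s hs => ?_).symm
    rw [DPlus.apply_of_neg hg (not_le.1 hs), map_zero]
  rw [h2, ← Ioc_union_Ioi_eq_Ioi ht, setIntegral_union (Ioc_disjoint_Ioi le_rfl)
    measurableSet_Ioi hint.integrableOn hint.integrableOn, conv,
    intervalIntegral.integral_of_le ht]
  congr 1
  · refine setIntegral_congr_fun measurableSet_Ioc fun s hs => ?_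
    simp only [hp]
    rw [← dualConv_eq_convolution hRF (sub_nonneg.2 hs.2)]
    rfl
  · congr 1 with s
    rw [neg_sub]
    rfl

/-- The space `𝒟_k` is closed under convolution: in the identity of `exists_dualConv_conv_eq` for `F`
and `k ∘ G` the error term is `q ∘ (k ∘ G) = k ∘ (q ∘ G)`, which lies in `𝒟_k`. -/
lemma conv_mem_DK {k f g : ℝ → ℂ} {hk : LOneLoc k} (hf : f ∈ DK k hk) (hg : g ∈ DK k hk) :
    conv f g ∈ DK k hk := by
  obtain ⟨F, hF, rfl⟩ := hf
  obtain ⟨G, hG, rfl⟩ := hg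
  obtain ⟨q, hq, h⟩ := exists_dualConv_conv_eq hk hF (dualConv_mem_DPlus hk hG)
  rw [dualConv_dualConv hq hk hG, conv_comm q, ← dualConv_dualConv hk hq hG] at h
  refine ⟨conv F (dualConv k G) - dualConv q G,
    DPlus.sub_mem (conv_mem_DPlus hF (dualConv_mem_DPlus hk hG)) (dualConv_mem_DPlus hq hG), ?_⟩
  rw [dualConv_sub hk (conv_mem_DPlus hF (dualConv_mem_DPlus hk hG)) (dualConv_mem_DPlus hq hG), h,
    add_sub_cancel_right]

lemma mem_DKInf {k f : ℝ → ℂ} {hk : LOneLoc k} :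
    f ∈ DKInf k hk ↔ ∀ n, f ∈ DK (convPow k (n + 1)) (hk.convPow n) := by
  simp [DKInf, Submodule.mem_iInf]

lemma conv_mem_DKInf {k f g : ℝ → ℂ} {hk : LOneLoc k} (hf : f ∈ DKInf k hk)
    (hg : g ∈ DKInf k hk) : conv f g ∈ DKInf k hk :=
  mem_DKInf.2 fun n => conv_mem_DK (mem_DKInf.1 hf n) (mem_DKInf.1 hg n)

lemma derivPlus_mem_DKInf {k f : ℝ → ℂ} {hk : LOneLoc k} (hf : f ∈ DKInf k hk) :
    derivPlus f ∈ DKInf k hk := by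
  refine mem_DKInf.2 fun n => ?_
  obtain ⟨F, hF, rfl⟩ := mem_DKInf.1 hf n
  exact ⟨derivPlus F, derivPlus_mem_DPlus hF, dualConv_derivPlus (hk.convPow n) hF⟩

/-! ### Averages of a local convoluted semigroup against test functions -/

/-- The formula `1 ∘ (g * u) = (1 ∘ g) ∫ u + g * (1 ∘ u)` for functions whose supports lie in
`[0, b]` and `[0, a]`, `a + b ≤ L`. -/
lemma integral_tail_vconv {E : Type*} [NormedAddCommGroup E] [NormedSpace ℂ E] [CompleteSpace E]
    {g : ℝ → ℂ} {u : ℝ → E} {a b L : ℝ} (hg : LOneLoc g) (hu : ContinuousOn u (Icc 0 L))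
    (hgb : ∀ t, b < t → g t = 0) (hua : ∀ t ∈ Icc 0 L, a < t → u t = 0) (hab : a + b ≤ L)
    {s : ℝ} (hs : s ∈ Icc 0 L) :
    ∫ r in s..L, vconv g u r = (∫ r in s..L, g r) • (∫ r in (0 : ℝ)..L, u r) +
      vconv g (fun r => ∫ q in r..L, u q) s := by
  have hL : 0 ≤ L := hs.1.trans hs.2
  have h0 : (0 : ℝ) ∈ Icc 0 L := ⟨le_rfl, hL⟩
  have hLL : L ∈ Icc 0 L := ⟨hL, le_rfl⟩
  have hui : ∀ {b c : ℝ}, b ∈ Icc 0 L → c ∈ Icc 0 L → IntervalIntegrable u volume b c :=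
    fun hb hc => hu.bddMeasOn.intervalIntegrable hb hc
  set U : ℝ → E := fun r => ∫ q in r..L, u q with hU
  have hsub : ∀ r ∈ Icc 0 L, vconv (fun _ => 1) u r = U 0 - U r := fun r hr => by
    simp only [vconv_one_left, hU]
    rw [← intervalIntegral.integral_add_adjacent_intervals (hui h0 hr) (hui hr hLL),
      add_sub_cancel_right]
  have hUc : ContinuousOn U (Icc 0 L) := by
    refine (continuousOn_const.sub (continuousOn_vconv (lOneLoc_const 1) hu)).congr
      (f := fun r => U 0 - vconv (fun _ => 1) u r) fun r hr => ?_
    beta_reduce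
    rw [hsub r hr, sub_sub_cancel]
  have hprim : ∀ r ∈ Icc 0 L, ∫ q in (0 : ℝ)..r, vconv g u q =
      (∫ q in (0 : ℝ)..r, g q) • U 0 - vconv g U r := fun r hr => by
    rw [← vconv_one_left, vconv_assoc (lOneLoc_const 1) hg hu.bddMeasOn hr, conv_comm,
      ← vconv_assoc hg (lOneLoc_const 1) hu.bddMeasOn hr, ← vconv_const,
      ← vconv_sub_right hg (bddMeasOn_const _ L) hUc.bddMeasOn hr]
    exact vconv_congr hr.1 (fun _ _ => rfl) fun q hq => hsub q ⟨hq.1, hq.2.trans hr.2⟩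
  have hend : vconv g U L = 0 := by
    refine intervalIntegral.integral_zero_ae (ae_of_all _ fun r hr => ?_)
    rw [uIoc_of_le hL] at hr
    rcases lt_or_ge r (L - b) with h | h
    · rw [hgb (L - r) (by linarith), zero_smul]
    · have : U r = 0 := by
        refine intervalIntegral.integral_zero_ae (ae_of_all _ fun q hq => ?_)
        rw [uIoc_of_le hr.2] at hq
        exact hua q ⟨hr.1.le.trans hq.1.le, hq.2⟩ (by linarith [hq.1])
      rw [this, smul_zero]
  have hcv := (continuousOn_vconv hg hu).bddMeasOn
  rw [← intervalIntegral.integral_interval_sub_left (hcv.intervalIntegrable h0 hLL)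
    (hcv.intervalIntegrable h0 hs), hprim L hLL, hprim s hs, hend,
    ← intervalIntegral.integral_interval_sub_left (hg.intervalIntegrable le_rfl hL)
    (hg.intervalIntegrable le_rfl hs.1), sub_smul]
  abel

lemma lOneLoc_reflect {F : ℝ → ℂ} (hF : F ∈ DPlus) (L : ℝ) : LOneLoc fun u => F (L - u) :=
  .of_integrable ((DPlus.integrable hF).comp_sub_left L)

lemma DPlus.lOneLoc {F : ℝ → ℂ} (hF : F ∈ DPlus) : LOneLoc F := .of_integrable (DPlus.integrable hF)

lemma SuppIn.mono {f : ℝ → ℂ} {a b : ℝ} (h : SuppIn f a) (hab : a ≤ b) : SuppIn f b :=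
  fun t ht hbt => h t ht (hab.trans_lt hbt)

lemma SuppIn.eq_zero {f : ℝ → ℂ} {a : ℝ} (h : SuppIn f a) (ha : 0 ≤ a) : ∀ t, a < t → f t = 0 :=
  fun t ht => h t (ha.trans ht.le) ht

section Average

variable {X : Type*} [NormedAddCommGroup X] [NormedSpace ℂ X]
  {l : ℝ → ℂ} {L : ℝ} {T : ℝ → X →L[ℂ] X} {A : X →ₗ.[ℂ] X}

lemma integral_smul_eq_vconv_reflect (F : ℝ → ℂ) (u : ℝ → X) (L : ℝ) :
    ∫ t in (0 : ℝ)..L, F t • u t = vconv (fun r => F (L - r)) u L := by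
  simp only [vconv, sub_sub_cancel]

variable [CompleteSpace X]

/-- For a test function `F` supported in `[0, L]` and `f = l ∘ F`, the function
`v(t) = ∫ F(L - t + s) T(s)x ds` is a mild solution of `v' = A v + f(L - t) x`, `v(0) = 0`. -/
lemma average_mem_graph (hl : LOneLoc l) (hT : IsLocalConvSemigroup l L T A) {F : ℝ → ℂ}
    (hF : F ∈ DPlus) (hFL : ∀ t, L < t → F t = 0) {t : ℝ} (ht : t ∈ Icc 0 L) (x : X) :
    (∫ s in (0 : ℝ)..t, vconv (fun u => F (L - u)) (fun s => T s x) s,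
      vconv (fun u => F (L - u)) (fun s => T s x) t -
        (∫ s in (0 : ℝ)..t, dualConv l F (L - s)) • x) ∈ A.graph := by
  have hF' := lOneLoc_reflect hF L
  have hTc := hT.continuousOn x
  have hKx : ContinuousOn (fun s => (∫ u in (0 : ℝ)..s, l u) • x) (Icc 0 L) :=
    (continuousOn_primitive hl L).smul continuousOn_const
  have e1 : ∫ s in (0 : ℝ)..t, vconv (fun u => F (L - u)) (fun s => T s x) s =
      vconv (fun u => F (L - u)) (vconv (fun _ => 1) fun s => T s x) t := by
    rw [← vconv_one_left, vconv_assoc (lOneLoc_const 1) hF' hTc.bddMeasOn ht, conv_comm,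
      ← vconv_assoc hF' (lOneLoc_const 1) hTc.bddMeasOn ht]
  have e2 : ∫ s in (0 : ℝ)..t, dualConv l F (L - s) =
      conv (fun u => F (L - u)) (fun s => ∫ u in (0 : ℝ)..s, l u) t := by
    have h1 := vconv_assoc hF' hl (bddMeasOn_const (1 : ℂ) L) ht
    have h2 : vconv l (fun _ => (1 : ℂ)) = fun s => ∫ u in (0 : ℝ)..s, l u := by
      ext s; rw [vconv_const, smul_eq_mul, mul_one]
    rw [h2, vconv_const, smul_eq_mul, mul_one] at h1
    rw [conv_eq_vconv, h1]
    refine intervalIntegral.integral_congr fun s hs => ?_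
    rw [uIcc_of_le ht.1] at hs
    rw [dualConv_eq_conv_reflect hFL ⟨by linarith [hs.2, ht.2], by linarith [hs.1]⟩,
      sub_sub_cancel, conv_comm]
  rw [e1, e2, ← vconv_smul_const, ← vconv_sub_right hF' hTc.bddMeasOn hKx.bddMeasOn ht]
  refine vconv_mem_graph hT.closed hF' (continuousOn_vconv (lOneLoc_const 1) hTc).bddMeasOn
    (hTc.sub hKx).bddMeasOn ht fun s hs => ?_
  rw [vconv_one_left]
  exact hT.integral_graph ⟨hs.1, hs.2.trans ht.2⟩ x

/-- The generator applied to an average: `A ∫ F T x = -∫ F' T x - (l ∘ F)(0) x`. -/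
lemma average_derivPlus_mem_graph (hl : LOneLoc l) (hL : 0 ≤ L)
    (hT : IsLocalConvSemigroup l L T A) {F : ℝ → ℂ} (hF : F ∈ DPlus)
    (hFL : ∀ t, L < t → F t = 0) (x : X) :
    (∫ t in (0 : ℝ)..L, F t • T t x,
      -(∫ t in (0 : ℝ)..L, derivPlus F t • T t x) - dualConv l F 0 • x) ∈ A.graph := by
  have hF1 := derivPlus_mem_DPlus hF
  set f1 : ℝ → ℂ := fun u => derivPlus F (L - u) with hf1
  have hf1l : LOneLoc f1 := lOneLoc_reflect hF1 L
  have hTc := hT.continuousOn x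
  have hLL : L ∈ Icc 0 L := ⟨hL, le_rfl⟩
  have hFend : F L = 0 := by
    have h1 : EqOn F 0 (Ioi L) := fun t ht => hFL t ht
    exact h1.of_subset_closure ((DPlus.continuousOn hF).mono (Ici_subset_Ici.2 hL))
      continuousOn_const Ioi_subset_Ici_self (by rw [closure_Ioi]) (mem_Ici.2 le_rfl)
  have hprim : ∀ u ∈ Icc 0 L, ∫ s in (0 : ℝ)..u, f1 s = -F (L - u) := by
    intro u hu
    rw [hf1, intervalIntegral.integral_comp_sub_left (fun s => derivPlus F s), sub_zero]
    obtain ⟨φ, hφ, -, rfl⟩ := id hF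
    have h0 : 0 ≤ L - u := sub_nonneg.2 hu.2
    have h2 : ∫ s in (L - u)..L, derivPlus ((Ici (0 : ℝ)).indicator φ) s =
        ∫ s in (L - u)..L, deriv φ s := by
      refine intervalIntegral.integral_congr fun s hs => ?_
      rw [uIcc_of_le (by linarith [hu.1])] at hs
      rw [derivPlus_indicator (hφ.differentiable (by simp))]
      exact indicator_of_mem (show s ∈ Ici (0 : ℝ) from h0.trans hs.1) _
    rw [h2, intervalIntegral.integral_deriv_eq_sub
      (fun s _ => hφ.differentiable (by simp) s)
      ((hφ.continuous_deriv (by simp)).intervalIntegrable _ _)]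
    rw [indicator_of_mem (show L ∈ Ici (0 : ℝ) from hL)] at hFend
    rw [hFend, indicator_of_mem (show L - u ∈ Ici (0 : ℝ) from h0), zero_sub]
  have hKx : ContinuousOn (fun s => (∫ u in (0 : ℝ)..s, l u) • x) (Icc 0 L) :=
    (continuousOn_primitive hl L).smul continuousOn_const
  have e1 : ∫ t in (0 : ℝ)..L, F t • T t x = -vconv f1 (vconv (fun _ => 1) fun s => T s x) L := by
    rw [integral_smul_eq_vconv_reflect, vconv_assoc hf1l (lOneLoc_const 1) hTc.bddMeasOn hLL,
      conv_comm, conv_one_left, vconv, vconv, ← intervalIntegral.integral_neg]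
    refine intervalIntegral.integral_congr fun s hs => ?_
    rw [uIcc_of_le hL] at hs
    rw [hprim (L - s) ⟨by linarith [hs.2], by linarith [hs.1]⟩, neg_smul, neg_neg]
  have e2 : dualConv l F 0 = -conv f1 (fun s => ∫ u in (0 : ℝ)..s, l u) L := by
    have hone : ∀ a : ℝ → ℂ, vconv a (fun _ => (1 : ℂ)) = fun s => ∫ u in (0 : ℝ)..s, a u := by
      intro a; ext s; rw [vconv_const, smul_eq_mul, mul_one]
    have h1 := vconv_assoc hf1l hl (bddMeasOn_const (1 : ℂ) L) hLL
    have h2 := vconv_assoc hl hf1l (bddMeasOn_const (1 : ℂ) L) hLL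
    rw [conv_comm l, ← h1, hone, hone] at h2
    rw [dualConv_eq_conv_reflect hFL ⟨le_rfl, hL⟩, sub_zero, conv_eq_vconv f1, ← h2, vconv, conv,
      ← intervalIntegral.integral_neg]
    refine intervalIntegral.integral_congr fun s hs => ?_
    rw [uIcc_of_le hL] at hs
    rw [hprim s hs, smul_neg, neg_neg, smul_eq_mul]
  have g : (vconv f1 (vconv (fun _ => 1) fun s => T s x) L,
      vconv f1 (fun s => T s x - (∫ u in (0 : ℝ)..s, l u) • x) L) ∈ A.graph := by
    refine vconv_mem_graph hT.closed hf1l (continuousOn_vconv (lOneLoc_const 1) hTc).bddMeasOn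
      (hTc.sub hKx).bddMeasOn hLL fun s hs => ?_
    rw [vconv_one_left]
    exact hT.integral_graph hs x
  convert A.graph.neg_mem g using 1
  refine Prod.ext e1 ?_
  rw [Prod.snd_neg, vconv_sub_right hf1l hTc.bddMeasOn hKx.bddMeasOn hLL, vconv_smul_const, e2,
    integral_smul_eq_vconv_reflect (derivPlus F) fun t => T t x, neg_smul]
  simp only [hf1]
  abel

/-- Multiplicativity of averages: if `l ∘ H = (l ∘ F) * (l ∘ G)`, then the average of `T` against
`H` is the product of the averages against `F` and `G`. With `v_F` the mild solution of
`average_mem_graph`, `f = l ∘ F` and `g = l ∘ G`, the function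
`t ↦ Q_F v_G(t) + ∫₀^(L - t) g(L - t - s) v_F(L - s) ds` is a mild solution of the problem solved by
`v_H`, so the two agree by uniqueness. -/
theorem average_mul (hl : LOneLoc l) (hl0 : ZeroMemSupp l) (hL : 0 < L)
    (hT : IsLocalConvSemigroup l L T A) {F G H : ℝ → ℂ} (hF : F ∈ DPlus) (hG : G ∈ DPlus)
    (hH : H ∈ DPlus) {a b : ℝ} (hb : 0 ≤ b) (hab : a + b ≤ L)
    (hFa : ∀ t, a < t → F t = 0) (hGb : ∀ t, b < t → G t = 0) (hHL : ∀ t, L < t → H t = 0)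
    (ha : 0 ≤ a) (hconv : dualConv l H = conv (dualConv l F) (dualConv l G)) (x : X) :
    ∫ t in (0 : ℝ)..L, H t • T t x =
      ∫ t in (0 : ℝ)..L, F t • T t (∫ s in (0 : ℝ)..L, G s • T s x) := by
  have hLL : L ∈ Icc 0 L := ⟨hL.le, le_rfl⟩
  have h0L : (0 : ℝ) ∈ Icc 0 L := ⟨le_rfl, hL.le⟩
  have hA := hT.closed
  have hFL : ∀ t, L < t → F t = 0 := fun t ht => hFa t (by linarith)
  have hGL : ∀ t, L < t → G t = 0 := fun t ht => hGb t (by linarith)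
  have hTc := hT.continuousOn x
  obtain ⟨Q, hQ⟩ := exists_clm_integral hT.continuousOn hLL
    ((DPlus.lOneLoc hF).intervalIntegrable le_rfl hL.le)
  have hQA : ∀ y z, (y, z) ∈ A.graph → (Q y, Q z) ∈ A.graph := fun y z hyz => by
    rw [hQ, hQ, integral_smul_eq_vconv_reflect, integral_smul_eq_vconv_reflect]
    exact vconv_mem_graph hA (lOneLoc_reflect hF L) (hT.continuousOn y).bddMeasOn
      (hT.continuousOn z).bddMeasOn hLL fun s hs => hT.commute_graph hs hyz
  set f := dualConv l F with hf
  set g := dualConv l G with hg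
  have hfD : f ∈ DPlus := dualConv_mem_DPlus hl hF
  have hgD : g ∈ DPlus := dualConv_mem_DPlus hl hG
  have hfa : ∀ t, a < t → f t = 0 := fun t ht => dualConv_of_ge hFa ht.le
  have hgb : ∀ t, b < t → g t = 0 := fun t ht => dualConv_of_ge hGb ht.le
  have hgl := DPlus.lOneLoc hgD
  set vF : ℝ → X := vconv (fun u => F (L - u)) fun s => T s x with hvF
  set vG : ℝ → X := vconv (fun u => G (L - u)) fun s => T s x with hvG
  set vH : ℝ → X := vconv (fun u => H (L - u)) fun s => T s x with hvH
  have hvFc : ContinuousOn vF (Icc 0 L) := continuousOn_vconv (lOneLoc_reflect hF L) hTc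
  have hvGc : ContinuousOn vG (Icc 0 L) := continuousOn_vconv (lOneLoc_reflect hG L) hTc
  have hvHc : ContinuousOn vH (Icc 0 L) := continuousOn_vconv (lOneLoc_reflect hH L) hTc
  have hrevc : ContinuousOn (fun s => L - s) (Icc 0 L) := by fun_prop
  have hrev : MapsTo (fun s => L - s) (Icc 0 L) (Icc 0 L) := fun s hs =>
    ⟨by linarith [hs.2], by linarith [hs.1]⟩
  set u : ℝ → X := fun s => vF (L - s) with hu
  have huc : ContinuousOn u (Icc 0 L) := hvFc.comp hrevc hrev
  have hua : ∀ t ∈ Icc 0 L, a < t → u t = 0 := fun t ht hat => by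
    refine intervalIntegral.integral_zero_ae (ae_of_all _ fun s hs => ?_)
    rw [uIoc_of_le (hrev ht).1] at hs
    beta_reduce
    rw [hFa _ (by linarith [hs.1]), zero_smul]
  have hfc : ContinuousOn f (Icc 0 L) := (DPlus.continuousOn hfD).mono Icc_subset_Ici_self
  -- tails of `u` and of `f`, and the relation between them
  set U : ℝ → X := fun r => ∫ q in r..L, u q with hU
  set φ : ℝ → ℂ := fun r => ∫ q in r..L, f q with hφ
  have hUA : ∀ r ∈ Icc 0 L, (U r, u r - φ r • x) ∈ A.graph := fun r hr => by
    have h1 := average_mem_graph hl hT hF hFL (hrev hr) x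
    have h2 : U r = ∫ s in (0 : ℝ)..(L - r), vF s := by
      have := intervalIntegral.integral_comp_sub_left (fun s => vF s) (a := r) (b := L) L
      rw [sub_self] at this
      exact this
    have h3 : φ r = ∫ s in (0 : ℝ)..(L - r), f (L - s) := by
      rw [intervalIntegral.integral_comp_sub_left (fun s => f s), sub_sub_cancel, sub_zero]
    rw [h2, h3]
    exact h1
  have hUc : ContinuousOn U (Icc 0 L) := by
    refine ((continuousOn_vconv (lOneLoc_const 1) hvFc).comp hrevc hrev).congr fun r _ => ?_
    rw [Function.comp_apply, vconv_one_left]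
    have := intervalIntegral.integral_comp_sub_left (fun s => vF s) (a := r) (b := L) L
    rw [sub_self] at this
    exact this
  have hφc : ContinuousOn φ (Icc 0 L) := by
    have h1 : ContinuousOn (fun r => (∫ q in (0 : ℝ)..L, f q) - ∫ q in (0 : ℝ)..r, f q)
        (Icc 0 L) :=
      continuousOn_const.sub (continuousOn_primitive (DPlus.lOneLoc hfD) L)
    refine h1.congr fun r hr => ?_
    beta_reduce
    rw [intervalIntegral.integral_interval_sub_left
      ((DPlus.lOneLoc hfD).intervalIntegrable le_rfl hL.le)
      ((DPlus.lOneLoc hfD).intervalIntegrable le_rfl hr.1)]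
  have hφx : ContinuousOn (fun r => φ r • x) (Icc 0 L) := hφc.smul continuousOn_const
  set ζ : ℝ → X := fun t => vconv g u (L - t) with hζ
  have hζc : ContinuousOn ζ (Icc 0 L) := (continuousOn_vconv hgl huc).comp hrevc hrev
  have hQvc : ContinuousOn (fun t => Q (vG t)) (Icc 0 L) := Q.continuous.comp_continuousOn hvGc
  -- the difference of the two candidate solutions solves the homogeneous problem
  set y : ℝ → X := fun t => Q (vG t) + ζ t - vH t with hy
  have hyc : ContinuousOn y (Icc 0 L) := (hQvc.add hζc).sub hvHc
  have hyA : ∀ t ∈ Icc 0 L, (∫ s in (0 : ℝ)..t, y s, y t) ∈ A.graph := by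
    intro t ht
    have hII : ∀ {w : ℝ → X}, ContinuousOn w (Icc 0 L) → IntervalIntegrable w volume 0 t :=
      fun hw => hw.bddMeasOn.intervalIntegrable h0L ht
    have hs := hrev ht
    set s := L - t with hsdef
    have g1 : (Q (∫ r in (0 : ℝ)..t, vG r), Q (vG t - (∫ r in s..L, g r) • x)) ∈ A.graph := by
      have h1 := average_mem_graph hl hT hG hGL ht x
      rw [intervalIntegral.integral_comp_sub_left (fun r => dualConv l G r), sub_zero] at h1
      exact hQA _ _ h1
    have g2 : (∫ r in (0 : ℝ)..t, ζ r, (∫ r in s..L, g r) • (u 0 - φ 0 • x) +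
        vconv g (fun r => u r - φ r • x) s) ∈ A.graph := by
      have h1 : ∫ r in (0 : ℝ)..t, ζ r = ∫ r in s..L, vconv g u r := by
        rw [hζ, intervalIntegral.integral_comp_sub_left (fun r => vconv g u r), sub_zero]
      rw [h1, integral_tail_vconv hgl huc hgb hua hab hs]
      refine A.graph.add_mem (A.graph.smul_mem (∫ r in s..L, g r) (hUA 0 h0L))
        (vconv_mem_graph hA hgl hUc.bddMeasOn (huc.sub hφx).bddMeasOn hs
          fun r hr => hUA r ⟨hr.1, hr.2.trans hs.2⟩)
    have g3 : (∫ r in (0 : ℝ)..t, vH r, vH t - (∫ r in s..L, conv g f r) • x) ∈ A.graph := by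
      have h1 := average_mem_graph hl hT hH hHL ht x
      rw [intervalIntegral.integral_comp_sub_left (fun r => dualConv l H r), sub_zero, hconv,
        conv_comm f g] at h1
      exact h1
    -- the inhomogeneous terms cancel: `1 ∘ (g * f) = (1 ∘ g) ∫ f + g * (1 ∘ f)`
    have hscal : ∫ r in s..L, conv g f r = (∫ r in s..L, g r) * φ 0 + conv g φ s :=
      integral_tail_vconv hgl hfc hgb (fun r _ hr => hfa r hr) hab hs
    have hu0 : u 0 = Q x := by
      rw [hQ, integral_smul_eq_vconv_reflect, hu]
      simp only [sub_zero, hvF]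
    have hint : ∫ r in (0 : ℝ)..t, y r =
        Q (∫ r in (0 : ℝ)..t, vG r) + (∫ r in (0 : ℝ)..t, ζ r) - ∫ r in (0 : ℝ)..t, vH r := by
      rw [hy, intervalIntegral.integral_sub ((hII hQvc).add (hII hζc)) (hII hvHc),
        intervalIntegral.integral_add (hII hQvc) (hII hζc),
        Q.intervalIntegral_comp_comm (hII hvGc)]
    rw [hint]
    convert A.graph.sub_mem (A.graph.add_mem g1 g2) g3 using 1
    refine Prod.ext rfl ?_
    simp only [Prod.snd_sub, Prod.snd_add]
    rw [vconv_sub_right hgl huc.bddMeasOn hφx.bddMeasOn hs, vconv_smul_const, hscal, hu0, map_sub,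
      map_smul, smul_sub, add_smul, smul_smul]
    simp only [hy, hζ]
    abel
  have hy0 : y L = 0 := by
    have h1 : EqOn y 0 (Ico 0 L) := mild_solution_eq_zero hl hl0 hT hyc hyA
    exact h1.of_subset_closure hyc continuousOn_const Ico_subset_Icc_self
      (by rw [closure_Ico hL.ne]) hLL
  have hζL : ζ L = 0 := by simp [hζ]
  simp only [hy] at hy0
  rw [hζL, add_zero, sub_eq_zero] at hy0
  rw [integral_smul_eq_vconv_reflect H, integral_smul_eq_vconv_reflect G, ← hQ]
  exact hy0.symm

end Average

/-! ### The maps `W` and the supports of test functions -/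

section WMaps

variable {k : ℝ → ℂ} {hk : LOneLoc k}

lemma W_eq_of_dualConv_eq {k f g : ℝ → ℂ} (hk : LOneLoc k) (hk0 : ZeroMemSupp k) (hg : g ∈ DPlus)
    (h : dualConv k g = f) : W k f = g := by
  rw [← h, W_dualConv hk hk0 hg]

lemma W_add (hk0 : ZeroMemSupp k) {f g : ℝ → ℂ} (hf : f ∈ DK k hk) (hg : g ∈ DK k hk) :
    W k (f + g) = W k f + W k g :=
  W_eq_of_dualConv_eq hk hk0 (DPlus.add_mem (W_mem hf) (W_mem hg)) (by
    rw [dualConv_add hk (W_mem hf) (W_mem hg), dualConv_W hf, dualConv_W hg])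

lemma W_smul (hk0 : ZeroMemSupp k) (c : ℂ) {f : ℝ → ℂ} (hf : f ∈ DK k hk) :
    W k (c • f) = c • W k f :=
  W_eq_of_dualConv_eq hk hk0 (DPlus.smul_mem c (W_mem hf)) (by
    rw [dualConv_smul, dualConv_W hf])

lemma W_derivPlus (hk0 : ZeroMemSupp k) {f : ℝ → ℂ} (hf : f ∈ DK k hk) :
    W k (derivPlus f) = derivPlus (W k f) :=
  W_eq_of_dualConv_eq hk hk0 (derivPlus_mem_DPlus (W_mem hf)) (by
    rw [dualConv_derivPlus hk (W_mem hf), dualConv_W hf])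

lemma suppIn_W (hk0 : ZeroMemSupp k) {f : ℝ → ℂ} (hf : f ∈ DK k hk) {a : ℝ} (ha : 0 ≤ a)
    (h : SuppIn f a) : SuppIn (W k f) a :=
  suppIn_of_dualConv hk hk0 (W_mem hf) (by rwa [dualConv_W hf]) ha

/-- The relation `W_{k^{*n}} f = k ∘ W_{k^{*(n+1)}} f`. -/
lemma W_convPow_eq_dualConv (hk0 : ZeroMemSupp k) {f : ℝ → ℂ} (hf : f ∈ DKInf k hk) (n : ℕ) :
    W (convPow k (n + 1)) f = dualConv k (W (convPow k (n + 2)) f) := by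
  have hF := W_mem (mem_DKInf.1 hf (n + 1))
  refine W_eq_of_dualConv_eq (hk.convPow n) (hk0.convPow hk n) (dualConv_mem_DPlus hk hF) ?_
  rw [dualConv_dualConv (hk.convPow n) hk hF, conv_comm]
  exact dualConv_W (mem_DKInf.1 hf (n + 1))

lemma mem_DPlus_of_mem_DKInf {f : ℝ → ℂ} (hf : f ∈ DKInf k hk) : f ∈ DPlus := by
  obtain ⟨g, hg, rfl⟩ := mem_DKInf.1 hf 0
  exact dualConv_mem_DPlus hk hg

lemma exists_suppIn_mul {f : ℝ → ℂ} (hf : f ∈ DPlus) {τ : ℝ} (hτ : 0 < τ) :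
    ∃ n : ℕ, SuppIn f ((n + 1 : ℕ) * τ) := by
  obtain ⟨R, -, hR⟩ := DPlus.exists_bound hf
  obtain ⟨n, hn⟩ := exists_nat_ge (R / τ)
  refine ⟨n, fun t _ ht => hR t (lt_of_le_of_lt ?_ ht)⟩
  rw [div_le_iff₀ hτ] at hn
  push_cast
  linarith

lemma SuppIn.derivPlus {f : ℝ → ℂ} {a : ℝ} (h : SuppIn f a) (ha : 0 ≤ a) :
    SuppIn (derivPlus f) a := by
  intro t ht hat
  rw [ConvSemigroup.derivPlus, indicator_of_mem (show t ∈ Ici (0 : ℝ) from ht)]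
  have h1 : f =ᶠ[𝓝[Ici 0] t] fun _ => 0 := by
    filter_upwards [mem_nhdsWithin_of_mem_nhds (Ioi_mem_nhds hat)] with s hs
    exact h.eq_zero ha s hs
  rw [h1.derivWithin_eq (h.eq_zero ha t hat), derivWithin_fun_const, Pi.zero_apply]

lemma suppIn_conv {f g : ℝ → ℂ} {a b : ℝ} (hf : SuppIn f a) (hg : SuppIn g b) :
    SuppIn (conv f g) (a + b) := by
  intro t ht hab
  refine intervalIntegral.integral_zero_ae (ae_of_all _ fun s hs => ?_)
  rw [uIoc_of_le ht] at hs
  rcases lt_or_ge b s with h | h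
  · rw [hg s hs.1.le h, mul_zero]
  · rw [hf (t - s) (by linarith [hs.2]) (by linarith), zero_mul]

end WMaps

/-! ### The operators `𝒢_k(f)` -/

section Averages

variable {X : Type*} [NormedAddCommGroup X] [NormedSpace ℂ X] {k : ℝ → ℂ} {hk : LOneLoc k}
  {τ : ℝ} {S : ℝ → X →L[ℂ] X} {A : X →ₗ.[ℂ] X}

/-- The integral `∫₀^{nτ} W_{k^{*n}} f(t) S_{k^{*n}}(t) x dt`. -/
noncomputable def testAverage (k : ℝ → ℂ) (τ : ℝ) (S : ℝ → X →L[ℂ] X) (n : ℕ) (f : ℝ → ℂ)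
    (x : X) : X :=
  ∫ t in (0 : ℝ)..(n * τ), W (convPow k n) f t • extFamily k τ S n t x

lemma testAverage_eq_integral (hτ : 0 ≤ τ) {n : ℕ} {T : ℝ → X →L[ℂ] X}
    (hext : ∀ t ∈ Icc 0 (((n + 1 : ℕ) : ℝ) * τ), ∀ x, extFamily k τ S (n + 1) t x = T t x)
    (f : ℝ → ℂ) (x : X) : testAverage k τ S (n + 1) f x =
      ∫ t in (0 : ℝ)..((n + 1 : ℕ) * τ), W (convPow k (n + 1)) f t • T t x := by
  refine intervalIntegral.integral_congr fun t ht => ?_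
  rw [uIcc_of_le (by positivity)] at ht
  simp only [hext t ht x]

/-- A linear map on `𝒟_{k^{*∞}}` is continuous if it is so on each of the steps: the topology it
induces is locally convex, hence coarser than the inductive limit topology. -/
lemma continuous_topologyDKInf {G : DKInf k hk →ₗ[ℂ] (X →L[ℂ] X)}
    (hG : ∀ a, @Continuous {f : DKInf k hk // SuppIn (f : ℝ → ℂ) a} (X →L[ℂ] X)
      (stepTopology k hk a) _ fun f => G f) : Continuous[topologyDKInf k hk, inferInstance] G := by
  refine continuous_sInf_dom (t := TopologicalSpace.induced G inferInstance) ⟨?_, ?_, ?_, ?_⟩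
    continuous_induced_dom
  · exact topologicalAddGroup_induced G
  · exact continuousSMul_induced G
  · exact LocallyConvexSpace.induced (G.restrictScalars ℝ)
  · exact fun a => continuous_induced_rng.2 (hG a)

variable [CompleteSpace X]

/-- The integrals defining `𝒢_k` exist. -/
lemma intervalIntegrable_testAverage (hτ : 0 ≤ τ) (hS : IsLocalConvSemigroup k τ S A)
    {f : ℝ → ℂ} (hf : f ∈ DKInf k hk) (n : ℕ) (x : X) :
    IntervalIntegrable (fun t => W (convPow k (n + 1)) f t • extFamily k τ S (n + 1) t x)
      volume 0 ((n + 1 : ℕ) * τ) := by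
  obtain ⟨T, hT, hext⟩ := exists_extFamily_clm hk hτ hS n
  have hL : 0 ≤ ((n + 1 : ℕ) : ℝ) * τ := by positivity
  refine ContinuousOn.intervalIntegrable ?_
  rw [uIcc_of_le hL]
  refine ContinuousOn.smul ((DPlus.continuousOn (W_mem (mem_DKInf.1 hf n))).mono
    Icc_subset_Ici_self) ((hT.continuousOn x).congr fun t ht => hext t ht x)

/-- Enlarging `n` by one does not change the average: after reflection this is
`(k * F) * S = F * (k * S)`. -/
lemma testAverage_succ (hk0 : ZeroMemSupp k) (hτ : 0 ≤ τ) (hS : IsLocalConvSemigroup k τ S A)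
    {f : ℝ → ℂ} (hf : f ∈ DKInf k hk) {n : ℕ} (hsupp : SuppIn f ((n + 1 : ℕ) * τ)) (x : X) :
    testAverage k τ S (n + 1) f x = testAverage k τ S (n + 2) f x := by
  obtain ⟨T, hT, hext⟩ := exists_extFamily_clm hk hτ hS n
  set L : ℝ := ((n + 1 : ℕ) : ℝ) * τ with hLdef
  have hL : 0 ≤ L := by positivity
  have hL' : L ≤ ((n + 2 : ℕ) : ℝ) * τ := by rw [hLdef]; push_cast; linarith
  have hLL : L ∈ Icc 0 L := ⟨hL, le_rfl⟩
  set F := W (convPow k (n + 2)) f with hF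
  have hFD : F ∈ DPlus := W_mem (mem_DKInf.1 hf (n + 1))
  have hFL : ∀ t, L < t → F t = 0 :=
    (suppIn_W (hk0.convPow hk (n + 1)) (mem_DKInf.1 hf (n + 1)) hL hsupp).eq_zero hL
  have hTc := hT.continuousOn x
  have e1 : testAverage k τ S (n + 1) f x =
      vconv (conv k fun u => F (L - u)) (fun t => T t x) L := by
    rw [testAverage, ← hLdef, vconv]
    refine intervalIntegral.integral_congr fun t ht => ?_
    rw [uIcc_of_le hL] at ht
    rw [hext t ht x, W_convPow_eq_dualConv hk0 hf, dualConv_eq_conv_reflect hFL ht]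
  have e2 : testAverage k τ S (n + 2) f x =
      ∫ t in (0 : ℝ)..L, F t • vconv k (fun s => T s x) t := by
    have h1 : IntervalIntegrable (fun t => F t • extFamily k τ S (n + 2) t x) volume 0
        (((n + 2 : ℕ) : ℝ) * τ) := intervalIntegrable_testAverage hτ hS hf (n + 1) x
    have hz : ∫ t in L..(((n + 2 : ℕ) : ℝ) * τ), F t • extFamily k τ S (n + 2) t x = 0 := by
      refine intervalIntegral.integral_zero_ae (ae_of_all _ fun t ht => ?_)
      rw [uIoc_of_le hL'] at ht
      rw [hFL t ht.1, zero_smul]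
    rw [testAverage, ← hF, ← intervalIntegral.integral_add_adjacent_intervals
      (h1.mono_set (uIcc_subset_uIcc left_mem_uIcc (mem_uIcc.2 (Or.inl ⟨hL, hL'⟩))))
      (h1.mono_set (uIcc_subset_uIcc (mem_uIcc.2 (Or.inl ⟨hL, hL'⟩)) right_mem_uIcc)), hz, add_zero]
    refine intervalIntegral.integral_congr fun t ht => ?_
    rw [uIcc_of_le hL] at ht
    simp only [extFamily]
    rw [if_pos (by have := ht.2; rw [hLdef] at this; exact_mod_cast this)]
    congr 1
    exact vconv_congr ht.1 (fun _ _ => rfl) fun s hs => hext s ⟨hs.1, hs.2.trans ht.2⟩ x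
  rw [e1, e2, integral_smul_eq_vconv_reflect,
    vconv_assoc (lOneLoc_reflect hFD L) hk hTc.bddMeasOn hLL, conv_comm]

/-- The average does not depend on the choice of `n`. -/
lemma testAverage_eq_of_le (hk0 : ZeroMemSupp k) (hτ : 0 ≤ τ) (hS : IsLocalConvSemigroup k τ S A)
    {f : ℝ → ℂ} (hf : f ∈ DKInf k hk) {n m : ℕ} (hnm : n ≤ m)
    (hsupp : SuppIn f ((n + 1 : ℕ) * τ)) (x : X) :
    testAverage k τ S (n + 1) f x = testAverage k τ S (m + 1) f x := by
  induction m, hnm using Nat.le_induction with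
  | base => rfl
  | succ m hnm ih =>
    rw [ih, testAverage_succ hk0 hτ hS hf (hsupp.mono ?_)]
    gcongr

/-- For each `f` the averages are the values of one bounded operator, the same for all admissible
`n`. -/
lemma exists_testAverage_clm (hk0 : ZeroMemSupp k) (hτ : 0 < τ) (hS : IsLocalConvSemigroup k τ S A)
    {f : ℝ → ℂ} (hf : f ∈ DKInf k hk) :
    ∃ Q : X →L[ℂ] X, ∀ n : ℕ, SuppIn f ((n + 1 : ℕ) * τ) →
      ∀ x, Q x = testAverage k τ S (n + 1) f x := by
  obtain ⟨m, hm⟩ := exists_suppIn_mul (mem_DPlus_of_mem_DKInf hf) hτ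
  obtain ⟨T, hT, hext⟩ := exists_extFamily_clm hk hτ.le hS m
  have hL : 0 ≤ ((m + 1 : ℕ) : ℝ) * τ := by positivity
  obtain ⟨Q, hQ⟩ := exists_clm_integral hT.continuousOn ⟨hL, le_rfl⟩
    ((DPlus.lOneLoc (W_mem (mem_DKInf.1 hf m))).intervalIntegrable le_rfl hL)
  have h0 : ∀ x, Q x = testAverage k τ S (m + 1) f x := fun x => by
    rw [hQ, testAverage_eq_integral hτ.le hext]
  refine ⟨Q, fun n hn x => ?_⟩
  rw [h0]
  rcases le_total n m with h | h
  · exact (testAverage_eq_of_le hk0 hτ.le hS hf h hn x).symm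
  · exact testAverage_eq_of_le hk0 hτ.le hS hf h hm x

/-- The operators `𝒢_k(f)` depend linearly on `f`: two test functions have a common `n`. -/
lemma exists_testAverage_linearMap (hk0 : ZeroMemSupp k) (hτ : 0 < τ)
    (hS : IsLocalConvSemigroup k τ S A) :
    ∃ G : DKInf k hk →ₗ[ℂ] (X →L[ℂ] X), ∀ (f : DKInf k hk) (n : ℕ),
      SuppIn (f : ℝ → ℂ) ((n + 1 : ℕ) * τ) → ∀ x, G f x = testAverage k τ S (n + 1) f x := by
  choose Q hQ using fun f : DKInf k hk => exists_testAverage_clm hk0 hτ hS f.2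
  refine ⟨{ toFun := Q, map_add' := fun f g => ?_, map_smul' := fun c f => ?_ }, hQ⟩
  · obtain ⟨n, hn⟩ := exists_suppIn_mul (mem_DPlus_of_mem_DKInf f.2) hτ
    obtain ⟨m, hm⟩ := exists_suppIn_mul (mem_DPlus_of_mem_DKInf g.2) hτ
    have hf : SuppIn (f : ℝ → ℂ) ((max n m + 1 : ℕ) * τ) :=
      hn.mono (by gcongr; exact le_max_left _ _)
    have hg : SuppIn (g : ℝ → ℂ) ((max n m + 1 : ℕ) * τ) :=
      hm.mono (by gcongr; exact le_max_right _ _)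
    have hfg : SuppIn ((f + g : DKInf k hk) : ℝ → ℂ) ((max n m + 1 : ℕ) * τ) := fun t h0 ht => by
      rw [Submodule.coe_add, Pi.add_apply, hf t h0 ht, hg t h0 ht, add_zero]
    ext x
    rw [add_apply, hQ _ _ hfg, hQ _ _ hf, hQ _ _ hg, testAverage, testAverage, testAverage,
      ← intervalIntegral.integral_add (intervalIntegrable_testAverage hτ.le hS f.2 _ x)
        (intervalIntegrable_testAverage hτ.le hS g.2 _ x), Submodule.coe_add,
      W_add (hk0.convPow hk _) (mem_DKInf.1 f.2 _) (mem_DKInf.1 g.2 _)]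
    simp only [Pi.add_apply, add_smul]
  · obtain ⟨n, hn⟩ := exists_suppIn_mul (mem_DPlus_of_mem_DKInf f.2) hτ
    have hcf : SuppIn ((c • f : DKInf k hk) : ℝ → ℂ) ((n + 1 : ℕ) * τ) := fun t h0 ht => by
      rw [Submodule.coe_smul, Pi.smul_apply, hn t h0 ht, smul_zero]
    ext x
    rw [RingHom.id_apply, smul_apply, hQ _ _ hcf, hQ _ _ hn, testAverage, testAverage,
      ← intervalIntegral.integral_smul, Submodule.coe_smul,
      W_smul (hk0.convPow hk _) c (mem_DKInf.1 f.2 _)]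
    simp only [Pi.smul_apply, smul_eq_mul, mul_smul]

/-- Continuity of `𝒢_k` on the functions supported in `[0, a]`; a single seminorm
`sup |W_{k^{*n}} f|` with `a ≤ nτ` suffices. -/
lemma continuous_stepTopology (hτ : 0 < τ) (hS : IsLocalConvSemigroup k τ S A)
    {G : DKInf k hk →ₗ[ℂ] (X →L[ℂ] X)} (hG : ∀ (f : DKInf k hk) (n : ℕ),
      SuppIn (f : ℝ → ℂ) ((n + 1 : ℕ) * τ) → ∀ x, G f x = testAverage k τ S (n + 1) f x) (a : ℝ) :
    @Continuous {f : DKInf k hk // SuppIn (f : ℝ → ℂ) a} (X →L[ℂ] X) (stepTopology k hk a) _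
      (fun f => G f) := by
  obtain ⟨n, hn⟩ := exists_nat_ge (a / τ)
  rw [div_le_iff₀ hτ] at hn
  have han : a ≤ ((n + 1 : ℕ) : ℝ) * τ := by push_cast; linarith
  obtain ⟨T, hT, hext⟩ := exists_extFamily_clm hk hτ.le hS n
  obtain ⟨C, hC0, hC⟩ := exists_norm_le_of_continuousOn hT.continuousOn
  set L : ℝ := ((n + 1 : ℕ) : ℝ) * τ with hLdef
  have hL : 0 ≤ L := by positivity
  refine continuous_iInf_dom (i := n) (continuous_iInf_dom (i := 0) ?_)
  set Φ : {f : DKInf k hk // SuppIn (f : ℝ → ℂ) a} → UniformFun (Ici (0 : ℝ)) ℂ :=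
    fun f => UniformFun.ofFun fun t : Ici (0 : ℝ) =>
      iteratedDerivWithin 0 (W (convPow k (n + 1)) (f : DKInf k hk)) (Ici 0) (t : ℝ) with hΦ
  let _ : TopologicalSpace {f : DKInf k hk // SuppIn (f : ℝ → ℂ) a} :=
    TopologicalSpace.induced Φ inferInstance
  have hΦc : Continuous Φ := continuous_induced_dom
  refine continuous_iff_continuousAt.2 fun f₀ => Metric.tendsto_nhds.2 fun ε hε => ?_
  have h1 := UniformFun.tendsto_iff_tendstoUniformly.1 (hΦc.tendsto f₀)
  have hδ : 0 < ε / (C * L + 1) := by positivity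
  filter_upwards [Metric.tendstoUniformly_iff.1 h1 _ hδ] with f hf
  have hdiff : ∀ t ∈ Icc 0 L, ‖W (convPow k (n + 1)) (f : DKInf k hk) t -
      W (convPow k (n + 1)) (f₀ : DKInf k hk) t‖ ≤ ε / (C * L + 1) := fun t ht => by
    have := hf ⟨t, ht.1⟩
    simp only [hΦ, Function.comp_apply, UniformFun.toFun_ofFun, iteratedDerivWithin_zero] at this
    rw [dist_comm, dist_eq_norm] at this
    exact this.le
  have hle : ‖G f - G f₀‖ ≤ ε / (C * L + 1) * C * L := by
    refine ContinuousLinearMap.opNorm_le_bound _ (by positivity) fun x => ?_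
    rw [sub_apply, hG _ n (f.2.mono han), hG _ n (f₀.2.mono han), testAverage, testAverage,
      ← intervalIntegral.integral_sub (intervalIntegrable_testAverage hτ.le hS f.1.2 n x)
        (intervalIntegrable_testAverage hτ.le hS f₀.1.2 n x)]
    have := intervalIntegral.norm_integral_le_of_norm_le_const (a := 0) (b := L)
      (C := ε / (C * L + 1) * (C * ‖x‖)) (f := fun t =>
        W (convPow k (n + 1)) (f : DKInf k hk) t • extFamily k τ S (n + 1) t x -
        W (convPow k (n + 1)) (f₀ : DKInf k hk) t • extFamily k τ S (n + 1) t x)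
      fun t ht => by
        rw [uIoc_of_le hL] at ht
        have ht' := Ioc_subset_Icc_self ht
        rw [← sub_smul, norm_smul, hext t ht' x]
        exact mul_le_mul (hdiff t ht') ((T t).le_of_opNorm_le (hC t ht') x) (norm_nonneg _) hδ.le
    rw [sub_zero, abs_of_nonneg hL] at this
    refine this.trans_eq (by ring)
  rw [dist_eq_norm]
  refine hle.trans_lt ?_
  rw [mul_assoc, div_mul_eq_mul_div, div_lt_iff₀ (by positivity)]
  linarith

/-- Multiplicativity of `𝒢_k`, from `average_mul` on an interval that contains the sum of the
supports. -/
lemma map_conv_of_eq_testAverage (hk0 : ZeroMemSupp k) (hτ : 0 < τ)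
    (hS : IsLocalConvSemigroup k τ S A) {G : DKInf k hk →ₗ[ℂ] (X →L[ℂ] X)}
    (hG : ∀ (f : DKInf k hk) (n : ℕ),
      SuppIn (f : ℝ → ℂ) ((n + 1 : ℕ) * τ) → ∀ x, G f x = testAverage k τ S (n + 1) f x)
    (f g : DKInf k hk) : ∃ hfg : conv f g ∈ DKInf k hk, G ⟨conv f g, hfg⟩ = (G f).comp (G g) := by
  have hfg := conv_mem_DKInf f.2 g.2
  refine ⟨hfg, ?_⟩
  obtain ⟨n, hn⟩ := exists_suppIn_mul (mem_DPlus_of_mem_DKInf f.2) hτ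
  obtain ⟨m, hm⟩ := exists_suppIn_mul (mem_DPlus_of_mem_DKInf g.2) hτ
  have ha : 0 ≤ ((n + 1 : ℕ) : ℝ) * τ := by positivity
  have hb : 0 ≤ ((m + 1 : ℕ) : ℝ) * τ := by positivity
  have hab : ((n + 1 : ℕ) : ℝ) * τ + ((m + 1 : ℕ) : ℝ) * τ = ((n + m + 1 + 1 : ℕ) : ℝ) * τ := by
    push_cast; ring
  have hsf := hn.mono ((le_add_of_nonneg_right hb).trans_eq hab)
  have hsg := hm.mono ((le_add_of_nonneg_left ha).trans_eq hab)
  have hsfg := (suppIn_conv hn hm).mono hab.le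
  have hl0 := hk0.convPow hk (n + m + 1)
  have hfW := mem_DKInf.1 f.2 (n + m + 1)
  have hgW := mem_DKInf.1 g.2 (n + m + 1)
  have hfgW := mem_DKInf.1 hfg (n + m + 1)
  ext x
  rw [hG ⟨_, hfg⟩ (n + m + 1) hsfg, ContinuousLinearMap.comp_apply, hG f (n + m + 1) hsf,
    hG g (n + m + 1) hsg]
  obtain ⟨T, hT, hext⟩ := exists_extFamily_clm hk hτ.le hS (n + m + 1)
  rw [testAverage_eq_integral hτ.le hext, testAverage_eq_integral hτ.le hext,
    testAverage_eq_integral hτ.le hext]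
  have hL : 0 < ((n + m + 1 + 1 : ℕ) : ℝ) * τ := by positivity
  refine average_mul (hk.convPow _) hl0 hL hT (W_mem hfW) (W_mem hgW) (W_mem hfgW) hb hab.le
    ((suppIn_W hl0 hfW ha hn).eq_zero ha) ((suppIn_W hl0 hgW hb hm).eq_zero hb)
    ((suppIn_W hl0 hfgW hL.le hsfg).eq_zero hL.le) ha ?_ x
  rw [dualConv_W hfW, dualConv_W hgW, dualConv_W hfgW]

/-- The generator applied to `𝒢_k(f) x`. -/
lemma map_derivPlus_of_eq_testAverage (hk0 : ZeroMemSupp k) (hτ : 0 < τ)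
    (hS : IsLocalConvSemigroup k τ S A)
    {G : DKInf k hk →ₗ[ℂ] (X →L[ℂ] X)} (hG : ∀ (f : DKInf k hk) (n : ℕ),
      SuppIn (f : ℝ → ℂ) ((n + 1 : ℕ) * τ) → ∀ x, G f x = testAverage k τ S (n + 1) f x)
    (f : DKInf k hk) : ∃ hf' : derivPlus f ∈ DKInf k hk, ∀ x : X, ∃ hx : G f x ∈ A.domain,
      A ⟨G f x, hx⟩ = -(G ⟨derivPlus f, hf'⟩ x) - (f : ℝ → ℂ) 0 • x := by
  have hf' := derivPlus_mem_DKInf f.2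
  refine ⟨hf', fun x => ?_⟩
  obtain ⟨n, hn⟩ := exists_suppIn_mul (mem_DPlus_of_mem_DKInf f.2) hτ
  obtain ⟨T, hT, hext⟩ := exists_extFamily_clm hk hτ.le hS n
  have hL : 0 ≤ ((n + 1 : ℕ) : ℝ) * τ := by positivity
  have hl0 := hk0.convPow hk n
  have hfW := mem_DKInf.1 f.2 n
  have h := average_derivPlus_mem_graph (hk.convPow n) hL hT (W_mem hfW)
    ((suppIn_W hl0 hfW hL hn).eq_zero hL) x
  rw [← W_derivPlus hl0 hfW, dualConv_W hfW, ← testAverage_eq_integral hτ.le hext,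
    ← testAverage_eq_integral hτ.le hext, ← hG f n hn, ← hG ⟨_, hf'⟩ n (hn.derivPlus hL)] at h
  rw [LinearPMap.mem_graph_iff] at h
  obtain ⟨y, hyf, hy⟩ : ∃ y : A.domain, (y : X) = G f x ∧
      A y = -(G ⟨derivPlus f, hf'⟩ x) - (f : ℝ → ℂ) 0 • x := h
  have hx : G f x ∈ A.domain := by rw [← hyf]; exact y.2
  have hyx : y = ⟨G f x, hx⟩ := Subtype.ext hyf
  exact ⟨hx, by rw [← hyx, hy]⟩

end Averages

end ConvSemigroup

theorem mainTheorem2 {X : Type*} [NormedAddCommGroup X] [NormedSpace ℂ X] [CompleteSpace X]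
    (k : ℝ → ℂ) (hk : ConvSemigroup.LOneLoc k) (hk0 : ConvSemigroup.ZeroMemSupp k)
    (τ : ℝ) (hτ : 0 < τ) (S : ℝ → X →L[ℂ] X) (A : X →ₗ.[ℂ] X)
    (hS : ConvSemigroup.IsLocalConvSemigroup k τ S A)
    (hnd : ConvSemigroup.NonDegenerate τ S) :
    ∃ G : ConvSemigroup.DKInf k hk →ₗ[ℂ] (X →L[ℂ] X),
      -- every `f` has support in some `[0, nτ]`, and any such `n` gives the same `G f`
      (∀ f : ConvSemigroup.DKInf k hk,
        ∃ n : ℕ, 1 ≤ n ∧ ConvSemigroup.SuppIn (f : ℝ → ℂ) (n * τ)) ∧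
      (∀ (f : ConvSemigroup.DKInf k hk) (n : ℕ), 1 ≤ n →
        ConvSemigroup.SuppIn (f : ℝ → ℂ) (n * τ) → ∀ x : X,
          IntervalIntegrable
            (fun t => ConvSemigroup.W (ConvSemigroup.convPow k n) f t •
              ConvSemigroup.extFamily k τ S n t x) volume 0 (n * τ) ∧
          G f x = ∫ t in (0 : ℝ)..(n * τ),
            ConvSemigroup.W (ConvSemigroup.convPow k n) f t •
              ConvSemigroup.extFamily k τ S n t x) ∧
      Continuous[ConvSemigroup.topologyDKInf k hk, inferInstance] G ∧
      (∀ f g : ConvSemigroup.DKInf k hk,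
        ∃ hfg : ConvSemigroup.conv f g ∈ ConvSemigroup.DKInf k hk,
          G ⟨ConvSemigroup.conv f g, hfg⟩ = (G f).comp (G g)) ∧
      (∀ f : ConvSemigroup.DKInf k hk,
        ∃ hf' : ConvSemigroup.derivPlus f ∈ ConvSemigroup.DKInf k hk, ∀ x : X,
          ∃ hx : G f x ∈ A.domain,
            A ⟨G f x, hx⟩ =
              -(G ⟨ConvSemigroup.derivPlus f, hf'⟩ x) - (f : ℝ → ℂ) 0 • x) := by
  obtain ⟨G, hG⟩ := ConvSemigroup.exists_testAverage_linearMap (hk := hk) hk0 hτ hS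
  refine ⟨G, fun f => ?_, fun f n hn hf x => ?_,
    ConvSemigroup.continuous_topologyDKInf (ConvSemigroup.continuous_stepTopology hτ hS hG),
    ConvSemigroup.map_conv_of_eq_testAverage hk0 hτ hS hG,
    ConvSemigroup.map_derivPlus_of_eq_testAverage hk0 hτ hS hG⟩
  · obtain ⟨n, hn⟩ := ConvSemigroup.exists_suppIn_mul (ConvSemigroup.mem_DPlus_of_mem_DKInf f.2) hτ
    exact ⟨n + 1, by omega, hn⟩
  · obtain ⟨m, rfl⟩ := Nat.exists_eq_add_of_le' hn
    exact ⟨ConvSemigroup.intervalIntegrable_testAverage hτ.le hS f.2 m x, hG f m hf x⟩
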